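/- Let $K$ be a primitive quartic CM field, i.e. a totally imaginary quadratic extension of a real quadratic field $K_0$ that contains no imaginary quadratic subfield. Let $\omega\in K_0$ be such that $\mathcal{O}_{K_0}=\mathbf{Z}[\omega]$, let $\omega'$ be its conjugate over $\mathbf{Q}$, and put $\delta=\omega-\omega'$ (a square root of the discriminant of $K_0$). Let $\mathcal{H}_2$ be the Siegel upper half space of symmetric complex $2\times 2$ matrices with positive definite imaginary part; a matrix $Z\in\mathcal{H}_2$ gives the principally polarized abelian surface $\mathbf{C}^2/(Z\mathbf{Z}^2+\mathbf{Z}^2)$ with the polarization for which the columns of $Z$ followed by the standard basis vectors form a symplectic basis. For $z\in K\setminus K_0$ let $\psi_1,\psi_2$ be the embeddings $K\to\mathbf{C}$ with $\psi_1(\omega)>\psi_2(\omega)$ and $\operatorname{Im}\psi_1(z)>0>\operatorname{Im}\psi_2(z)$, and put $$Z_z=(\psi_1+\psi_2)\left(z\delta^{-1}\begin{pmatrix}\omega^2&\omega\\ \omega&1\end{pmatrix}\right).$$ A principally polarized abelian surface over $\mathbf{C}$ is said to have CM by $\mathcal{O}_K$ if there is an embedding of $\mathcal{O}_K$ into its endomorphism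 ring. Let $\Phi=\{\phi_1,\phi_2\}$ be a CM type of $K$, let $\epsilon\in\mathcal{O}_{K_0}^*$ be such that $\langle -1\rangle\times\langle\epsilon\rangle$ has odd index in $\mathcal{O}_{K_0}^*$, and let $\mathcal{K}'\subset K$ be such that $z\mapsto z\mathcal{O}_{K_0}+\mathcal{O}_{K_0}$ maps $\mathcal{K}'$ to fractional $\mathcal{O}_K$-ideals and gives a bijection from $\mathcal{K}'$ to the set of ideal classes of $K$ that contain an ideal of the form $z\mathcal{O}_{K_0}+\mathcal{O}_{K_0}$ with $z\in K$. Put $\mathcal{K}=\pm\mathcal{K}'\cup\pm\epsilon\mathcal{K}'$. Then 1. if $K$ is cyclic Galois over $\mathbf{Q}$, the set $\{Z_z \mid z\in\mathcal{K},\ \operatorname{Im}\phi_1 z>0>\operatorname{Im}\phi_2 z\}$, 2. if $K$ is not Galois over $\mathbf{Q}$, the set $\{Z_z \mid z\in\mathcal{K},\ \operatorname{Im}\phi_1 z>0\}$ is a subset of $\mathcal{H}_2$ and is a complete set of representatives of the isomorphism classes of principally polarized abelian surfaces over $\mathbf{C}$ with CM by $\mathcal{O}_K$: each of its elements gives such a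 surface, and every such surface is isomorphic to the one given by exactly one element of the set. -/

import Mathlib

open NumberField
open scoped nonZeroDivisors

noncomputable section

namespace CMSurface

/-! ### Principally polarized abelian varieties over the complex numbers -/

/-- A principally polarized complex abelian variety of dimension `g`: a complex torus
`ℂ^g / Λ` with an alternating real bilinear form `E` that is integral on `Λ`, satisfies
`E(iu,iv) = E(u,v)`, is positive (`E(iu,u) > 0` for `u ≠ 0`), and has degree one, i.e. its
matrix with respect to a `ℤ`-basis of `Λ` has determinant one. -/
structure PPAV (g : ℕ) where
  lattice : Submodule ℤ (Fin g → ℂ)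
  discrete : DiscreteTopology lattice
  full : Submodule.span ℝ (lattice : Set (Fin g → ℂ)) = ⊤
  form : (Fin g → ℂ) →ₗ[ℝ] (Fin g → ℂ) →ₗ[ℝ] ℝ
  alternating : ∀ u, form u u = 0
  integral : ∀ u ∈ lattice, ∀ v ∈ lattice, ∃ n : ℤ, form u v = n
  compatible : ∀ u v, form (Complex.I • u) (Complex.I • v) = form u v
  positive : ∀ u, u ≠ 0 → 0 < form (Complex.I • u) u
  principal : ∃ b : Module.Basis (Fin g ⊕ Fin g) ℤ lattice,
    (Matrix.of fun i j => form (b i) (b j)).det = 1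

/-- Isomorphism of principally polarized abelian varieties. -/
def PPAV.Isomorphic {g : ℕ} (A B : PPAV g) : Prop :=
  ∃ f : (Fin g → ℂ) ≃ₗ[ℂ] (Fin g → ℂ),
    f '' (A.lattice : Set (Fin g → ℂ)) = (B.lattice : Set (Fin g → ℂ)) ∧
    ∀ u v, B.form (f u) (f v) = A.form u v

/-- The endomorphism ring of the torus `ℂ^g / Λ`: the `ℂ`-linear maps `ℂ^g → ℂ^g` that map
`Λ` into itself. -/
def PPAV.endRing {g : ℕ} (A : PPAV g) : Subring (Module.End ℂ (Fin g → ℂ)) where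
  carrier := {f | ∀ x ∈ A.lattice, f x ∈ A.lattice}
  mul_mem' hf hg x hx := hf _ (hg x hx)
  one_mem' _ hx := hx
  add_mem' hf hg x hx := A.lattice.add_mem (hf x hx) (hg x hx)
  zero_mem' _ _ := A.lattice.zero_mem
  neg_mem' hf x hx := A.lattice.neg_mem (hf x hx)

/-- `A` has complex multiplication by the ring of integers of the field `K`. -/
def PPAV.HasCM {g : ℕ} (A : PPAV g) (K : Type*) [Field K] [NumberField K] : Prop :=
  Module.finrank ℚ K = 2 * g ∧ ∃ ι : 𝓞 K →+* A.endRing, Function.Injective ι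

/-! ### The Siegel upper half space and the abelian variety of a period matrix -/

/-- The imaginary part of a complex matrix. -/
def imPart {g : ℕ} (Z : Matrix (Fin g) (Fin g) ℂ) : Matrix (Fin g) (Fin g) ℝ :=
  Z.map Complex.im

/-- The Siegel upper half space of symmetric complex matrices with positive definite imaginary
part. -/
def siegelUpperHalfSpace (g : ℕ) : Set (Matrix (Fin g) (Fin g) ℂ) :=
  {Z | Z.IsSymm ∧ (imPart Z).PosDef}

/-- The columns of `Z`, followed by the standard basis vectors. -/
def periodVectors {g : ℕ} (Z : Matrix (Fin g) (Fin g) ℂ) : Fin g ⊕ Fin g → (Fin g → ℂ) :=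
  Sum.elim (fun j i => Z i j) (fun j => Pi.single j 1)

/-- The real bilinear form on `ℂ^g` for which the vectors `periodVectors Z` form a symplectic
basis. It is the imaginary part of the Hermitian form `(u, v) ↦ uᵗ (Im Z)⁻¹ v̄`. -/
def periodForm {g : ℕ} (Z : Matrix (Fin g) (Fin g) ℂ) :
    (Fin g → ℂ) →ₗ[ℝ] (Fin g → ℂ) →ₗ[ℝ] ℝ :=
  LinearMap.mk₂ ℝ
    (fun u v =>
      (fun i => (u i).im) ⬝ᵥ (imPart Z)⁻¹.mulVec (fun i => (v i).re) -
      (fun i => (u i).re) ⬝ᵥ (imPart Z)⁻¹.mulVec (fun i => (v i).im))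
    (by
      intro u u' v
      simp only [Pi.add_apply, Complex.add_im, Complex.add_re]
      simp only [← Pi.add_def, add_dotProduct]
      ring)
    (by
      intro c u v
      simp only [Pi.smul_apply, Complex.smul_im, Complex.smul_re]
      have h : ∀ p q : Fin g → ℝ, (fun i => c • p i) ⬝ᵥ q = c * (p ⬝ᵥ q) :=
        fun p q => smul_dotProduct c p q
      rw [h, h, smul_eq_mul]
      ring)
    (by
      intro u v v'
      simp only [Pi.add_apply, Complex.add_im, Complex.add_re]
      simp only [← Pi.add_def, Matrix.mulVec_add, dotProduct_add]
      ring)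
    (by
      intro c u v
      simp only [Pi.smul_apply, Complex.smul_im, Complex.smul_re]
      have h : ∀ p q : Fin g → ℝ, p ⬝ᵥ (imPart Z)⁻¹.mulVec (fun i => c • q i) =
          c * (p ⬝ᵥ (imPart Z)⁻¹.mulVec q) := fun p q => by
        rw [show (fun i => c • q i) = c • q from rfl, Matrix.mulVec_smul, dotProduct_smul,
          smul_eq_mul]
      rw [h, h, smul_eq_mul]
      ring)

theorem periodForm_apply {g : ℕ} (Z : Matrix (Fin g) (Fin g) ℂ) (u v : Fin g → ℂ) :
    periodForm Z u v =
      (fun i => (u i).im) ⬝ᵥ (imPart Z)⁻¹.mulVec (fun i => (v i).re) -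
      (fun i => (u i).re) ⬝ᵥ (imPart Z)⁻¹.mulVec (fun i => (v i).im) := rfl

theorem dot_imPart_inv_comm {g : ℕ} {Z : Matrix (Fin g) (Fin g) ℂ}
    (hZ : Z ∈ siegelUpperHalfSpace g) (p q : Fin g → ℝ) :
    p ⬝ᵥ (imPart Z)⁻¹.mulVec q = q ⬝ᵥ (imPart Z)⁻¹.mulVec p := by
  have hs : ((imPart Z)⁻¹).transpose = (imPart Z)⁻¹ := by
    have := hZ.2.inv.isHermitian
    simpa [Matrix.IsHermitian, Matrix.conjTranspose_eq_transpose_of_trivial] using this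
  rw [Matrix.dotProduct_mulVec, ← Matrix.mulVec_transpose, hs, dotProduct_comm]

theorem imPart_inv_mulVec_col {g : ℕ} {Z : Matrix (Fin g) (Fin g) ℂ}
    (hZ : Z ∈ siegelUpperHalfSpace g) (j : Fin g) :
    (imPart Z)⁻¹.mulVec (fun i => (Z i j).im) = Pi.single j 1 := by
  have hu : IsUnit (imPart Z).det := isUnit_iff_ne_zero.2 hZ.2.det_pos.ne'
  have h1 : (fun i => (Z i j).im) = (imPart Z).mulVec (Pi.single j 1) := by
    ext i; simp [imPart]
  rw [h1, Matrix.mulVec_mulVec, Matrix.nonsing_inv_mul _ hu, Matrix.one_mulVec]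

/-- The period vectors form a symplectic basis for the period form. -/
theorem periodForm_periodVectors {g : ℕ} {Z : Matrix (Fin g) (Fin g) ℂ}
    (hZ : Z ∈ siegelUpperHalfSpace g) :
    (Matrix.of fun i j => periodForm Z (periodVectors Z i) (periodVectors Z j)) =
      Matrix.fromBlocks 0 1 (-1) 0 := by
  have hre : ∀ j : Fin g, (fun i => ((Pi.single j 1 : Fin g → ℂ) i).re) = Pi.single j 1 := by
    intro j; ext i; by_cases h : i = j
    · subst h; simp
    · simp [h]
  have him : ∀ j : Fin g, (fun i => ((Pi.single j 1 : Fin g → ℂ) i).im) = 0 := by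
    intro j; ext i; by_cases h : i = j
    · subst h; simp
    · simp [h]
  ext (j | j) (k | k)
  · simp only [Matrix.of_apply, periodForm_apply, periodVectors, Sum.elim_inl,
      Matrix.fromBlocks_apply₁₁, Matrix.zero_apply]
    rw [dot_imPart_inv_comm hZ (fun i => (Z i j).im), imPart_inv_mulVec_col hZ,
      imPart_inv_mulVec_col hZ]
    have := hZ.1.apply j k
    simp [this]
  · simp only [Matrix.of_apply, periodForm_apply, periodVectors, Sum.elim_inl, Sum.elim_inr,
      Matrix.fromBlocks_apply₁₂]
    rw [dot_imPart_inv_comm hZ (fun i => (Z i j).im), imPart_inv_mulVec_col hZ, hre, him]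
    simp [Matrix.one_apply, Pi.single_apply]
  · simp only [Matrix.of_apply, periodForm_apply, periodVectors, Sum.elim_inl, Sum.elim_inr,
      Matrix.fromBlocks_apply₂₁]
    rw [imPart_inv_mulVec_col hZ, hre, him]
    simp [Matrix.one_apply, Pi.single_apply, eq_comm]
  · simp only [Matrix.of_apply, periodForm_apply, periodVectors, Sum.elim_inr,
      Matrix.fromBlocks_apply₂₂, Matrix.zero_apply]
    rw [him, him]
    simp

theorem det_symplectic (g : ℕ) :
    (Matrix.fromBlocks 0 1 (-1) 0 : Matrix (Fin g ⊕ Fin g) (Fin g ⊕ Fin g) ℝ).det = 1 := by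
  have h : (Matrix.fromBlocks 0 1 (-1) 0 : Matrix (Fin g ⊕ Fin g) (Fin g ⊕ Fin g) ℝ) =
      Matrix.fromBlocks 1 1 0 1 * Matrix.fromBlocks 1 0 (-1) 1 * Matrix.fromBlocks 1 1 0 1 := by
    simp [Matrix.fromBlocks_multiply]
  rw [h, Matrix.det_mul, Matrix.det_mul, Matrix.det_fromBlocks_zero₂₁,
    Matrix.det_fromBlocks_zero₁₂]
  simp

theorem linearIndependent_periodVectors {g : ℕ} {Z : Matrix (Fin g) (Fin g) ℂ}
    (hZ : Z ∈ siegelUpperHalfSpace g) : LinearIndependent ℝ (periodVectors Z) := by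
  rw [Fintype.linearIndependent_iff]
  intro c hc
  have hval : ∀ i, ∑ k, c k * periodForm Z (periodVectors Z k) (periodVectors Z i) = 0 := by
    intro i
    have := congrArg (fun w => periodForm Z w (periodVectors Z i)) hc
    simpa using this
  have hM : ∀ k i, periodForm Z (periodVectors Z k) (periodVectors Z i) =
      (Matrix.fromBlocks 0 1 (-1) 0 : Matrix (Fin g ⊕ Fin g) (Fin g ⊕ Fin g) ℝ) k i := by
    intro k i
    rw [← periodForm_periodVectors hZ]; rfl
  rintro (j | j)
  · have := hval (Sum.inr j)
    simpa [hM, Fintype.sum_sum_type, Matrix.one_apply] using this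
  · have := hval (Sum.inl j)
    simpa [hM, Fintype.sum_sum_type, Matrix.one_apply] using this

/-- The period vectors as a real basis of `ℂ^g`. -/
def periodBasis {g : ℕ} {Z : Matrix (Fin g) (Fin g) ℂ} (hZ : Z ∈ siegelUpperHalfSpace g) :
    Module.Basis (Fin g ⊕ Fin g) ℝ (Fin g → ℂ) :=
  basisOfLinearIndependentOfCardEqFinrank' _ (linearIndependent_periodVectors hZ)
    (by rw [Module.finrank_pi_fintype]; simp [Complex.finrank_real_complex, mul_two])

theorem coe_periodBasis {g : ℕ} {Z : Matrix (Fin g) (Fin g) ℂ}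
    (hZ : Z ∈ siegelUpperHalfSpace g) : ⇑(periodBasis hZ) = periodVectors Z := by
  simp [periodBasis]

/-- The principally polarized abelian variety `ℂ^g / (Z ℤ^g + ℤ^g)` of a period matrix `Z`, with
the polarization for which the columns of `Z`, followed by the standard basis vectors, form a
symplectic basis. -/
def ofPeriodMatrix {g : ℕ} (Z : Matrix (Fin g) (Fin g) ℂ) (hZ : Z ∈ siegelUpperHalfSpace g) :
    PPAV g where
  lattice := Submodule.span ℤ (Set.range (periodVectors Z))
  discrete := by
    rw [← coe_periodBasis hZ]; infer_instance
  full := by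
    rw [← coe_periodBasis hZ]; exact ZSpan.span_top _
  form := periodForm Z
  alternating u := by
    rw [periodForm_apply, dot_imPart_inv_comm hZ, sub_self]
  integral u hu v hv := by
    have hM : ∀ k i, ∃ n : ℤ, periodForm Z (periodVectors Z k) (periodVectors Z i) = n := by
      intro k i
      have : periodForm Z (periodVectors Z k) (periodVectors Z i) =
        (Matrix.fromBlocks 0 1 (-1) 0 : Matrix (Fin g ⊕ Fin g) (Fin g ⊕ Fin g) ℝ) k i := by
        rw [← periodForm_periodVectors hZ]; rfl
      rw [this]
      rcases k with k | k <;> rcases i with i | i <;>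
        simp only [Matrix.fromBlocks_apply₁₁, Matrix.fromBlocks_apply₁₂,
          Matrix.fromBlocks_apply₂₁, Matrix.fromBlocks_apply₂₂, Matrix.zero_apply,
          Matrix.neg_apply, Matrix.one_apply]
      · exact ⟨0, by simp⟩
      · exact ⟨if k = i then 1 else 0, by split_ifs <;> simp⟩
      · exact ⟨-(if k = i then 1 else 0), by split_ifs <;> simp⟩
      · exact ⟨0, by simp⟩
    induction hu using Submodule.span_induction with
    | zero => exact ⟨0, by simp⟩
    | add x y _ _ hx hy =>
      obtain ⟨m, hm⟩ := hx
      obtain ⟨n, hn⟩ := hy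
      exact ⟨m + n, by simp [hm, hn]⟩
    | smul a x _ hx =>
      obtain ⟨m, hm⟩ := hx
      exact ⟨a * m, by rw [map_zsmul, LinearMap.smul_apply, hm]; simp⟩
    | mem x hx =>
      obtain ⟨k, rfl⟩ := hx
      induction hv using Submodule.span_induction with
      | zero => exact ⟨0, by simp⟩
      | add x y _ _ hx hy =>
        obtain ⟨m, hm⟩ := hx
        obtain ⟨n, hn⟩ := hy
        exact ⟨m + n, by simp [hm, hn]⟩
      | smul a x _ hx =>
        obtain ⟨m, hm⟩ := hx
        exact ⟨a * m, by rw [map_zsmul, hm]; simp⟩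
      | mem y hy =>
        obtain ⟨i, rfl⟩ := hy
        exact hM k i
  compatible u v := by
    simp only [periodForm_apply, Pi.smul_apply, smul_eq_mul, Complex.mul_re, Complex.mul_im,
      Complex.I_re, Complex.I_im, zero_mul, one_mul, zero_sub, zero_add]
    simp only [← Pi.neg_def, Matrix.mulVec_neg, neg_dotProduct, dotProduct_neg]
    ring
  positive u hu := by
    simp only [periodForm_apply, Pi.smul_apply, smul_eq_mul, Complex.mul_re, Complex.mul_im,
      Complex.I_re, Complex.I_im, zero_mul, one_mul, zero_sub, zero_add]
    simp only [← Pi.neg_def, neg_dotProduct, sub_neg_eq_add]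
    have hinv := hZ.2.inv
    have hnn : ∀ p : Fin g → ℝ, 0 ≤ p ⬝ᵥ (imPart Z)⁻¹.mulVec p := by
      intro p; simpa using hinv.posSemidef.dotProduct_mulVec_nonneg p
    have hpos : ∀ p : Fin g → ℝ, p ≠ 0 → 0 < p ⬝ᵥ (imPart Z)⁻¹.mulVec p := by
      intro p hp; simpa using hinv.dotProduct_mulVec_pos hp
    by_cases h : (fun i => (u i).re) = 0
    · refine add_pos_of_nonneg_of_pos (hnn _) (hpos _ ?_)
      intro h'
      exact hu (funext fun i => Complex.ext (congrFun h i) (congrFun h' i))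
    · exact add_pos_of_pos_of_nonneg (hpos _ h) (hnn _)
  principal := by
    refine ⟨Module.Basis.span ((linearIndependent_periodVectors hZ).restrict_scalars' ℤ), ?_⟩
    simp only [Module.Basis.span_apply]
    rw [periodForm_periodVectors hZ, det_symplectic]

/-- A set `S` of complex `g × g` matrices is a complete set of representatives for the
isomorphism classes of principally polarized abelian varieties with CM by the ring of integers
of `K`: its elements are period matrices of such varieties, and every such variety is isomorphic
to the one given by exactly one element of `S`. -/
def IsCompleteSetOfCMPeriodMatrices {g : ℕ} (S : Set (Matrix (Fin g) (Fin g) ℂ))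
    (K : Type*) [Field K] [NumberField K] : Prop :=
  ∃ hS : S ⊆ siegelUpperHalfSpace g,
    (∀ Z (hZ : Z ∈ S), (ofPeriodMatrix Z (hS hZ)).HasCM K) ∧
    ∀ A : PPAV g, A.HasCM K →
      ∃! Z : S, A.Isomorphic (ofPeriodMatrix Z.1 (hS Z.2))

/-! ### CM fields and CM types -/

/-- A quartic CM field without imaginary quadratic subfields. -/
structure IsPrimitiveQuarticCMField (K : Type*) [Field K] [NumberField K] : Prop where
  isCMField : IsCMField K
  finrank_eq : Module.finrank ℚ K = 4
  primitive : ¬ ∃ F : IntermediateField ℚ K, Module.finrank ℚ F = 2 ∧ IsTotallyComplex F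

/-- A CM type of a field of degree `2g`: a set `Φ` of `g` embeddings into `ℂ` such that `Φ`
and its complex conjugate together are all embeddings. -/
def IsCMType {K : Type*} [Field K] [NumberField K] (Φ : Set (K →+* ℂ)) : Prop :=
  2 * Φ.ncard = Module.finrank ℚ K ∧ Φ ∪ ComplexEmbedding.conjugate '' Φ = Set.univ

/-- The class `C` of the class group of `K` contains an ideal equal to `z 𝓞_{K₀} + 𝓞_{K₀}`, where
`K₀` is the maximal real subfield. (In particular the latter is a fractional `𝓞 K`-ideal.) -/
def IsIdealClassOf {K : Type*} [Field K] [NumberField K] (z : K) (C : ClassGroup (𝓞 K)) : Prop :=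
  ∃ I : (FractionalIdeal (𝓞 K)⁰ K)ˣ,
    ((I : FractionalIdeal (𝓞 K)⁰ K) : Set K) =
      {x | ∃ a b : 𝓞 (maximalRealSubfield K),
        x = z * ((a : maximalRealSubfield K) : K) + ((b : maximalRealSubfield K) : K)} ∧
    ClassGroup.mk K I = C

/-- The ideals `z 𝓞_{K₀} + 𝓞_{K₀}` for `z ∈ R` represent, each exactly once, the ideal classes of
`K` that contain an ideal of this form. -/
def RepresentsIdealClasses {K : Type*} [Field K] [NumberField K] (R : Set K) : Prop :=
  (∀ z ∈ R, ∃ C, IsIdealClassOf z C) ∧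
  ∀ C : ClassGroup (𝓞 K), (∃ z : K, IsIdealClassOf z C) → ∃! z, z ∈ R ∧ IsIdealClassOf z C

/-- The set `±R ∪ ±εR`. -/
def signedMultiples {K : Type*} [Field K] [NumberField K]
    (ε : (𝓞 (maximalRealSubfield K))ˣ) (R : Set K) : Set K :=
  {x | ∃ z ∈ R, x = z ∨ x = -z ∨
    x = (((ε : 𝓞 (maximalRealSubfield K)) : maximalRealSubfield K) : K) * z ∨
    x = -((((ε : 𝓞 (maximalRealSubfield K)) : maximalRealSubfield K) : K) * z)}

/-- For real quadratic `K₀` and `𝓞_{K₀} = ℤ[ω]` this is `δ = ω - ω'`, where `ω'` is the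
conjugate of `ω` over `ℚ`. It is the square root of the discriminant of `K₀` that is positive in
the real embedding in which `ω` is largest. -/
def delta {K : Type*} [Field K] [NumberField K] (ω : 𝓞 (maximalRealSubfield K)) : K :=
  2 * ((ω : maximalRealSubfield K) : K) -
    algebraMap ℚ K (Algebra.trace ℚ (maximalRealSubfield K) (ω : maximalRealSubfield K))

/-- `(ψ₁ + ψ₂)(z δ⁻¹ [[ω², ω], [ω, 1]])`, the embeddings being applied entrywise. -/
def embeddingSumMatrix {K : Type*} [Field K] [NumberField K]
    (ω : 𝓞 (maximalRealSubfield K)) (ψ₁ ψ₂ : K →+* ℂ) (z : K) : Matrix (Fin 2) (Fin 2) ℂ :=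
  let w : K := ((ω : maximalRealSubfield K) : K)
  let N : Matrix (Fin 2) (Fin 2) K := (z * (delta ω)⁻¹) • !![w ^ 2, w; w, 1]
  N.map ψ₁ + N.map ψ₂

/-- `Z` is the matrix `Z_z = (ψ₁ + ψ₂)(z δ⁻¹ [[ω², ω], [ω, 1]])`, where `ψ₁, ψ₂` are the
embeddings of `K` with `ψ₁ ω > ψ₂ ω` and `Im ψ₁ z > 0 > Im ψ₂ z`. (The element `ω` is totally
real, so that its images are compared through their real parts.) -/
def IsPeriodMatrixOf {K : Type*} [Field K] [NumberField K]
    (ω : 𝓞 (maximalRealSubfield K)) (z : K) (Z : Matrix (Fin 2) (Fin 2) ℂ) : Prop :=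
  ∃ ψ₁ ψ₂ : K →+* ℂ,
    (ψ₂ ((ω : maximalRealSubfield K) : K)).re < (ψ₁ ((ω : maximalRealSubfield K) : K)).re ∧
    0 < (ψ₁ z).im ∧ (ψ₂ z).im < 0 ∧
    Z = embeddingSumMatrix ω ψ₁ ψ₂ z

end CMSurface

end

/-! Write O for the integers of K₀ and x̄ for the complex conjugate of x in K. Let A be a surface
with CM by O_K. The element ω acts on ℂ² by a root of its quadratic equation on each of two lines,
and not by a scalar, since the integrality of the polarization would make that scalar rational.
Hence O_K acts diagonally, its two characters extend to embeddings ψ₁, ψ₂ of K that differ on ω, and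
A is ℂ² modulo the image of an O_K-module 𝔞 in K (`PPAV.HasCM.exists_uniformizes`). Trace duality
writes the polarization as Tr(x S(y)). Its invariance under i makes S conjugate-linear for the CM
type, and primitivity then leaves only S(y) = κ ȳ with κ̄ = -κ
(`IsPrimitiveQuarticCMField.semilinear`, `Uniformizes.exists_form_eq`).

Put D(x, y) = δκ(x ȳ - x̄ y). The polarization is the trace from K₀ to ℚ of D/δ. Since δ generates
the different, D is an O-valued alternating form on 𝔞, and principality means that its values lie in
no common maximal ideal. Over a Dedekind domain such a form takes the value 1
(`exists_eq_one_of_alternating`). If D(x, y) = 1, then x and y generate 𝔞 over O. With z = x/y, the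
surface is given by the lattice zO + O and a form that depends on z only. This is the surface of
Z_z: its period vectors are the images of zω, z, 1, -ω' (`isUniformizedBy_ofPeriodMatrix`).

It remains to count the z. If multiplication by μ carries zO + O to z'O + O, then comparing
determinants gives μμ̄(z - z̄) = u(z' - z̄') with a unit u of O, and for u = 1 the two surfaces
agree. Dividing μ by a real unit v divides u by v², so one z' per ideal class and the factors ±1, ±ε
suffice. Conversely, an isomorphism between the surfaces of uz and u'z that respects the embeddings
gives a unit κ of K with κκ̄ = u'/u. In a primitive quartic CM field such a norm is the square of a
real unit (`IsPrimitiveQuarticCMField.norm_unit_eq_sq`), which forces u = u'.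

Finally the CM type of A matters only up to automorphisms of K. In the Galois case all CM types are
equivalent. Otherwise the only automorphisms are the identity and complex conjugation, and there are
two classes. The sign conditions on φ₁ and φ₂ select one type from each class
(`isCompleteSet_of_pairs`). -/

set_option linter.unusedSectionVars false

noncomputable section

namespace CMSurface

/-! ### Arithmetic of the real quadratic subfield and its embeddings. -/

section

variable {K : Type*} [Field K] [NumberField K]

/-- The inclusion of the integers of the maximal real subfield of `K` into `K`. -/
def realInt : 𝓞 (maximalRealSubfield K) →+* K :=
  (maximalRealSubfield K).subtype.comp (algebraMap (𝓞 (maximalRealSubfield K)) _)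

theorem realInt_apply (a : 𝓞 (maximalRealSubfield K)) :
    realInt a = ((a : maximalRealSubfield K) : K) := rfl

theorem realInt_injective : Function.Injective (realInt (K := K)) := by
  intro a b h
  rw [realInt_apply, realInt_apply] at h
  exact RingOfIntegers.ext (Subtype.ext h)

theorem finrank_maximalRealSubfield [IsCMField K] (h4 : Module.finrank ℚ K = 4) :
    Module.finrank ℚ (maximalRealSubfield K) = 2 := by
  have h := Module.finrank_mul_finrank ℚ (maximalRealSubfield K) K
  rw [Algebra.IsQuadraticExtension.finrank_eq_two (maximalRealSubfield K) K, h4] at h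
  omega

/-- Cayley–Hamilton for multiplication by `ω` on a ℤ-basis. The second clause ties `t` to the trace
in the definition of `delta`. -/
theorem exists_sq_eq (h2 : Module.finrank ℚ (maximalRealSubfield K) = 2)
    (ω : 𝓞 (maximalRealSubfield K)) :
    ∃ t n : ℤ, ω ^ 2 = t * ω - n ∧
      Algebra.trace ℚ (maximalRealSubfield K) (ω : maximalRealSubfield K) = t := by
  have hr : Module.finrank ℤ (𝓞 (maximalRealSubfield K)) = 2 := by
    rw [RingOfIntegers.rank, h2]
  let b : Module.Basis (Fin 2) ℤ (𝓞 (maximalRealSubfield K)) :=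
    Module.finBasisOfFinrankEq ℤ _ hr
  refine ⟨Algebra.trace ℤ _ ω, (Algebra.leftMulMatrix b ω).det, ?_, ?_⟩
  · have h := Matrix.aeval_self_charpoly (Algebra.leftMulMatrix b ω)
    rw [Polynomial.aeval_algHom_apply (Algebra.leftMulMatrix b) ω, Matrix.charpoly_fin_two,
      ← map_zero (Algebra.leftMulMatrix b)] at h
    have h' := Algebra.leftMulMatrix_injective b h
    rw [Algebra.trace_eq_matrix_trace b]
    simp only [map_add, map_sub, map_mul, map_pow, Polynomial.aeval_X, Polynomial.aeval_C] at h'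
    simp only [algebraMap_int_eq, eq_intCast] at h'
    linear_combination h'
  · rw [Algebra.coe_trace_int]

theorem exists_int_coord (h2 : Module.finrank ℚ (maximalRealSubfield K) = 2)
    {ω : 𝓞 (maximalRealSubfield K)} (hω : Algebra.adjoin ℤ {ω} = ⊤)
    (a : 𝓞 (maximalRealSubfield K)) : ∃ m n : ℤ, a = m + n * ω := by
  obtain ⟨t, d, hq, -⟩ := exists_sq_eq h2 ω
  have ha : a ∈ Algebra.adjoin ℤ {ω} := hω ▸ Algebra.mem_top
  induction ha using Algebra.adjoin_induction with
  | mem x hx => exact ⟨0, 1, by simpa using hx⟩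
  | algebraMap r => exact ⟨r, 0, by simp⟩
  | add x y _ _ hx hy =>
    obtain ⟨m, n, rfl⟩ := hx
    obtain ⟨m', n', rfl⟩ := hy
    exact ⟨m + m', n + n', by push_cast; ring⟩
  | mul x y _ _ hx hy =>
    obtain ⟨m, n, rfl⟩ := hx
    obtain ⟨m', n', rfl⟩ := hy
    refine ⟨m * m' - n * n' * d, m * n' + n * m' + n * n' * t, ?_⟩
    push_cast
    linear_combination (n : 𝓞 (maximalRealSubfield K)) * n' * hq

theorem exists_rat_coord (h2 : Module.finrank ℚ (maximalRealSubfield K) = 2)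
    {ω : 𝓞 (maximalRealSubfield K)} (hω : Algebra.adjoin ℤ {ω} = ⊤)
    (x : maximalRealSubfield K) : ∃ a b : ℚ, (x : K) = a + b * realInt ω := by
  obtain ⟨r, m, hm, hx⟩ : ∃ (r : 𝓞 (maximalRealSubfield K)) (m : ℤ), m ≠ 0 ∧
      (m : maximalRealSubfield K) * x = r := by
    obtain ⟨m, hm, hi⟩ := ((IsFractionRing.isAlgebraic_iff ℤ ℚ _).2
      (Algebra.IsAlgebraic.isAlgebraic (R := ℚ) x)).exists_integral_multiple
    exact ⟨⟨m • x, hi⟩, m, hm, by simp⟩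
  obtain ⟨k, l, hr⟩ := exists_int_coord h2 hω r
  have hmK : (m : K) ≠ 0 := by exact_mod_cast hm
  have h : (m : K) * (x : K) = k + l * realInt ω := by
    have h1 := congrArg (fun y : maximalRealSubfield K => (y : K)) hx
    have h3 : realInt r = k + l * realInt ω := by rw [hr]; simp
    rw [← h3, realInt_apply, ← h1]; push_cast; rfl
  refine ⟨k / m, l / m, ?_⟩
  push_cast
  field_simp
  linear_combination h

theorem realInt_ne_rat (h2 : Module.finrank ℚ (maximalRealSubfield K) = 2)
    {ω : 𝓞 (maximalRealSubfield K)} (hω : Algebra.adjoin ℤ {ω} = ⊤) (q : ℚ) :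
    realInt ω ≠ q := by
  intro h
  have hb : (⊥ : Subalgebra ℚ (maximalRealSubfield K)) = ⊤ := by
    refine eq_top_iff.2 fun x _ => ?_
    obtain ⟨a, b, hx⟩ := exists_rat_coord h2 hω x
    refine Algebra.mem_bot.2 ⟨a + b * q, Subtype.ext ?_⟩
    rw [hx, h]
    simp
  have := Subalgebra.bot_eq_top_iff_finrank_eq_one.1 hb
  omega

theorem delta_eq {ω : 𝓞 (maximalRealSubfield K)} {t : ℤ}
    (ht : Algebra.trace ℚ (maximalRealSubfield K) (ω : maximalRealSubfield K) = t) :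
    delta ω = 2 * realInt ω - t := by
  rw [delta, ht, realInt_apply]; simp

theorem delta_ne_zero (h2 : Module.finrank ℚ (maximalRealSubfield K) = 2)
    {ω : 𝓞 (maximalRealSubfield K)} (hω : Algebra.adjoin ℤ {ω} = ⊤) : delta ω ≠ 0 := by
  obtain ⟨t, d, hq, ht⟩ := exists_sq_eq h2 ω
  rw [delta_eq ht]
  intro h
  refine realInt_ne_rat h2 hω (t / 2) ?_
  push_cast
  linear_combination h / 2

/-- Embeddings with `ψ₁ ω ≠ ψ₂ ω` are the two elements of a CM type. -/
def IsPair (ω : 𝓞 (maximalRealSubfield K)) (ψ₁ ψ₂ : K →+* ℂ) : Prop :=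
  ψ₁ (realInt ω) ≠ ψ₂ (realInt ω)

theorem IsPair.symm {ω : 𝓞 (maximalRealSubfield K)} {ψ₁ ψ₂ : K →+* ℂ} (h : IsPair ω ψ₁ ψ₂) :
    IsPair ω ψ₂ ψ₁ := Ne.symm h

theorem embedding_sq (ψ : K →+* ℂ) {ω : 𝓞 (maximalRealSubfield K)} {t n : ℤ}
    (hq : ω ^ 2 = t * ω - n) : ψ (realInt ω) ^ 2 = t * ψ (realInt ω) - n := by
  rw [← map_pow, ← map_pow, hq]; simp

theorem IsPair.add_eq {ω : 𝓞 (maximalRealSubfield K)} {ψ₁ ψ₂ : K →+* ℂ} (h : IsPair ω ψ₁ ψ₂)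
    {t n : ℤ} (hq : ω ^ 2 = t * ω - n) : ψ₁ (realInt ω) + ψ₂ (realInt ω) = t := by
  have h1 := embedding_sq ψ₁ hq
  have h2 := embedding_sq ψ₂ hq
  have : (ψ₁ (realInt ω) - ψ₂ (realInt ω)) * (ψ₁ (realInt ω) + ψ₂ (realInt ω) - t) = 0 := by
    linear_combination h1 - h2
  rcases mul_eq_zero.1 this with h' | h'
  · exact absurd (sub_eq_zero.1 h') h
  · linear_combination h'

theorem IsPair.map_delta (h2 : Module.finrank ℚ (maximalRealSubfield K) = 2)
    {ω : 𝓞 (maximalRealSubfield K)} {ψ₁ ψ₂ : K →+* ℂ} (h : IsPair ω ψ₁ ψ₂) :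
    ψ₁ (delta ω) = ψ₁ (realInt ω) - ψ₂ (realInt ω) := by
  obtain ⟨t, d, hq, ht⟩ := exists_sq_eq h2 ω
  have := h.add_eq hq
  rw [delta_eq ht]
  simp only [map_sub, map_mul, map_intCast, map_ofNat]
  linear_combination this

theorem IsPair.eq_or_eq (h2 : Module.finrank ℚ (maximalRealSubfield K) = 2)
    {ω : 𝓞 (maximalRealSubfield K)} {ψ₁ ψ₂ : K →+* ℂ} (h : IsPair ω ψ₁ ψ₂) (σ : K →+* ℂ) :
    σ (realInt ω) = ψ₁ (realInt ω) ∨ σ (realInt ω) = ψ₂ (realInt ω) := by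
  obtain ⟨t, d, hq, ht⟩ := exists_sq_eq h2 ω
  by_contra! hc
  have ha : IsPair ω σ ψ₁ := hc.1
  have hb : IsPair ω σ ψ₂ := hc.2
  have ha := ha.add_eq hq
  have hb := hb.add_eq hq
  exact h (by linear_combination ha - hb)

/-! ### Complex conjugation and the four embeddings of K. -/

section CM
variable [IsCMField K]

theorem embedding_conj (φ : K →+* ℂ) (x : K) :
    φ (IsCMField.complexConj K x) = (starRingEnd ℂ) (φ x) :=
  IsCMField.complexEmbedding_complexConj K φ x

theorem mem_real_of_conj {x : K} (h : IsCMField.complexConj K x = x) :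
    ∃ y : maximalRealSubfield K, (y : K) = x :=
  ⟨⟨x, (IsCMField.complexConj_eq_self_iff K x).1 h⟩, rfl⟩

theorem conj_real (x : maximalRealSubfield K) : IsCMField.complexConj K (x : K) = x :=
  IsCMField.complexConj_apply_eq_self K x

theorem conj_realInt (a : 𝓞 (maximalRealSubfield K)) :
    IsCMField.complexConj K (realInt a) = realInt a :=
  conj_real (a : maximalRealSubfield K)

theorem conj_delta (ω : 𝓞 (maximalRealSubfield K)) :
    IsCMField.complexConj K (delta ω) = delta ω := by
  have := conj_realInt ω
  rw [realInt_apply] at this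
  have h : IsCMField.complexConj K (2 : K) = 2 := map_ofNat _ 2
  rw [delta, map_sub, map_mul, h, this, eq_ratCast, map_ratCast]

theorem embedding_im_eq_zero (φ : K →+* ℂ) {x : K} (h : IsCMField.complexConj K x = x) :
    (φ x).im = 0 := by
  have := embedding_conj φ x
  rw [h] at this
  exact Complex.conj_eq_iff_im.1 this.symm

theorem embedding_re_eq_zero (φ : K →+* ℂ) {x : K} (h : IsCMField.complexConj K x = -x) :
    (φ x).re = 0 := by
  have := embedding_conj φ x
  rw [h, map_neg] at this
  have := congrArg Complex.re this
  simp at this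
  linarith

theorem embedding_real_eq (φ : K →+* ℂ) {x : K} (h : IsCMField.complexConj K x = x) :
    φ x = ((φ x).re : ℂ) :=
  Complex.ext (by simp) (by simp [embedding_im_eq_zero φ h])

variable (K) in
theorem exists_conj_eq_neg : ∃ y : K, y ≠ 0 ∧ IsCMField.complexConj K y = -y := by
  have h := IsCMField.complexConj_ne_one K
  obtain ⟨x, hx⟩ : ∃ x, IsCMField.complexConj K x ≠ x := by
    by_contra! hc
    exact h (AlgEquiv.ext hc)
  refine ⟨x - IsCMField.complexConj K x, sub_ne_zero.2 hx.symm, ?_⟩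
  rw [map_sub, IsCMField.complexConj_apply_apply]; ring

theorem embedding_agree_real (h2 : Module.finrank ℚ (maximalRealSubfield K) = 2)
    {ω : 𝓞 (maximalRealSubfield K)} (hω : Algebra.adjoin ℤ {ω} = ⊤) {L : Type*} [Field L]
    [CharZero L] {σ τ : K →+* L}
    (h : σ (realInt ω) = τ (realInt ω)) {x : K} (hx : IsCMField.complexConj K x = x) :
    σ x = τ x := by
  obtain ⟨y, rfl⟩ := mem_real_of_conj hx
  obtain ⟨a, b, hab⟩ := exists_rat_coord h2 hω y
  rw [hab]; simp [h]

/-- K is K₀ + K₀y for a purely imaginary y, and y² is real, so two maps that agree on K₀ can differ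
on y only by a sign. The target is arbitrary because the result is applied both to ℂ and to K
itself. -/
theorem ringHom_eq_or (h2 : Module.finrank ℚ (maximalRealSubfield K) = 2)
    {ω : 𝓞 (maximalRealSubfield K)} (hω : Algebra.adjoin ℤ {ω} = ⊤) {L : Type*} [Field L]
    [CharZero L] {σ τ : K →+* L}
    (h : σ (realInt ω) = τ (realInt ω)) :
    (∀ x, σ x = τ x) ∨ ∀ x, σ x = τ (IsCMField.complexConj K x) := by
  obtain ⟨y, hy0, hy⟩ := exists_conj_eq_neg K
  have hag := fun x hx => embedding_agree_real h2 hω h (x := x) hx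
  have hyy : σ (y ^ 2) = τ (y ^ 2) := hag _ (by rw [map_pow, hy]; ring)
  rw [map_pow, map_pow, sq_eq_sq_iff_eq_or_eq_neg] at hyy
  have hdec : ∀ x : K, ∃ a b : K, IsCMField.complexConj K a = a ∧
      IsCMField.complexConj K b = b ∧ x = a + b * y := by
    intro x
    have hc2 : IsCMField.complexConj K (2 : K) = 2 := map_ofNat _ 2
    refine ⟨(x + IsCMField.complexConj K x) / 2, (x - IsCMField.complexConj K x) / (2 * y),
      ?_, ?_, by field_simp; ring⟩
    · rw [map_div₀, map_add, IsCMField.complexConj_apply_apply, hc2, add_comm]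
    · rw [map_div₀, map_sub, map_mul, IsCMField.complexConj_apply_apply, hc2, hy]
      field_simp; ring
  refine hyy.imp (fun h' x => ?_) (fun h' x => ?_)
  · obtain ⟨a, b, ha, hb, rfl⟩ := hdec x
    rw [map_add, map_add, map_mul, map_mul, hag a ha, hag b hb, h']
  · obtain ⟨a, b, ha, hb, rfl⟩ := hdec x
    rw [map_add, map_add, map_mul, map_mul, hag a ha, hag b hb, h', map_add, map_mul, ha, hb, hy]
    simp

theorem embedding_eq_or (h2 : Module.finrank ℚ (maximalRealSubfield K) = 2)
    {ω : 𝓞 (maximalRealSubfield K)} (hω : Algebra.adjoin ℤ {ω} = ⊤) {σ τ : K →+* ℂ}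
    (h : σ (realInt ω) = τ (realInt ω)) : σ = τ ∨ σ = ComplexEmbedding.conjugate τ := by
  refine (ringHom_eq_or h2 hω h).imp (fun h => RingHom.ext h) (fun h => RingHom.ext fun x => ?_)
  rw [h, embedding_conj, ComplexEmbedding.conjugate_coe_eq]

theorem conjugate_realInt (σ : K →+* ℂ) (a : 𝓞 (maximalRealSubfield K)) :
    ComplexEmbedding.conjugate σ (realInt a) = σ (realInt a) := by
  rw [ComplexEmbedding.conjugate_coe_eq, ← embedding_conj, conj_realInt]

theorem conjugate_ne (σ : K →+* ℂ) : ComplexEmbedding.conjugate σ ≠ σ := by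
  obtain ⟨y, hy0, hy⟩ := exists_conj_eq_neg K
  intro h
  have := congrArg (fun f : K →+* ℂ => f y) h
  simp only [ComplexEmbedding.conjugate_coe_eq] at this
  rw [← embedding_conj, hy] at this
  have h' := σ.injective this
  exact hy0 (by linear_combination -h' / 2)

theorem IsPair.conjugate_left {ω : 𝓞 (maximalRealSubfield K)} {ψ₁ ψ₂ : K →+* ℂ}
    (h : IsPair ω ψ₁ ψ₂) : IsPair ω (ComplexEmbedding.conjugate ψ₁) ψ₂ := by
  rwa [IsPair, conjugate_realInt]

theorem IsPair.conjugate_right {ω : 𝓞 (maximalRealSubfield K)} {ψ₁ ψ₂ : K →+* ℂ}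
    (h : IsPair ω ψ₁ ψ₂) : IsPair ω ψ₁ (ComplexEmbedding.conjugate ψ₂) :=
  h.symm.conjugate_left.symm

theorem IsPair.cases (h2 : Module.finrank ℚ (maximalRealSubfield K) = 2)
    {ω : 𝓞 (maximalRealSubfield K)} (hω : Algebra.adjoin ℤ {ω} = ⊤) {ψ₁ ψ₂ : K →+* ℂ}
    (h : IsPair ω ψ₁ ψ₂) (σ : K →+* ℂ) :
    σ = ψ₁ ∨ σ = ψ₂ ∨ σ = ComplexEmbedding.conjugate ψ₁ ∨ σ = ComplexEmbedding.conjugate ψ₂ := by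
  rcases h.eq_or_eq h2 σ with h' | h' <;> rcases embedding_eq_or h2 hω h' with h'' | h'' <;>
    simp [h'']

/-- The four embeddings of `K` are linearly independent. -/
theorem IsPair.independent (h2 : Module.finrank ℚ (maximalRealSubfield K) = 2)
    {ω : 𝓞 (maximalRealSubfield K)} (hω : Algebra.adjoin ℤ {ω} = ⊤) {ψ₁ ψ₂ : K →+* ℂ}
    (h : IsPair ω ψ₁ ψ₂) {a b c d : ℂ}
    (hz : ∀ x, a * ψ₁ x + b * ψ₂ x + c * (starRingEnd ℂ) (ψ₁ x) + d * (starRingEnd ℂ) (ψ₂ x) = 0) :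
    a = 0 ∧ b = 0 ∧ c = 0 ∧ d = 0 := by
  obtain ⟨y, hy0, hy⟩ := exists_conj_eq_neg K
  have hδ1 : ψ₁ (delta ω) ≠ 0 := by simpa using delta_ne_zero h2 hω
  have hδ2 : ψ₂ (delta ω) = - ψ₁ (delta ω) := by
    rw [h.map_delta h2, h.symm.map_delta h2]; ring
  simp only [← embedding_conj] at hz
  have hA : ∀ x, a * ψ₁ x + c * ψ₁ (IsCMField.complexConj K x) = 0 := by
    intro x
    have e1 := hz x
    -- The real element δ takes opposite values under `ψ₁` and `ψ₂`, so the relations at x and at δx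
    -- together separate the `ψ₁` terms from the `ψ₂` terms.
    have e2 := hz (delta ω * x)
    simp only [map_mul, conj_delta, hδ2] at e2
    have : ψ₁ (delta ω) * (2 * (a * ψ₁ x + c * ψ₁ (IsCMField.complexConj K x))) = 0 := by
      linear_combination ψ₁ (delta ω) * e1 + e2
    have := (mul_eq_zero.1 this).resolve_left hδ1
    linear_combination this / 2
  have hB : ∀ x, b * ψ₂ x + d * ψ₂ (IsCMField.complexConj K x) = 0 := by
    intro x
    linear_combination hz x - hA x
  -- Evaluation at 1 and at the purely imaginary y gives p + q = 0 and p - q = 0.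
  have key : ∀ (ψ : K →+* ℂ) (p q : ℂ),
      (∀ x, p * ψ x + q * ψ (IsCMField.complexConj K x) = 0) → p = 0 ∧ q = 0 := by
    intro ψ p q hpq
    have e1 := hpq 1
    have e2 := hpq y
    rw [hy, map_neg] at e2
    simp only [map_one, mul_one] at e1
    have hyψ : ψ y ≠ 0 := by simpa using hy0
    have e3 : p - q = 0 := by
      refine (mul_eq_zero.1 (?_ : (p - q) * ψ y = 0)).resolve_right hyψ
      linear_combination e2
    exact ⟨by linear_combination e1 / 2 + e3 / 2, by linear_combination e1 / 2 - e3 / 2⟩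
  obtain ⟨ha, hc⟩ := key ψ₁ a c hA
  obtain ⟨hb, hd⟩ := key ψ₂ b d hB
  exact ⟨ha, hb, hc, hd⟩

end CM

end

/-! ### Automorphisms of a primitive quartic CM field. -/

section

variable {K : Type*} [Field K] [NumberField K] [IsCMField K]

theorem IsPrimitiveQuarticCMField.finrank_real (hK : IsPrimitiveQuarticCMField K) :
    Module.finrank ℚ (maximalRealSubfield K) = 2 :=
  finrank_maximalRealSubfield hK.finrank_eq

theorem sq_eq_neg_of_conj_eq_neg {x : K} (hx : IsCMField.complexConj K x = -x) {q : ℚ}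
    (hq : x ^ 2 = q) (φ : K →+* ℂ) : (q : ℝ) = -((φ x).im ^ 2) := by
  have h1 : φ x = Complex.I * ((φ x).im : ℂ) :=
    Complex.ext (by simp [embedding_re_eq_zero φ hx]) (by simp)
  have h3 : φ x ^ 2 = q := by rw [← map_pow, hq]; simp
  rw [h1, mul_pow, Complex.I_sq] at h3
  apply Complex.ofReal_injective
  push_cast
  linear_combination -h3

/-- A primitive quartic CM field does not contain a square root of a negative rational. -/
theorem IsPrimitiveQuarticCMField.sq_ne_rat (hK : IsPrimitiveQuarticCMField K) {x : K}
    (hx0 : x ≠ 0) (hx : IsCMField.complexConj K x = -x) (q : ℚ) : x ^ 2 ≠ q := by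
  intro hq
  refine hK.primitive ⟨IntermediateField.adjoin ℚ {x}, ?_, ⟨fun v => ?_⟩⟩
  · have hint : IsIntegral ℚ x := Algebra.IsIntegral.isIntegral x
    rw [IntermediateField.adjoin.finrank hint]
    have hnot : x ∉ (algebraMap ℚ K).range := by
      rintro ⟨r, rfl⟩
      rw [eq_ratCast, map_ratCast] at hx
      apply hx0
      rw [eq_ratCast]
      linear_combination hx / 2
    have h2 := (minpoly.two_le_natDegree_iff hint).2 hnot
    refine le_antisymm ?_ h2
    have hp : (Polynomial.X ^ 2 - Polynomial.C q : Polynomial ℚ).natDegree = 2 :=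
      Polynomial.natDegree_X_pow_sub_C
    rw [← hp]
    refine Polynomial.natDegree_le_of_dvd (minpoly.dvd ℚ x (by simp [hq])) ?_
    exact Polynomial.X_pow_sub_C_ne_zero (by norm_num) q
  -- At a real place of ℚ(x) the number q would be the square of a real number, whereas every
  -- embedding of K sends x to the imaginary axis and so shows that q is negative.
  · by_contra hv
    rw [InfinitePlace.not_isComplex_iff_isReal, InfinitePlace.isReal_iff] at hv
    set σ := v.embedding
    set g : IntermediateField.adjoin ℚ {x} := IntermediateField.AdjoinSimple.gen ℚ x
    have hg : g ^ 2 = (q : IntermediateField.adjoin ℚ {x}) := by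
      apply Subtype.ext
      push_cast
      rw [IntermediateField.AdjoinSimple.coe_gen, hq]
    have h1 : σ g ^ 2 = q := by rw [← map_pow, hg, map_ratCast]
    have h2 : σ g = ((σ g).re : ℂ) := by
      have := congrArg (fun f : _ →+* ℂ => f g) hv
      simp only [ComplexEmbedding.conjugate_coe_eq] at this
      exact (Complex.conj_eq_iff_re.1 this).symm
    rw [h2] at h1
    have h3 : (σ g).re ^ 2 = (q : ℝ) := by exact_mod_cast h1
    obtain φ : K →+* ℂ := Classical.choice inferInstance
    have h4 := sq_eq_neg_of_conj_eq_neg hx hq φ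
    have h5 : (φ x).im ≠ 0 := by
      intro h
      have : φ x = 0 := Complex.ext (embedding_re_eq_zero φ hx) h
      exact hx0 (by simpa using this)
    have := sq_nonneg (σ g).re
    have := sq_pos_of_ne_zero h5
    linarith

/-- Every embedding of K, in particular `φ` composed with `s`, turns the conjugation of K into that
of ℂ. -/
theorem conj_commutes (s : K ≃ₐ[ℚ] K) (x : K) :
    s (IsCMField.complexConj K x) = IsCMField.complexConj K (s x) := by
  obtain φ : K →+* ℂ := Classical.choice inferInstance
  apply φ.injective
  rw [embedding_conj]
  exact embedding_conj (φ.comp (s : K →+* K)) x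

section

variable {ω : 𝓞 (maximalRealSubfield K)}

theorem aut_realInt (s : K ≃ₐ[ℚ] K) {t n : ℤ} (hq : ω ^ 2 = t * ω - n) :
    s (realInt ω) = realInt ω ∨ s (realInt ω) = t - realInt ω := by
  have h1 : realInt ω ^ 2 = t * realInt ω - n := by rw [← map_pow, hq]; simp
  have h2 : s (realInt ω) ^ 2 = t * s (realInt ω) - n := by rw [← map_pow, h1]; simp
  have : (s (realInt ω) - realInt ω) * (s (realInt ω) - (t - realInt ω)) = 0 := by
    linear_combination h2 - h1
  exact (mul_eq_zero.1 this).imp sub_eq_zero.1 sub_eq_zero.1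

/-- A real element is a + bω with rational a, b. As s sends ω to its conjugate, being fixed means bδ
= 0. -/
theorem rat_of_fixed (h2 : Module.finrank ℚ (maximalRealSubfield K) = 2)
    (hω : Algebra.adjoin ℤ {ω} = ⊤) {s : K ≃ₐ[ℚ] K} (hs : s (realInt ω) ≠ realInt ω)
    {x : K} (hx : IsCMField.complexConj K x = x) (hsx : s x = x) : ∃ q : ℚ, x = q := by
  obtain ⟨t, n, hq, ht⟩ := exists_sq_eq h2 ω
  have hsw := (aut_realInt s hq).resolve_left hs
  obtain ⟨y, rfl⟩ := mem_real_of_conj hx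
  obtain ⟨a, b, hab⟩ := exists_rat_coord h2 hω y
  rw [hab] at hsx ⊢
  simp only [map_add, map_mul, map_ratCast, hsw] at hsx
  have h1 : (b : K) * delta ω = 0 := by
    rw [delta_eq ht]; linear_combination -hsx
  have hb := (mul_eq_zero.1 h1).resolve_right (delta_ne_zero h2 hω)
  exact ⟨a, by rw [hb]; ring⟩

/-- An automorphism of order two of a primitive quartic CM field fixes the real subfield. -/
theorem IsPrimitiveQuarticCMField.fixes_of_involutive (hK : IsPrimitiveQuarticCMField K)
    (hω : Algebra.adjoin ℤ {ω} = ⊤) {s : K ≃ₐ[ℚ] K} (hs : ∀ x, s (s x) = x) :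
    s (realInt ω) = realInt ω := by
  have h2 := hK.finrank_real
  by_contra hne
  obtain ⟨t, n, hq, ht⟩ := exists_sq_eq h2 ω
  have hsw := (aut_realInt s hq).resolve_left hne
  have hsδ : s (delta ω) = -delta ω := by
    rw [delta_eq ht]
    simp only [map_sub, map_mul, map_ofNat, map_intCast, hsw]; ring
  -- A purely imaginary element fixed by s has a real square fixed by s, which is rational and
  -- contradicts primitivity. The candidate is y + s y. If this vanishes, s changes the sign of both
  -- y and δ and therefore fixes yδ.
  obtain ⟨x, hx0, hx, hsx⟩ : ∃ x : K, x ≠ 0 ∧ IsCMField.complexConj K x = -x ∧ s x = x := by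
    obtain ⟨y, hy0, hy⟩ := exists_conj_eq_neg K
    by_cases h : y + s y = 0
    · have hsy : s y = -y := by linear_combination h
      refine ⟨y * delta ω, mul_ne_zero hy0 (delta_ne_zero h2 hω), ?_, ?_⟩
      · rw [map_mul, hy, conj_delta]; ring
      · rw [map_mul, hsy, hsδ]; ring
    · refine ⟨y + s y, h, ?_, ?_⟩
      · rw [map_add, ← conj_commutes, hy, map_neg]; ring
      · rw [map_add, hs, add_comm]
  obtain ⟨q, hq'⟩ := rat_of_fixed h2 hω hne (x := x ^ 2)
    (by rw [map_pow, hx]; ring) (by rw [map_pow, hsx])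
  exact hK.sq_ne_rat hx0 hx q hq'

theorem aut_eq_or (h2 : Module.finrank ℚ (maximalRealSubfield K) = 2)
    (hω : Algebra.adjoin ℤ {ω} = ⊤) {s : K ≃ₐ[ℚ] K} (hs : s (realInt ω) = realInt ω) :
    (∀ x, s x = x) ∨ ∀ x, s x = IsCMField.complexConj K x := by
  have := ringHom_eq_or h2 hω (σ := (s : K →+* K)) (τ := RingHom.id K) (by simpa using hs)
  simpa using this

/-- In the non-Galois case, the automorphisms are the identity and complex conjugation. -/
theorem aut_eq_or_of_not_isGalois (h4 : Module.finrank ℚ K = 4)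
    (hω : Algebra.adjoin ℤ {ω} = ⊤) (hG : ¬ IsGalois ℚ K) (s : K ≃ₐ[ℚ] K) :
    (∀ x, s x = x) ∨ ∀ x, s x = IsCMField.complexConj K x := by
  have h2 := finrank_maximalRealSubfield h4
  by_cases hs : s (realInt ω) = realInt ω
  · exact aut_eq_or h2 hω hs
  exfalso
  apply hG
  -- An automorphism s that moves ω would give four distinct automorphisms 1, c, s, sc, as many as
  -- the degree of K, and K would be Galois.
  let c : K ≃ₐ[ℚ] K := (IsCMField.complexConj K).restrictScalars ℚ
  have hc : ∀ x, c x = IsCMField.complexConj K x := fun _ => rfl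
  have hcw : c (realInt ω) = realInt ω := conj_realInt ω
  obtain ⟨y, hy0, hy⟩ := exists_conj_eq_neg K
  have hyy : -y ≠ y := fun h => hy0 (by linear_combination -h / 2)
  refine IsGalois.of_card_aut_eq_finrank ℚ K ?_
  rw [h4]
  refine le_antisymm ?_ ?_
  · rw [← h4, Nat.card_eq_fintype_card]
    exact AlgEquiv.card_le
  · have hinj : Function.Injective (![1, c, s, s * c] : Fin 4 → (K ≃ₐ[ℚ] K)) := by
      have e1 : (1 : K ≃ₐ[ℚ] K) ≠ c := fun h => by
        have := congrArg (fun f : K ≃ₐ[ℚ] K => f y) h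
        simp only [hc, AlgEquiv.one_apply, hy] at this
        exact hyy this.symm
      have e2 : ∀ a b : K ≃ₐ[ℚ] K, a (realInt ω) = realInt ω → b (realInt ω) ≠ realInt ω → a ≠ b :=
        fun a b ha hb h => hb (h ▸ ha)
      have e3 : s ≠ s * c := fun h => e1 (mul_left_cancel (a := s) (by rw [mul_one]; exact h))
      have hscw : (s * c) (realInt ω) ≠ realInt ω := by
        rw [AlgEquiv.mul_apply, hcw]; exact hs
      have h1s := e2 1 s rfl hs
      have h1sc := e2 1 _ rfl hscw
      have hcs := e2 c s hcw hs
      have hcsc := e2 c _ hcw hscw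
      intro i j hij
      fin_cases i <;> fin_cases j <;>
        first
          | rfl
          | (exfalso
             simp only [Fin.zero_eta, Fin.mk_one, Fin.reduceFinMk, Matrix.cons_val] at hij
             first
               | exact e1 hij | exact e1 hij.symm | exact e3 hij | exact e3 hij.symm
               | exact h1s hij | exact h1s hij.symm | exact h1sc hij | exact h1sc hij.symm
               | exact hcs hij | exact hcs hij.symm | exact hcsc hij | exact hcsc hij.symm)
    have := Nat.card_le_card_of_injective _ hinj
    simpa using this

/-- σ⁻¹τ is then a ring endomorphism of K, and it is bijective because K is algebraic over ℚ. -/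
theorem exists_aut_of_range_subset {σ τ : K →+* ℂ} (h : ∀ x, ∃ y, σ y = τ x) :
    ∃ s : K ≃ₐ[ℚ] K, ∀ x, σ (s x) = τ x := by
  choose f hf using h
  let F : K →+* K :=
    { toFun := f
      map_one' := σ.injective (by rw [hf]; simp)
      map_zero' := σ.injective (by rw [hf]; simp)
      map_mul' := fun x y => σ.injective (by rw [map_mul, hf, hf, hf, map_mul])
      map_add' := fun x y => σ.injective (by rw [map_add, hf, hf, hf, map_add]) }
  let G : K →ₐ[ℚ] K := F.toRatAlgHom
  have hb : Function.Bijective G := Algebra.IsAlgebraic.algHom_bijective G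
  exact ⟨AlgEquiv.ofBijective G hb, hf⟩

theorem IsPair.map_delta_right (h2 : Module.finrank ℚ (maximalRealSubfield K) = 2)
    {ψ₁ ψ₂ : K →+* ℂ} (h : IsPair ω ψ₁ ψ₂) : ψ₂ (delta ω) = - ψ₁ (delta ω) := by
  rw [h.map_delta h2, h.symm.map_delta h2]; ring

theorem map_delta_eq_or (h2 : Module.finrank ℚ (maximalRealSubfield K) = 2)
    {ψ₁ ψ₂ : K →+* ℂ} (h : IsPair ω ψ₁ ψ₂) (σ : K →+* ℂ) :
    σ (delta ω) = ψ₁ (delta ω) ∨ σ (delta ω) = ψ₂ (delta ω) := by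
  obtain ⟨t, n, hq, ht⟩ := exists_sq_eq h2 ω
  rcases h.eq_or_eq h2 σ with h' | h'
  · left; rw [delta_eq ht]; simp only [map_sub, map_mul, map_ofNat, map_intCast, h']
  · right; rw [delta_eq ht]; simp only [map_sub, map_mul, map_ofNat, map_intCast, h']

/-- The coefficients of a combination of two embeddings with values in the image of `σ`. -/
theorem exists_coeff (h2 : Module.finrank ℚ (maximalRealSubfield K) = 2)
    (hω : Algebra.adjoin ℤ {ω} = ⊤) {ψ₁ ψ₂ : K →+* ℂ} (h : IsPair ω ψ₁ ψ₂) (σ : K →+* ℂ)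
    {T : K → K} {p q : ℂ} (hT : ∀ y, σ (T y) = p * ψ₁ y + q * ψ₂ y) :
    (∃ p', σ p' = p) ∧ (∃ q', σ q' = q) ∧ (∀ y, ∃ y', σ y' = p * ψ₁ y) ∧
      ∀ y, ∃ y', σ y' = q * ψ₂ y := by
  have hδ : delta ω ≠ 0 := delta_ne_zero h2 hω
  have hδ2 := h.map_delta_right h2
  have hδ1 : ψ₁ (delta ω) ≠ 0 := by simpa using hδ
  -- The value of δ under σ is ± its value under `ψ₁`, so the latter is σ(d) for some d. Passing
  -- from T(y) to T(δy)/d changes the sign of the `ψ₂` term only. Half the sum and half the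
  -- difference isolate the two terms.
  obtain ⟨d, hd⟩ : ∃ d, σ d = ψ₁ (delta ω) := by
    rcases map_delta_eq_or h2 h σ with h' | h'
    · exact ⟨_, h'⟩
    · exact ⟨-delta ω, by rw [map_neg, h', hδ2, neg_neg]⟩
  have hP : ∀ y, ∃ y', σ y' = p * ψ₁ y := fun y => ⟨(T y + T (delta ω * y) / d) / 2, by
    simp only [map_div₀, map_add, map_ofNat, hT, map_mul, hd, hδ2]
    field_simp; ring⟩
  have hQ : ∀ y, ∃ y', σ y' = q * ψ₂ y := fun y => ⟨(T y - T (delta ω * y) / d) / 2, by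
    simp only [map_div₀, map_sub, map_ofNat, hT, map_mul, hd, hδ2]
    field_simp; ring⟩
  exact ⟨by simpa using hP 1, by simpa using hQ 1, hP, hQ⟩

theorem exists_aut_of_coeff_ne_zero {σ τ : K →+* ℂ} {p : ℂ} (hp : p ≠ 0)
    (hp' : ∃ p', σ p' = p) (h : ∀ y, ∃ y', σ y' = p * τ y) :
    ∃ s : K ≃ₐ[ℚ] K, ∀ x, σ (s x) = τ x := by
  obtain ⟨p', rfl⟩ := hp'
  refine exists_aut_of_range_subset fun x => ?_
  obtain ⟨y, hy⟩ := h x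
  exact ⟨y / p', by rw [map_div₀, hy]; field_simp⟩

theorem conj_conjugate_apply (σ : K →+* ℂ) (x : K) :
    ComplexEmbedding.conjugate σ x = (starRingEnd ℂ) (σ x) := by
  rw [ComplexEmbedding.conjugate_coe_eq]

/-- The case of `semilinear` in which the two sides are matched, up to independence. -/
theorem IsPair.aut_cases (h2 : Module.finrank ℚ (maximalRealSubfield K) = 2)
    (hω : Algebra.adjoin ℤ {ω} = ⊤) {ψ₁ ψ₂ : K →+* ℂ} (h : IsPair ω ψ₁ ψ₂) {σ : K →+* ℂ}
    {k p q : ℂ} (hk : k ≠ 0) (hs : ∀ x, k * σ x = p * ψ₁ x + q * ψ₂ x) :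
    σ = ψ₁ ∨ σ = ψ₂ := by
  rcases h.cases h2 hω σ with rfl | rfl | rfl | rfl
  · simp
  · simp
  · exfalso
    have := h.independent h2 hω (a := -p) (b := -q) (c := k) (d := 0)
      (fun x => by rw [← conj_conjugate_apply ψ₁]; linear_combination hs x)
    exact hk this.2.2.1
  · exfalso
    have := h.independent h2 hω (a := -p) (b := -q) (c := 0) (d := k)
      (fun x => by rw [← conj_conjugate_apply ψ₂]; linear_combination hs x)
    exact hk this.2.2.2

/-- A nonzero additive map `K → K` that is `ℂ`-linear for two CM types is, up to a factor, an
automorphism that maps one CM type to the other. -/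
theorem IsPrimitiveQuarticCMField.semilinear (hK : IsPrimitiveQuarticCMField K)
    (hω : Algebra.adjoin ℤ {ω} = ⊤) {ψ₁ ψ₂ χ₁ χ₂ : K →+* ℂ} (h : IsPair ω ψ₁ ψ₂)
    (h' : IsPair ω χ₁ χ₂) {T : K → K} {y₀ : K} (hT0 : T y₀ ≠ 0) {p₁ q₁ p₂ q₂ : ℂ}
    (hT₁ : ∀ y, χ₁ (T y) = p₁ * ψ₁ y + q₁ * ψ₂ y)
    (hT₂ : ∀ y, χ₂ (T y) = p₂ * ψ₁ y + q₂ * ψ₂ y) :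
    ∃ (κ : K) (s : K ≃ₐ[ℚ] K), κ ≠ 0 ∧ (∀ y, T y = κ * s y) ∧
      ((∀ x, χ₁ (s x) = ψ₁ x) ∧ (∀ x, χ₂ (s x) = ψ₂ x) ∨
        (∀ x, χ₁ (s x) = ψ₂ x) ∧ (∀ x, χ₂ (s x) = ψ₁ x)) := by
  have h2 := hK.finrank_real
  obtain ⟨hp, hq, hP, hQ⟩ := exists_coeff h2 hω h χ₁ hT₁
  have hpair : ∀ s : K ≃ₐ[ℚ] K, IsPair ω (χ₁.comp (s : K →+* K)) (χ₂.comp (s : K →+* K)) := by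
    intro s hs
    obtain ⟨t, n, hqq, ht⟩ := exists_sq_eq h2 ω
    simp only [RingHom.comp_apply, RingHom.coe_coe] at hs
    rcases aut_realInt s hqq with e | e
    · rw [e] at hs; exact h' hs
    · rw [e] at hs
      simp only [map_sub, map_intCast] at hs
      exact h' (by linear_combination -hs)
  -- one nonzero coefficient
  have main : ∀ (κ : K) (s : K ≃ₐ[ℚ] K), (∀ y, T y = κ * s y) →
      (∀ x, χ₁ (s x) = ψ₁ x) ∨ (∀ x, χ₁ (s x) = ψ₂ x) →
      ∃ (κ : K) (s : K ≃ₐ[ℚ] K), κ ≠ 0 ∧ (∀ y, T y = κ * s y) ∧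
      ((∀ x, χ₁ (s x) = ψ₁ x) ∧ (∀ x, χ₂ (s x) = ψ₂ x) ∨
        (∀ x, χ₁ (s x) = ψ₂ x) ∧ (∀ x, χ₂ (s x) = ψ₁ x)) := by
    intro κ s hTs hs
    have hκ : κ ≠ 0 := by rintro rfl; exact hT0 (by rw [hTs, zero_mul])
    refine ⟨κ, s, hκ, hTs, ?_⟩
    have hκ2 : χ₂ κ ≠ 0 := by simpa using hκ
    have hc := h.aut_cases h2 hω (σ := χ₂.comp (s : K →+* K)) hκ2
      (fun x => by rw [← hT₂, hTs, map_mul]; rfl)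
    have hne := hpair s
    rcases hs with hs | hs
    · left
      refine ⟨hs, fun x => ?_⟩
      rcases hc with hc | hc
      · exact absurd (by rw [hc]; exact hs (realInt ω)) hne
      · rw [← hc]; rfl
    · right
      refine ⟨hs, fun x => ?_⟩
      rcases hc with hc | hc
      · rw [← hc]; rfl
      · exact absurd (by rw [hc]; exact hs (realInt ω)) hne
  by_cases hp0 : p₁ = 0
  · by_cases hq0 : q₁ = 0
    · exfalso
      have := hT₁ y₀
      rw [hp0, hq0, zero_mul, zero_mul, add_zero] at this
      exact hT0 (by simpa using this)
    obtain ⟨s, hs⟩ := exists_aut_of_coeff_ne_zero hq0 hq hQ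
    obtain ⟨κ, hκ⟩ := hq
    exact main κ s (fun y => χ₁.injective (by rw [hT₁, hp0, map_mul, hκ, hs]; ring)) (Or.inr hs)
  obtain ⟨s₁, hs₁⟩ := exists_aut_of_coeff_ne_zero hp0 hp hP
  by_cases hq0 : q₁ = 0
  · obtain ⟨κ, hκ⟩ := hp
    exact main κ s₁ (fun y => χ₁.injective (by rw [hT₁, hq0, map_mul, hκ, hs₁]; ring)) (Or.inl hs₁)
  -- Both coefficients nonzero would give automorphisms s₁, s₂ and r = s₁⁻¹s₂ with ψ₁ ∘ r = ψ₂. Then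
  -- r moves ω, so it is not an involution, while r² fixes ω. Hence r² is complex conjugation.
  exfalso
  obtain ⟨s₂, hs₂⟩ := exists_aut_of_coeff_ne_zero hq0 hq hQ
  obtain ⟨p', rfl⟩ := hp
  obtain ⟨q', rfl⟩ := hq
  have hTs : ∀ y, T y = p' * s₁ y + q' * s₂ y := fun y => χ₁.injective (by
    rw [hT₁, map_add, map_mul, map_mul, hs₁, hs₂])
  set r : K ≃ₐ[ℚ] K := s₂.trans s₁.symm with hr
  have hs₂r : ∀ x, s₂ x = s₁ (r x) := by intro x; simp [hr]
  have hψr : ∀ x, ψ₁ (r x) = ψ₂ x := by intro x; rw [← hs₁, ← hs₂r, hs₂]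
  have hrw : r (realInt ω) ≠ realInt ω := by
    intro hc
    have := hψr (realInt ω)
    rw [hc] at this
    exact h this
  have hrr : ∀ x, r (r x) = IsCMField.complexConj K x := by
    have hfix : (r.trans r) (realInt ω) = realInt ω := by
      obtain ⟨t, n, hqq, ht⟩ := exists_sq_eq h2 ω
      have := (aut_realInt r hqq).resolve_left hrw
      simp [this]
    rcases aut_eq_or h2 hω hfix with e | e
    · exact absurd (hK.fixes_of_involutive hω (s := r) (fun x => e x)) hrw
    · exact fun x => e x
  have hψ2r : ∀ x, ψ₂ (r x) = (starRingEnd ℂ) (ψ₁ x) := by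
    intro x; rw [← hψr, hrr, embedding_conj]
  have hp'' : χ₂ p' ≠ 0 := by rintro e; apply hp0; simp at e; simp [e]
  have hq'' : χ₂ q' ≠ 0 := by rintro e; apply hq0; simp at e; simp [e]
  have hlin : ∀ x, χ₂ p' * χ₂ (s₁ x) + χ₂ q' * χ₂ (s₁ (r x)) = p₂ * ψ₁ x + q₂ * ψ₂ x := by
    intro x
    rw [← hT₂, hTs, map_add, map_mul, map_mul, hs₂r]
  have hne := hpair s₁
  have hs₁' : χ₁.comp (s₁ : K →+* K) = ψ₁ := RingHom.ext hs₁
  rw [hs₁'] at hne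
  have hcase := (hne.symm.eq_or_eq h2 ψ₂).resolve_right (fun e => h e.symm)
  -- χ₂ ∘ s₁ is `ψ₂` or its conjugate. In the first case χ₂ ∘ T contains the conjugate of `ψ₁` with
  -- coefficient χ₂(q'), in the second the conjugate of `ψ₂` with coefficient χ₂(p'). Both
  -- contradict independence, as χ₂ ∘ T is a combination of `ψ₁` and `ψ₂`.
  rcases embedding_eq_or h2 hω hcase.symm with e | e
  · have e' : ∀ x, χ₂ (s₁ x) = ψ₂ x := fun x => by rw [← e]; rfl
    have := h.independent h2 hω (a := -p₂) (b := χ₂ p' - q₂) (c := χ₂ q') (d := 0) (fun x => by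
      rw [← hψ2r, ← e', ← e']
      have := hlin x
      rw [← e' x] at this
      linear_combination this)
    exact hq'' this.2.2.1
  · have e' : ∀ x, χ₂ (s₁ x) = (starRingEnd ℂ) (ψ₂ x) := fun x => by
      rw [← conj_conjugate_apply, ← e]; rfl
    have := h.independent h2 hω (a := χ₂ q' - p₂) (b := -q₂) (c := 0) (d := χ₂ p') (fun x => by
      have := hlin x
      rw [e', e', hψ2r, Complex.conj_conj] at this
      linear_combination this)
    exact hp'' this.2.2.2

end

end

/-! ### Units and roots of unity of a primitive quartic CM field. -/

section

variable {K : Type*} [Field K] [NumberField K] [IsCMField K]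

section

variable {ω : 𝓞 (maximalRealSubfield K)}

/-- If all embeddings agreed with φ on ω, there would be at most two of them instead of four. -/
theorem exists_isPair (h4 : Module.finrank ℚ K = 4) (hω : Algebra.adjoin ℤ {ω} = ⊤)
    (φ : K →+* ℂ) : ∃ ψ : K →+* ℂ, IsPair ω φ ψ := by
  by_contra! hc
  have hall : ∀ σ : K →+* ℂ, σ = φ ∨ σ = ComplexEmbedding.conjugate φ := fun σ =>
    embedding_eq_or (finrank_maximalRealSubfield h4) hω (by
      by_contra hne; exact hc σ (Ne.symm hne))
  classical
  have hcard := Embeddings.card K ℂ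
  rw [h4] at hcard
  have hle : Fintype.card (K →+* ℂ) ≤ 2 := by
    rw [← Finset.card_univ]
    refine (Finset.card_le_card (t := {φ, ComplexEmbedding.conjugate φ}) ?_).trans
      Finset.card_le_two
    intro σ _
    simpa using hall σ
  omega

/-- A totally positive unit of a real quadratic field has rational trace `e + e⁻¹`. -/
theorem add_inv_rat_of_unit (h4 : Module.finrank ℚ K = 4) (hω : Algebra.adjoin ℤ {ω} = ⊤)
    (e : (𝓞 (maximalRealSubfield K))ˣ)
    (hpos : ∀ φ : K →+* ℂ, 0 < (φ (realInt (e : 𝓞 (maximalRealSubfield K)))).re) :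
    ∃ k : ℤ, realInt (e : 𝓞 (maximalRealSubfield K)) +
      (realInt (e : 𝓞 (maximalRealSubfield K)))⁻¹ = k := by
  have h2 := finrank_maximalRealSubfield h4
  obtain ⟨t, d, hq, ht⟩ := exists_sq_eq h2 ω
  obtain φ : K →+* ℂ := Classical.choice inferInstance
  obtain ⟨ψ, hψ⟩ := exists_isPair h4 hω φ
  have hsum := hψ.add_eq hq
  have hsq := embedding_sq φ hq
  obtain ⟨m, n, he⟩ := exists_int_coord h2 hω (e : 𝓞 (maximalRealSubfield K))
  obtain ⟨m', n', he'⟩ := exists_int_coord h2 hω ((e⁻¹ : (𝓞 (maximalRealSubfield K))ˣ) :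
    𝓞 (maximalRealSubfield K))
  have hinv : realInt (e : 𝓞 (maximalRealSubfield K)) * realInt ((e⁻¹ :
      (𝓞 (maximalRealSubfield K))ˣ) : 𝓞 (maximalRealSubfield K)) = 1 := by
    rw [← map_mul, Units.mul_inv, map_one]
  set E := realInt (e : 𝓞 (maximalRealSubfield K)) with hE
  set F := realInt ((e⁻¹ : (𝓞 (maximalRealSubfield K))ˣ) : 𝓞 (maximalRealSubfield K)) with hF
  have hEw : E = m + n * realInt ω := by rw [hE, he]; simp
  have hFw : F = m' + n' * realInt ω := by rw [hF, he']; simp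
  have hmap : ∀ (χ : K →+* ℂ), χ E = m + n * χ (realInt ω) ∧ χ F = m' + n' * χ (realInt ω) := by
    intro χ; rw [hEw, hFw]; simp
  have hnorm : ∀ a b : ℤ, ((a : ℂ) + b * φ (realInt ω)) * (a + b * ψ (realInt ω)) =
      ((a ^ 2 + a * b * t + b ^ 2 * d : ℤ) : ℂ) := by
    intro a b
    have hw : ψ (realInt ω) = t - φ (realInt ω) := by linear_combination hsum
    rw [hw]
    push_cast
    linear_combination -(b : ℂ) ^ 2 * hsq
  -- The norms of e and e⁻¹ are integers with product 1, and total positivity excludes -1. So e⁻¹ is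
  -- the conjugate of e, and the integer sought is the trace 2m + nt.
  have hN : (m ^ 2 + m * n * t + n ^ 2 * d) * (m' ^ 2 + m' * n' * t + n' ^ 2 * d) = 1 := by
    have h1 : φ E * φ F = 1 := by rw [← map_mul, hinv, map_one]
    have h3 : ψ E * ψ F = 1 := by rw [← map_mul, hinv, map_one]
    rw [(hmap φ).1, (hmap φ).2] at h1
    rw [(hmap ψ).1, (hmap ψ).2] at h3
    have : (((m ^ 2 + m * n * t + n ^ 2 * d : ℤ) : ℂ) *
      ((m' ^ 2 + m' * n' * t + n' ^ 2 * d : ℤ) : ℂ)) = 1 := by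
      rw [← hnorm, ← hnorm]
      linear_combination h1 * (m + n * ψ (realInt ω)) * (m' + n' * ψ (realInt ω)) + h3
    exact_mod_cast this
  have hreal : ∀ χ : K →+* ℂ, χ E = ((χ E).re : ℂ) := fun χ =>
    embedding_real_eq χ (conj_realInt _)
  have hprod : φ E * ψ E = ((m ^ 2 + m * n * t + n ^ 2 * d : ℤ) : ℂ) := by
    rw [(hmap φ).1, (hmap ψ).1, hnorm]
  have hpos' : 0 < m ^ 2 + m * n * t + n ^ 2 * d := by
    rw [hreal φ, hreal ψ] at hprod
    have h5 : (φ E).re * (ψ E).re = ((m ^ 2 + m * n * t + n ^ 2 * d : ℤ) : ℝ) := by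
      exact_mod_cast hprod
    have h6 := mul_pos (hpos φ) (hpos ψ)
    rw [h5] at h6
    exact_mod_cast h6
  have hN1 : m ^ 2 + m * n * t + n ^ 2 * d = 1 := by
    rcases Int.eq_one_or_neg_one_of_mul_eq_one hN with h | h
    · exact h
    · omega
  rw [hN1] at hprod
  refine ⟨2 * m + n * t, φ.injective ?_⟩
  have hne : φ E ≠ 0 := by
    intro h0; rw [h0] at hprod; simp at hprod
  have hψE : (φ E)⁻¹ = ψ E := by
    field_simp; rw [hprod]; simp
  rw [map_add, map_inv₀, hψE, (hmap φ).1, (hmap ψ).1]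
  simp only [map_intCast]
  push_cast
  linear_combination (n : ℂ) * hsum

theorem mul_conj_pos {x : K} (hx : x ≠ 0) (φ : K →+* ℂ) :
    0 < (φ (x * IsCMField.complexConj K x)).re := by
  rw [map_mul, embedding_conj, Complex.mul_conj, Complex.ofReal_re]
  exact Complex.normSq_pos.2 (by simpa using hx)

/-- Up to sign, a root of unity in a primitive quartic CM field is the square of a root of
unity. -/
theorem IsPrimitiveQuarticCMField.torsion_eq_sq (hK : IsPrimitiveQuarticCMField K) {ζ : K}
    (hζ : IsOfFinOrder ζ) (hc : IsCMField.complexConj K ζ * ζ = 1) :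
    ∃ η : K, IsCMField.complexConj K η * η = 1 ∧ (ζ = η ^ 2 ∨ ζ = -η ^ 2) := by
  set c := IsCMField.complexConj K
  -- A root of unity of odd order has a square root among its own powers.
  have hodd : ∀ ξ : K, c ξ * ξ = 1 → ∀ k : ℕ, ξ ^ (2 * k + 1) = 1 →
      ∃ η : K, c η * η = 1 ∧ ξ = η ^ 2 := by
    intro ξ hξ k hk
    refine ⟨ξ ^ (k + 1), by rw [map_pow, ← mul_pow, hξ, one_pow], ?_⟩
    calc ξ = ξ * ξ ^ (2 * k + 1) := by rw [hk, mul_one]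
      _ = _ := by ring
  have hm : 0 < orderOf ζ := hζ.orderOf_pos
  have hpow := pow_orderOf_eq_one ζ
  set m := orderOf ζ with hmdef
  rcases Nat.even_or_odd' m with ⟨k, hk | hk⟩
  · have hhalf : ζ ^ k = -1 := by
      have h1 : (ζ ^ k - 1) * (ζ ^ k + 1) = 0 := by
        rw [hk] at hpow; linear_combination hpow
      rcases mul_eq_zero.1 h1 with h | h
      · exfalso
        have := Nat.le_of_dvd (by omega) (orderOf_dvd_of_pow_eq_one (sub_eq_zero.1 h))
        omega
      · linear_combination h
    -- Here ζ has order 2k and ζᵏ = -1. For even k the field would contain a square root of -1,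
    -- against primitivity. For odd k the k-th power of -ζ is 1.
    rcases Nat.even_or_odd' k with ⟨l, hl | hl⟩
    · exfalso
      have hi : (ζ ^ l) ^ 2 = -1 := by rw [← hhalf, hl]; ring
      have hne : ζ ^ l ≠ 0 := by intro h; rw [h] at hi; norm_num at hi
      have hcc : c (ζ ^ l) * ζ ^ l = 1 := by rw [map_pow, ← mul_pow, hc, one_pow]
      refine hK.sq_ne_rat hne (mul_right_cancel₀ hne ?_) (-1) (by rw [hi]; norm_num)
      rw [hcc]; linear_combination hi
    · obtain ⟨η, hη, hη'⟩ := hodd (-ζ) (by rw [map_neg]; linear_combination hc) l (by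
        rw [← hl, Odd.neg_pow (by rw [hl]; exact odd_two_mul_add_one l), hhalf, neg_neg])
      exact ⟨η, hη, Or.inr (by linear_combination -hη')⟩
  · obtain ⟨η, hη, hη'⟩ := hodd ζ hc k (by rw [← hk, hpow])
    exact ⟨η, hη, Or.inl hη'⟩

/-- The relative norm of a unit of a primitive quartic CM field is the square of a real unit. -/
theorem IsPrimitiveQuarticCMField.norm_unit_eq_sq (hK : IsPrimitiveQuarticCMField K)
    (hω : Algebra.adjoin ℤ {ω} = ⊤) (κ : (𝓞 K)ˣ) (e : (𝓞 (maximalRealSubfield K))ˣ)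
    (he : ((κ : 𝓞 K) : K) * IsCMField.complexConj K ((κ : 𝓞 K) : K) =
      realInt (e : 𝓞 (maximalRealSubfield K))) :
    ∃ r : (𝓞 (maximalRealSubfield K))ˣ, e = r ^ 2 := by
  set c := IsCMField.complexConj K with hcdef
  set k : K := ((κ : 𝓞 K) : K) with hk
  have hk0 : k ≠ 0 := by simp [hk]
  have hck0 : c k ≠ 0 := by simpa using hk0
  have hcc : ∀ x, c (c x) = x := IsCMField.complexConj_apply_apply K
  set ζ : K := k * (c k)⁻¹ with hζ
  have hfin : IsOfFinOrder ζ := by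
    have h1 := (IsCMField.unitsMulComplexConjInv K κ).2
    rw [IsCMField.unitsMulComplexConjInv_apply] at h1
    have h2 : IsOfFinOrder (κ * (IsCMField.unitsComplexConj K κ)⁻¹) := h1
    have h3 := ((Units.coeHom K).comp (Units.map (algebraMap (𝓞 K) K).toMonoidHom)).isOfFinOrder h2
    convert h3 using 1
    simp [hζ, hk, hcdef]
  have hζc : c ζ * ζ = 1 := by
    rw [hζ, map_mul, map_inv₀, hcc]; field_simp
  obtain ⟨η, hη, hsq⟩ := hK.torsion_eq_sq hfin hζc
  have hη0 : η ≠ 0 := by rintro rfl; simp at hη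
  have hcη : c η = η⁻¹ := eq_inv_of_mul_eq_one_left hη
  have hkζ : k = ζ * c k := by rw [hζ]; field_simp
  -- Since k / k̄ = ±η² and η̄ = η⁻¹, the element v = k/η has the same relative norm as k and
  -- satisfies v̄ = ±v. The real case exhibits e as v².
  set v : K := k * η⁻¹ with hv
  have hv0 : v ≠ 0 := mul_ne_zero hk0 (inv_ne_zero hη0)
  have hcv : c v = c k * η := by rw [hv, map_mul, map_inv₀, hcη, inv_inv]
  have hvcv : v * c v = realInt (e : 𝓞 (maximalRealSubfield K)) := by
    rw [← he, hcv, hv]; field_simp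
  rcases hsq with hsq | hsq
  · have hreal : c v = v := by
      rw [hcv, hv, hkζ, hsq, map_mul, map_pow, hcη, hcc]
      nth_rewrite 1 [hkζ]
      rw [hsq]; field_simp
    -- `v` is integral because `v ^ 2` is
    have hvi : IsIntegral ℤ v := by
      refine IsIntegral.of_pow (n := 2) (by norm_num) ?_
      have : v ^ 2 = realInt (e : 𝓞 (maximalRealSubfield K)) := by rw [← hvcv, hreal, sq]
      rw [this]
      exact (RingOfIntegers.isIntegral_coe (e : 𝓞 (maximalRealSubfield K))).map
        ((maximalRealSubfield K).subtype.toIntAlgHom)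
    obtain ⟨r, hr⟩ := (IsCMField.RingOfIntegers.complexConj_eq_self_iff K ⟨v, hvi⟩).1 hreal
    have hr' : realInt r = v := hr
    have hre : r ^ 2 = (e : 𝓞 (maximalRealSubfield K)) := by
      apply realInt_injective
      rw [map_pow, hr', ← hvcv, hreal, sq]
    have hru : IsUnit r := by
      have : IsUnit (r ^ 2) := hre ▸ e.isUnit
      exact (isUnit_pow_iff (by norm_num)).1 this
    exact ⟨hru.unit, Units.ext (by rw [Units.val_pow_eq_pow_val, IsUnit.unit_spec, hre])⟩
  · exfalso
    have hneg : c v = -v := by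
      have : k = -η ^ 2 * c k := by rw [← hsq]; exact hkζ
      have h3 : k * η⁻¹ = -η ^ 2 * c k * η⁻¹ := by rw [← this]
      rw [hcv, hv, h3]
      field_simp
    have hpos : ∀ φ : K →+* ℂ, 0 < (φ (realInt (e : 𝓞 (maximalRealSubfield K)))).re := by
      intro φ; rw [← hvcv]; exact mul_conj_pos hv0 φ
    obtain ⟨l, hl⟩ := add_inv_rat_of_unit hK.finrank_eq hω e hpos
    rw [← hvcv, hneg] at hl
    -- For purely imaginary v one has e = -v², and the integer l = e + e⁻¹ gives (v - v⁻¹)² = -l -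
    -- 2. This is a purely imaginary element with rational square, which primitivity forbids.
    have hx0 : v - v⁻¹ ≠ 0 := by
      intro h0
      have h1 : v * v = 1 := by field_simp at h0; linear_combination h0
      obtain φ : K →+* ℂ := Classical.choice inferInstance
      have h5 := hpos φ
      rw [← hvcv, hneg, mul_neg, h1, map_neg, map_one] at h5
      norm_num at h5
    refine hK.sq_ne_rat hx0 (by rw [map_sub, map_inv₀]; rw [← hcdef, hneg, inv_neg]; ring)
      (-l - 2) ?_
    push_cast
    rw [← hl]
    field_simp
    ring

end

/-! ### Real units modulo squares. -/

section units

variable {ε : (𝓞 (maximalRealSubfield K))ˣ}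

/-- `±1` and `±ε` represent the real units modulo squares. -/
theorem exists_unit_eq_sq_mul
    (hε : Odd (Subgroup.closure ({-1, ε} : Set (𝓞 (maximalRealSubfield K))ˣ)).index)
    (u : (𝓞 (maximalRealSubfield K))ˣ) :
    ∃ v u₀ : (𝓞 (maximalRealSubfield K))ˣ, u = v ^ 2 * u₀ ∧
      (u₀ = 1 ∨ u₀ = -1 ∨ u₀ = ε ∨ u₀ = -ε) := by
  obtain ⟨k, hk⟩ := hε
  have hmem := Subgroup.pow_index_mem (Subgroup.closure
    ({-1, ε} : Set (𝓞 (maximalRealSubfield K))ˣ)) u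
  rw [hk, Subgroup.mem_closure_pair] at hmem
  obtain ⟨i, j, hij⟩ := hmem
  have hsgn : ((-1 : (𝓞 (maximalRealSubfield K))ˣ) ^ i = 1) ∨
      ((-1 : (𝓞 (maximalRealSubfield K))ˣ) ^ i = -1) := by
    rcases Int.even_or_odd i with h | h
    · left; exact h.neg_one_zpow
    · right; exact h.neg_one_zpow
  -- With odd index 2k + 1, the power of u to the index lies in the subgroup generated by -1 and ε,
  -- and u differs from that power by the square of u⁻ᵏ.
  have hu : u = (u ^ (-k : ℤ)) ^ 2 * ((-1) ^ i * ε ^ j) := by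
    rw [hij, ← zpow_natCast u, ← zpow_natCast, ← zpow_mul, ← zpow_add]
    push_cast
    ring_nf
    simp
  rcases Int.even_or_odd' j with ⟨l, hl | hl⟩
  · refine ⟨u ^ (-k : ℤ) * ε ^ l, (-1) ^ i, ?_, ?_⟩
    · conv_lhs => rw [hu]
      rw [hl, mul_pow, ← zpow_natCast (ε ^ l), ← zpow_mul, mul_comm 2 l, Nat.cast_ofNat]
      rw [mul_assoc, mul_comm ((-1) ^ i)]
    · rcases hsgn with h | h <;> simp [h]
  · refine ⟨u ^ (-k : ℤ) * ε ^ l, (-1) ^ i * ε, ?_, ?_⟩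
    · conv_lhs => rw [hu]
      rw [hl, mul_pow, ← zpow_natCast (ε ^ l), ← zpow_mul, zpow_add, mul_comm 2 l,
        Nat.cast_ofNat, zpow_one, mul_assoc, mul_left_comm ((-1) ^ i)]
    · rcases hsgn with h | h <;> simp [h]

/-- If ε were torsion, an odd power of every unit would be torsion, hence every unit, whereas the
unit group of K₀ has rank one by Dirichlet. -/
theorem not_isOfFinOrder (h4 : Module.finrank ℚ K = 4)
    (hε : Odd (Subgroup.closure ({-1, ε} : Set (𝓞 (maximalRealSubfield K))ˣ)).index) :
    ¬ IsOfFinOrder ε := by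
  intro hfin
  have h2 := finrank_maximalRealSubfield h4
  have hrank : Units.rank (maximalRealSubfield K) = 1 := by
    rw [Units.rank, InfinitePlace.card_eq_nrRealPlaces_add_nrComplexPlaces,
      IsTotallyReal.nrComplexPlaces_eq_zero, ← IsTotallyReal.finrank, h2]
  have hall : ∀ u : (𝓞 (maximalRealSubfield K))ˣ, IsOfFinOrder u := by
    intro u
    obtain ⟨k, hk⟩ := hε
    have hmem := Subgroup.pow_index_mem (Subgroup.closure
      ({-1, ε} : Set (𝓞 (maximalRealSubfield K))ˣ)) u
    rw [hk, Subgroup.mem_closure_pair] at hmem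
    obtain ⟨i, j, hij⟩ := hmem
    have hneg : IsOfFinOrder (-1 : (𝓞 (maximalRealSubfield K))ˣ) :=
      isOfFinOrder_iff_pow_eq_one.2 ⟨2, by norm_num, by simp⟩
    have : IsOfFinOrder (u ^ (2 * k + 1)) := by
      rw [← hij]
      exact (Commute.all _ _).isOfFinOrder_mul hneg.zpow hfin.zpow
    exact this.of_pow (by omega)
  have h0 : Module.finrank ℤ (Additive (𝓞 (maximalRealSubfield K))ˣ) = 0 := by
    rw [Module.finrank_eq_zero_iff]
    intro x
    obtain ⟨n, hn, hx⟩ := isOfFinOrder_iff_pow_eq_one.1 (hall x.toMul)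
    refine ⟨n, by exact_mod_cast hn.ne', ?_⟩
    have := congrArg Additive.ofMul hx
    simpa using this
  rw [Units.finrank_eq, hrank] at h0
  exact one_ne_zero h0

/-- The power of r to the odd index 2k + 1 is ±εʲ. Squaring to remove signs gives equal powers of ε
with exponents 2b(2k + 1) and 4j. These differ for odd b, and ε has infinite order. -/
theorem zpow_mul_zpow_ne_sq (h4 : Module.finrank ℚ K = 4)
    (hε : Odd (Subgroup.closure ({-1, ε} : Set (𝓞 (maximalRealSubfield K))ˣ)).index)
    {a b : ℤ} (hb : Odd b) (r : (𝓞 (maximalRealSubfield K))ˣ) : (-1) ^ a * ε ^ b ≠ r ^ 2 := by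
  intro h
  apply not_isOfFinOrder h4 hε
  obtain ⟨k, hk⟩ := hε
  have hmem := Subgroup.pow_index_mem (Subgroup.closure
    ({-1, ε} : Set (𝓞 (maximalRealSubfield K))ˣ)) r
  rw [hk, Subgroup.mem_closure_pair] at hmem
  obtain ⟨i, j, hij⟩ := hmem
  have hsq : ∀ i : ℤ, ((-1 : (𝓞 (maximalRealSubfield K))ˣ) ^ i) ^ 2 = 1 := by
    intro i
    rw [← zpow_natCast, ← zpow_mul, mul_comm, zpow_mul]; simp
  have h1 : ε ^ (b * 2 * (2 * k + 1)) = ε ^ (j * 4) := by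
    have e1 : ((r ^ (2 * k + 1)) ^ 2) ^ 2 = ((r ^ 2) ^ 2) ^ (2 * k + 1) := by
      rw [← pow_mul, ← pow_mul, ← pow_mul, ← pow_mul]; ring_nf
    rw [← hij, ← h] at e1
    simp only [mul_pow, hsq, one_mul] at e1
    have e2 := e1.symm
    simp only [← zpow_natCast, ← zpow_mul] at e2
    push_cast at e2
    rw [e2]; congr 1; ring
  have h2 : ε ^ (b * 2 * (2 * k + 1) - j * 4) = 1 := by rw [zpow_sub, h1, mul_inv_cancel]
  refine isOfFinOrder_iff_zpow_eq_one.2 ⟨_, ?_, h2⟩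
  obtain ⟨l, rfl⟩ := hb
  intro h0
  ring_nf at h0
  omega

theorem neg_one_ne_sq (r : (𝓞 (maximalRealSubfield K))ˣ) : -1 ≠ r ^ 2 := by
  intro h
  obtain φ : K →+* ℂ := Classical.choice inferInstance
  have h1 : (-1 : K) = realInt (r : 𝓞 (maximalRealSubfield K)) ^ 2 := by
    rw [← map_pow, ← Units.val_pow_eq_pow_val, ← h]; simp
  have h2 := congrArg φ h1
  rw [map_pow, embedding_real_eq φ (conj_realInt (r : 𝓞 (maximalRealSubfield K)))] at h2
  have h3 : (-1 : ℝ) = (φ (realInt (r : 𝓞 (maximalRealSubfield K)))).re ^ 2 := by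
    apply Complex.ofReal_injective
    push_cast
    rw [← h2]; simp
  nlinarith [sq_nonneg (φ (realInt (r : 𝓞 (maximalRealSubfield K)))).re]

/-- The units `±1` and `±ε` are distinct modulo squares. -/
theorem eq_of_eq_mul_sq (h4 : Module.finrank ℚ K = 4)
    (hε : Odd (Subgroup.closure ({-1, ε} : Set (𝓞 (maximalRealSubfield K))ˣ)).index)
    {u u' r : (𝓞 (maximalRealSubfield K))ˣ} (hu : u = 1 ∨ u = -1 ∨ u = ε ∨ u = -ε)
    (hu' : u' = 1 ∨ u' = -1 ∨ u' = ε ∨ u' = -ε) (h : u' = u * r ^ 2) : u' = u := by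
  have h1 := zpow_mul_zpow_ne_sq h4 hε (a := 0) (b := 1) odd_one r
  have h2 := zpow_mul_zpow_ne_sq h4 hε (a := 1) (b := 1) odd_one r
  have h3 := zpow_mul_zpow_ne_sq h4 hε (a := 0) (b := -1) (by decide) r
  have h5 := zpow_mul_zpow_ne_sq h4 hε (a := 1) (b := -1) (by decide) r
  have h6 := neg_one_ne_sq r
  simp only [zpow_zero, zpow_one, one_mul, zpow_neg, neg_mul] at h1 h2 h3 h5
  have h7 : u⁻¹ * u' = r ^ 2 := by rw [h]; simp
  rcases hu with rfl | rfl | rfl | rfl <;> rcases hu' with rfl | rfl | rfl | rfl <;>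
    first
      | rfl
      | (exfalso
         simp only [inv_one, one_mul, mul_one, mul_neg, neg_mul, inv_neg, neg_neg,
           inv_mul_cancel] at h7
         first
           | exact h1 h7 | exact h2 h7 | exact h3 h7 | exact h5 h7 | exact h6 h7)

end units

end

/-! ### The period matrix and its polarization in trace coordinates. -/

section

/-- The change of coordinates `u ↦ (∑ wⱼ uⱼ / δⱼ, ∑ uⱼ / δⱼ)` with `δ₁ = w₁ - w₂ = -δ₂`. -/
def traceCoord {w₁ w₂ : ℝ} (h : w₂ < w₁) : (Fin 2 → ℂ) ≃ₗ[ℂ] (Fin 2 → ℂ) where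
  toFun u := ![(w₁ * u 0 - w₂ * u 1) / (w₁ - w₂), (u 0 - u 1) / (w₁ - w₂)]
  invFun v := ![v 0 - w₂ * v 1, v 0 - w₁ * v 1]
  map_add' u v := by
    ext i; fin_cases i <;> simp <;> ring
  map_smul' c u := by
    ext i; fin_cases i <;> simp <;> ring
  left_inv u := by
    have h' : (w₁ - w₂ : ℂ) ≠ 0 := by exact_mod_cast (sub_pos.2 h).ne'
    ext i; fin_cases i <;> simp <;> field_simp <;> ring
  right_inv v := by
    have h' : (w₁ - w₂ : ℂ) ≠ 0 := by exact_mod_cast (sub_pos.2 h).ne'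
    ext i; fin_cases i <;> simp <;> field_simp <;> ring

theorem traceCoord_apply {w₁ w₂ : ℝ} (h : w₂ < w₁) (u : Fin 2 → ℂ) :
    traceCoord h u = ![(w₁ * u 0 - w₂ * u 1) / (w₁ - w₂), (u 0 - u 1) / (w₁ - w₂)] := rfl

/-- The matrix `∑ zⱼ / δⱼ [[wⱼ², wⱼ], [wⱼ, 1]]`. -/
def tracePeriod (w₁ w₂ : ℝ) (z₁ z₂ : ℂ) : Matrix (Fin 2) (Fin 2) ℂ :=
  !![(z₁ * w₁ ^ 2 - z₂ * w₂ ^ 2) / (w₁ - w₂), (z₁ * w₁ - z₂ * w₂) / (w₁ - w₂);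
    (z₁ * w₁ - z₂ * w₂) / (w₁ - w₂), (z₁ - z₂) / (w₁ - w₂)]

theorem imPart_tracePeriod (w₁ w₂ : ℝ) (z₁ z₂ : ℂ) : imPart (tracePeriod w₁ w₂ z₁ z₂) =
    !![(z₁.im * w₁ ^ 2 - z₂.im * w₂ ^ 2) / (w₁ - w₂), (z₁.im * w₁ - z₂.im * w₂) / (w₁ - w₂);
      (z₁.im * w₁ - z₂.im * w₂) / (w₁ - w₂), (z₁.im - z₂.im) / (w₁ - w₂)] := by
  have him : ∀ (a : ℂ), (a / ((w₁ : ℂ) - w₂)).im = a.im / (w₁ - w₂) := by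
    intro a
    rw [← Complex.ofReal_sub, Complex.div_ofReal_im]
  have hmul : ∀ (a : ℂ) (r : ℝ), (a * r).im = a.im * r := fun a r => by simp
  ext i j
  fin_cases i <;> fin_cases j <;>
    simp only [imPart, tracePeriod, Fin.zero_eta, Fin.mk_one, Matrix.map_apply, Matrix.of_apply,
      Matrix.cons_val', Matrix.cons_val_zero, Matrix.cons_val_one, Matrix.cons_val_fin_one, him,
      Complex.sub_im, ← Complex.ofReal_pow, hmul]

/-- The quadratic form of the imaginary part is a combination of the squares of the two independent
linear forms wⱼx₀ + x₁. The signs of Im z₁, Im z₂ and w₁ - w₂ make both coefficients positive. -/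
theorem tracePeriod_mem {w₁ w₂ : ℝ} (h : w₂ < w₁) {z₁ z₂ : ℂ} (h₁ : 0 < z₁.im) (h₂ : z₂.im < 0) :
    tracePeriod w₁ w₂ z₁ z₂ ∈ siegelUpperHalfSpace 2 := by
  refine ⟨?_, ?_⟩
  · ext i j
    fin_cases i <;> fin_cases j <;> simp [tracePeriod]
  · rw [imPart_tracePeriod]
    refine Matrix.PosDef.of_dotProduct_mulVec_pos ?_ ?_
    · ext i j
      fin_cases i <;> fin_cases j <;> simp
    · intro x hx
      have hd : 0 < w₁ - w₂ := sub_pos.2 h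
      have heq : star x ⬝ᵥ (!![(z₁.im * w₁ ^ 2 - z₂.im * w₂ ^ 2) / (w₁ - w₂),
          (z₁.im * w₁ - z₂.im * w₂) / (w₁ - w₂);
          (z₁.im * w₁ - z₂.im * w₂) / (w₁ - w₂), (z₁.im - z₂.im) / (w₁ - w₂)]).mulVec x =
          (z₁.im * (w₁ * x 0 + x 1) ^ 2 + (-z₂.im) * (w₂ * x 0 + x 1) ^ 2) / (w₁ - w₂) := by
        simp [Matrix.mulVec, dotProduct, Fin.sum_univ_two]
        field_simp
        ring
      rw [heq]
      refine div_pos ?_ hd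
      by_cases h0 : w₁ * x 0 + x 1 = 0
      · have h1 : w₂ * x 0 + x 1 ≠ 0 := by
          intro h1
          have h3 : (w₁ - w₂) * x 0 = 0 := by linear_combination h0 - h1
          have h4 : x 0 = 0 := (mul_eq_zero.1 h3).resolve_left hd.ne'
          rw [h4, mul_zero, zero_add] at h1
          exact hx (by ext i; fin_cases i <;> simp [h4, h1])
        have := mul_pos (neg_pos.2 h₂) (sq_pos_of_ne_zero h1)
        rw [h0]; linarith
      · have h3 := mul_pos h₁ (sq_pos_of_ne_zero h0)
        have h4 := mul_nonneg (neg_pos.2 h₂).le (sq_nonneg (w₂ * x 0 + x 1))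
        linarith

theorem imPart_tracePeriod_inv {w₁ w₂ : ℝ} (h : w₂ < w₁) {z₁ z₂ : ℂ} (h₁ : 0 < z₁.im)
    (h₂ : z₂.im < 0) : (imPart (tracePeriod w₁ w₂ z₁ z₂))⁻¹ =
      !![(z₁.im)⁻¹ * (w₁ - w₂)⁻¹ * ((z₂.im - z₁.im) / z₂.im),
        (z₁.im)⁻¹ * (w₁ - w₂)⁻¹ * ((w₁ * z₁.im - w₂ * z₂.im) / z₂.im);
        (z₁.im)⁻¹ * (w₁ - w₂)⁻¹ * ((w₁ * z₁.im - w₂ * z₂.im) / z₂.im),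
        (z₁.im)⁻¹ * (w₁ - w₂)⁻¹ * ((z₂.im * w₂ ^ 2 - z₁.im * w₁ ^ 2) / z₂.im)] := by
  have hd : w₁ - w₂ ≠ 0 := (sub_pos.2 h).ne'
  have h₁' := h₁.ne'
  have h₂' := h₂.ne
  apply Matrix.inv_eq_right_inv
  rw [imPart_tracePeriod]
  ext i j
  fin_cases i <;> fin_cases j <;> simp [Matrix.mul_apply, Fin.sum_univ_two] <;> field_simp <;> ring

/-- The imaginary part is diagonal in the linear forms wⱼx₀ + x₁, so the polarization is diagonal in
the trace coordinates. The denominators are δⱼ Im zⱼ with δ₁ = w₁ - w₂ = -δ₂, as in `standardForm`.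
-/
theorem periodForm_tracePeriod {w₁ w₂ : ℝ} (h : w₂ < w₁) {z₁ z₂ : ℂ} (h₁ : 0 < z₁.im)
    (h₂ : z₂.im < 0) (u v : Fin 2 → ℂ) :
    periodForm (tracePeriod w₁ w₂ z₁ z₂) (traceCoord h u) (traceCoord h v) =
      (u 0 * (starRingEnd ℂ) (v 0)).im / ((w₁ - w₂) * z₁.im) +
        (u 1 * (starRingEnd ℂ) (v 1)).im / ((w₂ - w₁) * z₂.im) := by
  have hd : w₁ - w₂ ≠ 0 := (sub_pos.2 h).ne'
  have hd2 : w₂ - w₁ = -(w₁ - w₂) := by ring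
  have h₁' := h₁.ne'
  have h₂' := h₂.ne
  have him : ∀ (a : ℂ), (a / ((w₁ : ℂ) - w₂)).im = a.im / (w₁ - w₂) := by
    intro a
    rw [← Complex.ofReal_sub, Complex.div_ofReal_im]
  have hre : ∀ (a : ℂ), (a / ((w₁ : ℂ) - w₂)).re = a.re / (w₁ - w₂) := by
    intro a
    rw [← Complex.ofReal_sub, Complex.div_ofReal_re]
  rw [periodForm_apply, imPart_tracePeriod_inv h h₁ h₂, hd2]
  simp only [traceCoord_apply, Matrix.mulVec, dotProduct, Fin.sum_univ_two, Matrix.cons_val_zero,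
    Matrix.cons_val_one, Matrix.of_apply, Matrix.cons_val', Matrix.cons_val_fin_one, him, hre,
    Complex.sub_im, Complex.sub_re, Complex.mul_re, Complex.mul_im, Complex.ofReal_re,
    Complex.ofReal_im, zero_mul, sub_zero, add_zero, Complex.conj_re, Complex.conj_im]
  field_simp
  ring

/-- When wⱼ, zⱼ are the images of ω, z under the two embeddings, the coordinates are the images of
zω, z, 1 and -ω'. So the period lattice becomes the image of zO + O. -/
theorem periodVectors_tracePeriod {w₁ w₂ : ℝ} (h : w₂ < w₁) (z₁ z₂ : ℂ) :
    periodVectors (tracePeriod w₁ w₂ z₁ z₂) = Sum.elim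
      ![traceCoord h ![z₁ * w₁, z₂ * w₂], traceCoord h ![z₁, z₂]]
      ![traceCoord h ![1, 1], traceCoord h ![-w₂, -w₁]] := by
  have h' : (w₁ - w₂ : ℂ) ≠ 0 := by exact_mod_cast (sub_pos.2 h).ne'
  funext i
  rcases i with i | i <;> fin_cases i <;> ext j <;> fin_cases j <;>
    simp [periodVectors, tracePeriod, traceCoord_apply] <;> field_simp <;> ring

end

section

/-! ### Alternating forms over a Dedekind domain. -/

section Dedekind

variable {R M : Type*} [CommRing R] [IsDedekindDomain R] [AddCommGroup M] [Module R M]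

theorem finite_maximal_containing {s : R} (hs : s ≠ 0) :
    {P : Ideal R | P.IsMaximal ∧ s ∈ P}.Finite := by
  have hI : Ideal.span {s} ≠ 0 := by simpa using hs
  refine ((Ideal.finite_factors hI).image IsDedekindDomain.HeightOneSpectrum.asIdeal).subset ?_
  rintro P ⟨hP, hsP⟩
  refine ⟨⟨P, hP.isPrime, ?_⟩, ?_, rfl⟩
  · rintro rfl
    exact hs (by simpa using hsP)
  · exact Ideal.dvd_span_singleton.2 hsP

theorem exists_crt (T : Finset (Ideal R)) (hT : ∀ P ∈ T, P.IsMaximal) (f : Ideal R → R) :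
    ∃ c : R, ∀ P ∈ T, c - f P ∈ P := by
  obtain ⟨c, hc⟩ := Ideal.exists_forall_sub_mem_ideal (I := fun P : T => (P : Ideal R))
    (fun P Q hne => Ideal.isCoprime_iff_sup_eq.2
      ((hT P P.2).coprime_of_ne (hT Q Q.2) (fun e => hne (Subtype.ext e)))) (fun P => f P)
  exact ⟨c, fun P hP => hc ⟨P, hP⟩⟩

/-- Induction on the set of primes. If m fails at the new prime P, adding c x with c ≡ 1 modulo P
and c ≡ 0 modulo the other primes repairs P and changes nothing modulo the others. -/
theorem exists_good (S : M →ₗ[R] M →ₗ[R] R) (T : Finset (Ideal R))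
    (hT : ∀ P ∈ T, P.IsMaximal) (h : ∀ P ∈ T, ∃ x y, S x y ∉ P) :
    ∃ m, ∀ P ∈ T, ∃ y, S m y ∉ P := by
  classical
  induction T using Finset.induction_on with
  | empty => exact ⟨0, by simp⟩
  | insert P T hPT ih =>
    obtain ⟨m, hm⟩ := ih (fun Q hQ => hT Q (Finset.mem_insert_of_mem hQ))
      (fun Q hQ => h Q (Finset.mem_insert_of_mem hQ))
    by_cases hmP : ∃ y, S m y ∉ P
    · exact ⟨m, fun Q hQ => (Finset.mem_insert.1 hQ).elim (fun e => by rw [e]; exact hmP) (hm Q)⟩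
    push Not at hmP
    obtain ⟨c, hc⟩ := exists_crt (insert P T) hT (fun Q => if Q = P then 1 else 0)
    obtain ⟨x, y, hxy⟩ := h P (Finset.mem_insert_self P T)
    have hP := (hT P (Finset.mem_insert_self P T)).isPrime
    refine ⟨m + c • x, fun Q hQ => ?_⟩
    rcases Finset.mem_insert.1 hQ with rfl | hQT
    · refine ⟨y, fun hmem => ?_⟩
      have hcP := hc Q hQ
      rw [if_pos rfl] at hcP
      simp only [map_add, map_smul, LinearMap.add_apply, LinearMap.smul_apply, smul_eq_mul] at hmem
      have h1 : S x y = S m y + c * S x y - S m y - (c - 1) * S x y := by ring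
      exact hxy (h1 ▸ Q.sub_mem (Q.sub_mem hmem (hmP y)) (Q.mul_mem_right _ hcP))
    · obtain ⟨y', hy'⟩ := hm Q hQT
      refine ⟨y', fun hmem => ?_⟩
      have hcQ := hc Q hQ
      rw [if_neg (fun e : Q = P => hPT (e ▸ hQT)), sub_zero] at hcQ
      simp only [map_add, map_smul, LinearMap.add_apply, LinearMap.smul_apply, smul_eq_mul] at hmem
      exact hy' ((Q.add_mem_iff_left (Q.mul_mem_right _ hcQ)).1 hmem)

/-- An alternating form over a Dedekind domain whose values generate the unit ideal takes the
value one. -/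
theorem exists_eq_one_of_alternating (S : M →ₗ[R] M →ₗ[R] R) (halt : ∀ x, S x x = 0)
    (h : ∀ P : Ideal R, P.IsMaximal → ∃ x y, S x y ∉ P) : ∃ x y, S x y = 1 := by
  classical
  have hskew : ∀ x y, S x y = -S y x := by
    intro x y
    have := halt (x + y)
    simp only [map_add, LinearMap.add_apply, halt, zero_add, add_zero] at this
    linear_combination this
  obtain ⟨v, w, hvw⟩ : ∃ v w, S v w ≠ 0 := by
    obtain ⟨P, hP⟩ := Ideal.exists_maximal R
    obtain ⟨x, y, hxy⟩ := h P hP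
    exact ⟨x, y, fun h0 => hxy (h0 ▸ P.zero_mem)⟩
  set a := S v w with ha
  have hfin := finite_maximal_containing hvw
  obtain ⟨m, hmgood, hmv⟩ : ∃ m, (∀ P : Ideal R, P.IsMaximal → a ∈ P → ∃ y, S m y ∉ P) ∧
      S m v ≠ 0 := by
    obtain ⟨m, hm⟩ := exists_good S hfin.toFinset
      (fun P hP => ((Set.Finite.mem_toFinset _).1 hP).1)
      (fun P hP => h P ((Set.Finite.mem_toFinset _).1 hP).1)
    have hm' : ∀ P : Ideal R, P.IsMaximal → a ∈ P → ∃ y, S m y ∉ P := fun P h1 h2 =>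
      hm P ((Set.Finite.mem_toFinset _).2 ⟨h1, h2⟩)
    -- Adding a w does not change m modulo the primes that contain a, and it turns the value S m v =
    -- 0 into -a² ≠ 0.
    by_cases h0 : S m v = 0
    · refine ⟨m + a • w, fun P h1 h2 => ?_, ?_⟩
      · obtain ⟨y, hy⟩ := hm' P h1 h2
        refine ⟨y, fun hmem => hy ?_⟩
        simp only [map_add, map_smul, LinearMap.add_apply, LinearMap.smul_apply,
          smul_eq_mul] at hmem
        exact (P.add_mem_iff_left (P.mul_mem_right _ h2)).1 hmem
      · simp only [map_add, map_smul, LinearMap.add_apply, LinearMap.smul_apply, smul_eq_mul, h0,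
          zero_add]
        rw [hskew w v, ← ha]
        exact mul_ne_zero hvw (neg_ne_zero.2 hvw)
    · exact ⟨m, hm', h0⟩
  have hfin2 := finite_maximal_containing hmv
  -- At primes not containing S m v the vector m + c v is good because it pairs with v to S m v. At
  -- the finitely many others, c ≡ 0 keeps a good m. Where m is bad, a is not in the prime, and c ≡
  -- 1 makes the pairing with w congruent to a.
  obtain ⟨c, hc⟩ := exists_crt hfin2.toFinset
    (fun P hP => ((Set.Finite.mem_toFinset _).1 hP).1)
    (fun P => if ∀ y, S m y ∈ P then 1 else 0)
  have hgood : ∀ P : Ideal R, P.IsMaximal → ∃ y, S (m + c • v) y ∉ P := by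
    intro P hP
    by_cases hsP : S m v ∈ P
    · have hcP := hc P ((Set.Finite.mem_toFinset _).2 ⟨hP, hsP⟩)
      by_cases hbad : ∀ y, S m y ∈ P
      · rw [if_pos hbad] at hcP
        have haP : a ∉ P := fun haP => by
          obtain ⟨y, hy⟩ := hmgood P hP haP
          exact hy (hbad y)
        refine ⟨w, fun hmem => haP ?_⟩
        simp only [map_add, map_smul, LinearMap.add_apply, LinearMap.smul_apply,
          smul_eq_mul, ← ha] at hmem
        have h1 : a = S m w + c * a - S m w - (c - 1) * a := by ring
        exact h1 ▸ P.sub_mem (P.sub_mem hmem (hbad w)) (P.mul_mem_right _ hcP)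
      · rw [if_neg hbad, sub_zero] at hcP
        push Not at hbad
        obtain ⟨y, hy⟩ := hbad
        refine ⟨y, fun hmem => hy ?_⟩
        simp only [map_add, map_smul, LinearMap.add_apply, LinearMap.smul_apply,
          smul_eq_mul] at hmem
        exact (P.add_mem_iff_left (P.mul_mem_right _ hcP)).1 hmem
    · refine ⟨v, ?_⟩
      simpa [halt] using hsP
  refine ⟨m + c • v, ?_⟩
  have htop : LinearMap.range (S (m + c • v)) = ⊤ := by
    by_contra hne
    obtain ⟨P, hP, hle⟩ := Ideal.exists_le_maximal (LinearMap.range (S (m + c • v))) hne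
    obtain ⟨y, hy⟩ := hgood P hP
    exact hy (hle ⟨y, rfl⟩)
  exact LinearMap.range_eq_top.1 htop 1

end Dedekind

/-! ### Surfaces uniformized by a lattice in K. -/

section uniformization

variable {K : Type*} [Field K] [NumberField K]

/-- The set `z 𝓞 + 𝓞`, where `𝓞` is the ring of integers of the maximal real subfield. -/
def idealSet (z : K) : Set K := {x | ∃ a b, x = z * realInt a + realInt b}

/-- The coordinates `F` identify the lattice of `A` with the image of `𝔞` under `(ψ₁, ψ₂)`. -/
def Uniformizes (A : PPAV 2) (ψ₁ ψ₂ : K →+* ℂ) (𝔞 : Set K)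
    (F : (Fin 2 → ℂ) ≃ₗ[ℂ] (Fin 2 → ℂ)) : Prop :=
  ∀ v, v ∈ A.lattice ↔ ∃ x ∈ 𝔞, F v = ![ψ₁ x, ψ₂ x]

/-- The form `∑ Im (uⱼ v̄ⱼ) / (ψⱼ(δ) Im ψⱼ(z))`. -/
def standardForm (ω : 𝓞 (maximalRealSubfield K)) (ψ₁ ψ₂ : K →+* ℂ) (z : K)
    (u v : Fin 2 → ℂ) : ℝ :=
  (u 0 * (starRingEnd ℂ) (v 0)).im / ((ψ₁ (delta ω)).re * (ψ₁ z).im) +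
    (u 1 * (starRingEnd ℂ) (v 1)).im / ((ψ₂ (delta ω)).re * (ψ₂ z).im)

/-- `A` is the quotient of `ℂ²` by the image of `z 𝓞 + 𝓞` under `(ψ₁, ψ₂)`, with the form
`standardForm`. -/
def IsUniformizedBy (A : PPAV 2) (ω : 𝓞 (maximalRealSubfield K)) (ψ₁ ψ₂ : K →+* ℂ) (z : K) :
    Prop :=
  ∃ F : (Fin 2 → ℂ) ≃ₗ[ℂ] (Fin 2 → ℂ), Uniformizes A ψ₁ ψ₂ (idealSet z) F ∧
    ∀ u v, A.form u v = standardForm ω ψ₁ ψ₂ z (F u) (F v)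

theorem IsUniformizedBy.isomorphic {A B : PPAV 2} {ω : 𝓞 (maximalRealSubfield K)}
    {ψ₁ ψ₂ : K →+* ℂ} {z : K} (hA : IsUniformizedBy A ω ψ₁ ψ₂ z)
    (hB : IsUniformizedBy B ω ψ₁ ψ₂ z) : A.Isomorphic B := by
  obtain ⟨F, hF, hFE⟩ := hA
  obtain ⟨G, hG, hGE⟩ := hB
  refine ⟨F.trans G.symm, ?_, fun u v => ?_⟩
  · ext v
    constructor
    · rintro ⟨u, hu, rfl⟩
      have := (hF u).1 hu
      refine (hG _).2 ?_
      simpa using this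
    · intro hv
      refine ⟨F.symm (G v), (hF _).2 ?_, by simp⟩
      simpa using (hG v).1 hv
  · rw [hFE, hGE]; simp

/-- Multiplication of the coordinates by nonzero numbers. -/
def diagEquiv {a b : ℂ} (ha : a ≠ 0) (hb : b ≠ 0) : (Fin 2 → ℂ) ≃ₗ[ℂ] (Fin 2 → ℂ) where
  toFun u := ![a * u 0, b * u 1]
  invFun u := ![a⁻¹ * u 0, b⁻¹ * u 1]
  map_add' u v := by ext i; fin_cases i <;> simp <;> ring
  map_smul' c u := by ext i; fin_cases i <;> simp <;> ring
  left_inv u := by ext i; fin_cases i <;> simp <;> field_simp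
  right_inv u := by ext i; fin_cases i <;> simp <;> field_simp

theorem diagEquiv_apply {a b : ℂ} (ha : a ≠ 0) (hb : b ≠ 0) (u : Fin 2 → ℂ) :
    diagEquiv ha hb u = ![a * u 0, b * u 1] := rfl

theorem Uniformizes.rescale {A : PPAV 2} {ψ₁ ψ₂ : K →+* ℂ} {𝔞 𝔟 : Set K}
    {F : (Fin 2 → ℂ) ≃ₗ[ℂ] (Fin 2 → ℂ)} (h : Uniformizes A ψ₁ ψ₂ 𝔞 F) {μ : K} (hμ : μ ≠ 0)
    (hab : ∀ x, μ * x ∈ 𝔟 ↔ x ∈ 𝔞) :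
    Uniformizes A ψ₁ ψ₂ 𝔟 (F.trans (diagEquiv (a := ψ₁ μ) (b := ψ₂ μ) (by simpa using hμ)
      (by simpa using hμ))) := by
  have h1 : ψ₁ μ ≠ 0 := by simpa using hμ
  have h2 : ψ₂ μ ≠ 0 := by simpa using hμ
  intro v
  rw [h v]
  constructor
  · rintro ⟨x, hx, hFx⟩
    refine ⟨μ * x, (hab x).2 hx, ?_⟩
    rw [LinearEquiv.trans_apply, hFx, diagEquiv_apply]
    simp
  · rintro ⟨y, hy, hFy⟩
    refine ⟨y / μ, (hab _).1 (by rwa [mul_div_cancel₀ _ hμ]), ?_⟩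
    rw [LinearEquiv.trans_apply, diagEquiv_apply] at hFy
    have e0 := congrFun hFy 0
    have e1 := congrFun hFy 1
    simp only [Matrix.cons_val_zero, Matrix.cons_val_one] at e0 e1
    ext i
    fin_cases i
    · simp [← e0]; field_simp
    · simp [← e1]; field_simp

variable [IsCMField K]

theorem sub_conj_im (φ : K →+* ℂ) (x : K) :
    φ (x - IsCMField.complexConj K x) = 2 * Complex.I * ((φ x).im : ℂ) := by
  rw [map_sub, embedding_conj, Complex.sub_conj]; push_cast; ring

theorem im_eq_of_sub_conj_eq {μ z z' : K}
    (h : z' - IsCMField.complexConj K z' =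
      μ * IsCMField.complexConj K μ * (z - IsCMField.complexConj K z)) (φ : K →+* ℂ) :
    (φ z').im = Complex.normSq (φ μ) * (φ z).im := by
  have := congrArg φ h
  rw [map_mul, map_mul, sub_conj_im, sub_conj_im, embedding_conj, Complex.mul_conj] at this
  have h3 : (2 * Complex.I) * ((φ z').im : ℂ) =
      (2 * Complex.I) * ((Complex.normSq (φ μ) * (φ z).im : ℝ) : ℂ) := by
    rw [this]; push_cast; ring
  exact_mod_cast mul_left_cancel₀ (by simp) h3

/-- Scaling the coordinates by ψⱼ(μ) multiplies each numerator of `standardForm` by |ψⱼ(μ)|². The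
relation between z and z' multiplies Im ψⱼ(z) by the same factor. -/
theorem IsUniformizedBy.rescale {A : PPAV 2} {ω : 𝓞 (maximalRealSubfield K)}
    {ψ₁ ψ₂ : K →+* ℂ} {z z' μ : K} (h : IsUniformizedBy A ω ψ₁ ψ₂ z) (hμ : μ ≠ 0)
    (hab : ∀ x, μ * x ∈ idealSet z' ↔ x ∈ idealSet z)
    (hz : z' - IsCMField.complexConj K z' =
      μ * IsCMField.complexConj K μ * (z - IsCMField.complexConj K z)) :
    IsUniformizedBy A ω ψ₁ ψ₂ z' := by
  obtain ⟨F, hF, hE⟩ := h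
  refine ⟨_, hF.rescale hμ hab, fun u v => ?_⟩
  have h1 : Complex.normSq (ψ₁ μ) ≠ 0 := by simpa using hμ
  have h2 : Complex.normSq (ψ₂ μ) ≠ 0 := by simpa using hμ
  have hmul : ∀ a x y : ℂ, ((a * x) * (starRingEnd ℂ) (a * y)).im =
      Complex.normSq a * (x * (starRingEnd ℂ) y).im := by
    intro a x y
    rw [map_mul, mul_mul_mul_comm, Complex.mul_conj, Complex.im_ofReal_mul]
  rw [hE, standardForm, standardForm, im_eq_of_sub_conj_eq hz, im_eq_of_sub_conj_eq hz]
  simp only [LinearEquiv.trans_apply, diagEquiv_apply, Matrix.cons_val_zero, Matrix.cons_val_one,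
    hmul]
  congr 1
  · rw [mul_left_comm, mul_div_mul_left _ _ h1]
  · rw [mul_left_comm, mul_div_mul_left _ _ h2]

/-- A surface uniformized by a module over the ring of integers has complex multiplication. -/
theorem Uniformizes.hasCM (h4 : Module.finrank ℚ K = 4) {A : PPAV 2} {ψ₁ ψ₂ : K →+* ℂ}
    {𝔞 : Set K} {F : (Fin 2 → ℂ) ≃ₗ[ℂ] (Fin 2 → ℂ)} (h : Uniformizes A ψ₁ ψ₂ 𝔞 F)
    (h𝔞 : ∀ (a : 𝓞 K), ∀ x ∈ 𝔞, (a : K) * x ∈ 𝔞) : A.HasCM K := by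
  refine ⟨by rw [h4], ?_⟩
  let D : 𝓞 K → Module.End ℂ (Fin 2 → ℂ) := fun a =>
    F.symm.toLinearMap ∘ₗ Algebra.lmul ℂ (Fin 2 → ℂ) ![ψ₁ a, ψ₂ a] ∘ₗ F.toLinearMap
  have hD : ∀ a v, D a v = F.symm (![ψ₁ a, ψ₂ a] * F v) := fun a v => rfl
  have hmem : ∀ a, D a ∈ A.endRing := by
    intro a v hv
    obtain ⟨x, hx, hFx⟩ := (h v).1 hv
    refine (h _).2 ⟨a * x, h𝔞 a x hx, ?_⟩
    rw [hD, LinearEquiv.apply_symm_apply, hFx]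
    ext i; fin_cases i <;> simp
  have hvec : ∀ p q : K, ![ψ₁ (p * q), ψ₂ (p * q)] = ![ψ₁ p, ψ₂ p] * ![ψ₁ q, ψ₂ q] := by
    intro p q; ext i; fin_cases i <;> simp
  have hvec' : ∀ p q : K, ![ψ₁ (p + q), ψ₂ (p + q)] = ![ψ₁ p, ψ₂ p] + ![ψ₁ q, ψ₂ q] := by
    intro p q; ext i; fin_cases i <;> simp
  have h1 : (![1, 1] : Fin 2 → ℂ) = 1 := by ext i; fin_cases i <;> rfl
  have h0 : (![0, 0] : Fin 2 → ℂ) = 0 := by ext i; fin_cases i <;> rfl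
  refine ⟨{ toFun := fun a => ⟨D a, hmem a⟩
            map_one' := Subtype.ext (LinearMap.ext fun v => by simp [hD, h1])
            map_zero' := Subtype.ext (LinearMap.ext fun v => by simp [hD, h0])
            map_mul' := fun a b => Subtype.ext (LinearMap.ext fun v => by
              change D (a * b) v = D a (D b v)
              rw [hD, hD, hD, LinearEquiv.apply_symm_apply,
                show ((a * b : 𝓞 K) : K) = a * b from rfl, hvec, mul_assoc])
            map_add' := fun a b => Subtype.ext (LinearMap.ext fun v => by
              change D (a + b) v = D a v + D b v
              rw [hD, hD, hD, show ((a + b : 𝓞 K) : K) = a + b from rfl, hvec', add_mul, map_add]) }, ?_⟩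
  rw [injective_iff_map_eq_zero]
  intro a ha
  have h2 : D a = 0 := congrArg Subtype.val ha
  have h3 := congrArg (fun f : Module.End ℂ (Fin 2 → ℂ) => F (f (F.symm 1)) 0) h2
  simpa [hD] using h3

theorem embeddingSumMatrix_eq (h2 : Module.finrank ℚ (maximalRealSubfield K) = 2)
    {ω : 𝓞 (maximalRealSubfield K)} {ψ₁ ψ₂ : K →+* ℂ} (h : IsPair ω ψ₁ ψ₂) (z : K) :
    embeddingSumMatrix ω ψ₁ ψ₂ z =
      tracePeriod (ψ₁ (realInt ω)).re (ψ₂ (realInt ω)).re (ψ₁ z) (ψ₂ z) := by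
  have hw : ∀ ψ : K →+* ℂ, (((ψ (realInt ω)).re : ℝ) : ℂ) = ψ (realInt ω) := fun ψ =>
    (embedding_real_eq ψ (conj_realInt ω)).symm
  have hd : ψ₁ (realInt ω) - ψ₂ (realInt ω) ≠ 0 := sub_ne_zero.2 h
  have hd' : ψ₂ (realInt ω) - ψ₁ (realInt ω) ≠ 0 := sub_ne_zero.2 h.symm
  have hdd : (ψ₂ (realInt ω) - ψ₁ (realInt ω))⁻¹ = -(ψ₁ (realInt ω) - ψ₂ (realInt ω))⁻¹ := by
    rw [← inv_neg, neg_sub]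
  ext i j
  fin_cases i <;> fin_cases j <;>
    simp [embeddingSumMatrix, tracePeriod, hw, h.map_delta h2, h.symm.map_delta h2,
      ← realInt_apply, hdd] <;> ring

theorem isPair_of_re_lt {ω : 𝓞 (maximalRealSubfield K)} {ψ₁ ψ₂ : K →+* ℂ}
    (h : (ψ₂ (realInt ω)).re < (ψ₁ (realInt ω)).re) : IsPair ω ψ₁ ψ₂ :=
  fun e => by rw [e] at h; exact lt_irrefl _ h

theorem embeddingSumMatrix_mem (h2 : Module.finrank ℚ (maximalRealSubfield K) = 2)
    {ω : 𝓞 (maximalRealSubfield K)} {ψ₁ ψ₂ : K →+* ℂ}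
    (hlt : (ψ₂ (realInt ω)).re < (ψ₁ (realInt ω)).re) {z : K} (h₁ : 0 < (ψ₁ z).im)
    (h₂ : (ψ₂ z).im < 0) : embeddingSumMatrix ω ψ₁ ψ₂ z ∈ siegelUpperHalfSpace 2 := by
  rw [embeddingSumMatrix_eq h2 (isPair_of_re_lt hlt)]
  exact tracePeriod_mem hlt h₁ h₂

/-- The link between the matrix Z_z and the ideal zO + O: the inverse of `traceCoord` is the
required uniformization. -/
theorem isUniformizedBy_ofPeriodMatrix (h2 : Module.finrank ℚ (maximalRealSubfield K) = 2)
    {ω : 𝓞 (maximalRealSubfield K)} (hω : Algebra.adjoin ℤ {ω} = ⊤) {ψ₁ ψ₂ : K →+* ℂ}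
    (hlt : (ψ₂ (realInt ω)).re < (ψ₁ (realInt ω)).re) {z : K} (h₁ : 0 < (ψ₁ z).im)
    (h₂ : (ψ₂ z).im < 0) {Z : Matrix (Fin 2) (Fin 2) ℂ} (hZ : Z ∈ siegelUpperHalfSpace 2)
    (hZz : Z = embeddingSumMatrix ω ψ₁ ψ₂ z) :
    IsUniformizedBy (ofPeriodMatrix Z hZ) ω ψ₁ ψ₂ z := by
  have hp := isPair_of_re_lt hlt
  rw [embeddingSumMatrix_eq h2 hp] at hZz
  subst hZz
  obtain ⟨t, d, hq, ht⟩ := exists_sq_eq h2 ω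
  have hw : ∀ ψ : K →+* ℂ, (((ψ (realInt ω)).re : ℝ) : ℂ) = ψ (realInt ω) := fun ψ =>
    (embedding_real_eq ψ (conj_realInt ω)).symm
  have hsum := hp.add_eq hq
  refine ⟨(traceCoord hlt).symm, fun v => ?_, fun u v => ?_⟩
  · have hlat : v ∈ (ofPeriodMatrix _ hZ).lattice ↔ ∃ c : Fin 2 ⊕ Fin 2 → ℤ,
        ∑ i, c i • periodVectors (tracePeriod (ψ₁ (realInt ω)).re (ψ₂ (realInt ω)).re (ψ₁ z) (ψ₂ z))
          i = v := Submodule.mem_span_range_iff_exists_fun ℤ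
    -- The last period vector corresponds to -ω' = ω - t, which accounts for the term -t times its
    -- coefficient.
    have hcomb : ∀ c : Fin 2 ⊕ Fin 2 → ℤ, ∑ i, c i • periodVectors
        (tracePeriod (ψ₁ (realInt ω)).re (ψ₂ (realInt ω)).re (ψ₁ z) (ψ₂ z)) i =
        traceCoord hlt ![ψ₁ (z * (c (Sum.inl 1) + c (Sum.inl 0) * realInt ω) +
          (c (Sum.inr 0) - t * c (Sum.inr 1) + c (Sum.inr 1) * realInt ω)),
          ψ₂ (z * (c (Sum.inl 1) + c (Sum.inl 0) * realInt ω) +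
          (c (Sum.inr 0) - t * c (Sum.inr 1) + c (Sum.inr 1) * realInt ω))] := by
      intro c
      rw [periodVectors_tracePeriod hlt]
      simp only [Fintype.sum_sum_type, Fin.sum_univ_two, Sum.elim_inl, Sum.elim_inr,
        Matrix.cons_val_zero, Matrix.cons_val_one, ← map_zsmul, ← map_add]
      congr 1
      ext i
      fin_cases i
      · simp [hw]
        linear_combination (c (Sum.inr 1) : ℂ) * (-hsum)
      · simp [hw]
        linear_combination (c (Sum.inr 1) : ℂ) * (-hsum)
    rw [hlat]
    constructor
    · rintro ⟨c, rfl⟩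
      refine ⟨_, ⟨c (Sum.inl 1) + c (Sum.inl 0) * ω,
        c (Sum.inr 0) - t * c (Sum.inr 1) + c (Sum.inr 1) * ω, rfl⟩, ?_⟩
      rw [hcomb, LinearEquiv.symm_apply_apply]
      simp
    · rintro ⟨x, ⟨a, b, rfl⟩, hx⟩
      obtain ⟨m, n, rfl⟩ := exists_int_coord h2 hω a
      obtain ⟨m', n', rfl⟩ := exists_int_coord h2 hω b
      -- Here 1 must receive the coefficient m' + t n', because n'(ω - t) contributes -t n' to the
      -- constant term.
      refine ⟨Sum.elim ![n, m] ![m' + t * n', n'], ?_⟩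
      rw [hcomb, ← LinearEquiv.eq_symm_apply, hx]
      simp
  · have h := periodForm_tracePeriod hlt h₁ h₂ ((traceCoord hlt).symm u) ((traceCoord hlt).symm v)
    simp only [LinearEquiv.apply_symm_apply] at h
    rw [standardForm, hp.map_delta h2, hp.symm.map_delta h2, Complex.sub_re, Complex.sub_re]
    exact h

end uniformization

end

/-! ### Unimodularity of the polarization and the diagonal action of O_K. -/

section

namespace PPAV

variable {g : ℕ} (A : PPAV g)

theorem form_skew (u v : Fin g → ℂ) : A.form u v = -A.form v u := by
  have := A.alternating (u + v)
  simp only [map_add, LinearMap.add_apply, A.alternating, zero_add, add_zero] at this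
  linear_combination this

/-- The lattice spans ℂ^g over ℝ, so v pairs to zero with everything, in particular with iv, and
positivity gives v = 0. -/
theorem eq_zero_of_form {v : Fin g → ℂ} (h : ∀ u ∈ A.lattice, A.form v u = 0) : v = 0 := by
  have hle : (⊤ : Submodule ℝ (Fin g → ℂ)) ≤ LinearMap.ker (A.form v) := by
    rw [← A.full, Submodule.span_le]
    exact fun u hu => h u hu
  by_contra hv
  have h1 := A.positive v hv
  rw [form_skew, hle (Submodule.mem_top (x := Complex.I • v))] at h1
  simp at h1

/-- The lattice is its own dual with respect to the polarization. -/
theorem mem_lattice_of_form {v : Fin g → ℂ} (h : ∀ u ∈ A.lattice, ∃ n : ℤ, A.form v u = n) :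
    v ∈ A.lattice := by
  obtain ⟨b, hdet⟩ := A.principal
  have hint := fun i j => A.integral (b i) (b i).2 (b j) (b j).2
  choose M hM using hint
  have hMdet : (Matrix.of M).det = 1 := by
    have h1 : (Matrix.of fun i j => A.form (b i) (b j)) =
        (Int.castRingHom ℝ).mapMatrix (Matrix.of M) := by
      ext i j; simp [hM]
    rw [h1, ← RingHom.map_det, eq_intCast] at hdet
    exact_mod_cast hdet
  choose n hn using fun j => h (b j) (b j).2
  -- The Gram matrix has determinant 1, so its inverse is integral. The lattice vector with
  -- coordinates m has the same pairings as v.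
  set m := Matrix.vecMul n (Matrix.of M)⁻¹ with hm
  have hmM : Matrix.vecMul m (Matrix.of M) = n := by
    rw [hm, Matrix.vecMul_vecMul, Matrix.nonsing_inv_mul _ (by rw [hMdet]; exact isUnit_one),
      Matrix.vecMul_one]
  set l : A.lattice := ∑ i, m i • b i with hl
  have hzero : v - l = 0 := by
    refine A.eq_zero_of_form ?_
    have hb : ∀ j, A.form (v - l) (b j) = 0 := by
      intro j
      have h2 := congrFun hmM j
      simp only [Matrix.vecMul, dotProduct, Matrix.of_apply] at h2
      rw [map_sub, LinearMap.sub_apply, hn, hl]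
      push_cast
      rw [map_sum, LinearMap.sum_apply]
      simp only [map_zsmul, LinearMap.smul_apply, hM]
      rw [← h2]
      push_cast
      simp
    intro u hu
    have hu' : (⟨u, hu⟩ : A.lattice) = ∑ j, b.repr ⟨u, hu⟩ j • b j := (b.sum_repr _).symm
    have hu'' := congrArg (Subtype.val) hu'
    push_cast at hu''
    rw [hu'', map_sum]
    refine Finset.sum_eq_zero fun j _ => ?_
    rw [map_zsmul, hb, smul_zero]
  rw [sub_eq_zero] at hzero
  rw [hzero]
  exact l.2

theorem exists_ne_zero_mem [NeZero g] : ∃ v ∈ A.lattice, v ≠ 0 := by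
  by_contra! hc
  have hle : (⊤ : Submodule ℝ (Fin g → ℂ)) ≤ ⊥ := by
    rw [← A.full, Submodule.span_le]
    exact fun u hu => by simpa using hc u hu
  have : (1 : Fin g → ℂ) ∈ (⊥ : Submodule ℝ (Fin g → ℂ)) := hle Submodule.mem_top
  rw [Submodule.mem_bot] at this
  have := congrFun this ⟨0, Nat.pos_of_ne_zero (NeZero.ne g)⟩
  simp at this

end PPAV

theorem exists_character {R V : Type*} [Ring R] [AddCommGroup V] [Module ℂ V]
    (T : R →+* Module.End ℂ V) {e : V} (he : e ≠ 0) (h : ∀ a, ∃ c : ℂ, T a e = c • e) :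
    ∃ χ : R →+* ℂ, ∀ a, T a e = χ a • e := by
  choose f hf using h
  have hinj := smul_left_injective ℂ he
  exact ⟨{ toFun := f
           map_one' := hinj (by simp only [← hf]; simp)
           map_zero' := hinj (by simp only [← hf]; simp)
           map_mul' := fun a b => hinj (by
             change f (a * b) • e = (f a * f b) • e
             rw [← hf, map_mul, Module.End.mul_apply, hf, map_smul, hf, smul_smul, mul_comm])
           map_add' := fun a b => hinj (by
             change f (a + b) • e = (f a + f b) • e
             rw [← hf, map_add, LinearMap.add_apply, hf, hf, add_smul]) }, hf⟩

/-- In characteristic zero the kernel meets ℤ trivially, so it is zero, and the character extends to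
the field of fractions. -/
theorem exists_embedding_of_character {K : Type*} [Field K] [NumberField K] (χ : 𝓞 K →+* ℂ) :
    ∃ ψ : K →+* ℂ, ∀ a : 𝓞 K, ψ a = χ a := by
  have hinj : Function.Injective χ := by
    rw [RingHom.injective_iff_ker_eq_bot]
    refine Ideal.eq_bot_of_comap_eq_bot (R := ℤ) ?_
    rw [eq_bot_iff]
    intro n hn
    simpa using hn
  exact ⟨IsFractionRing.lift hinj, fun a => IsFractionRing.lift_algebraMap hinj a⟩

variable {K : Type*} [Field K] [NumberField K]

theorem exists_int_mul_eq (x : K) : ∃ (a : 𝓞 K) (n : ℤ), n ≠ 0 ∧ (n : K) * x = a := by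
  obtain ⟨m, hm, hi⟩ := ((IsFractionRing.isAlgebraic_iff ℤ ℚ _).2
    (Algebra.IsAlgebraic.isAlgebraic (R := ℚ) x)).exists_integral_multiple
  exact ⟨⟨m • x, hi⟩, m, hm, by simp⟩

variable [IsCMField K]

/-- On a plane, T a₀ has two distinct eigenvalues and hence two eigenlines. The other operators
commute with it and preserve each line, so each line carries a character. -/
theorem exists_coordinates {V : Type*} [AddCommGroup V] [Module ℂ V]
    (hV : Module.finrank ℂ V = 2) {R : Type*} [CommRing R] (T : R →+* Module.End ℂ V) (a₀ : R)
    {r₁ r₂ : ℂ} (hr : r₁ ≠ r₂) (hT : ∀ v, T a₀ (T a₀ v) = (r₁ + r₂) • T a₀ v - (r₁ * r₂) • v)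
    (h₁ : ∃ v, T a₀ v ≠ r₁ • v) (h₂ : ∃ v, T a₀ v ≠ r₂ • v) :
    ∃ (χ₁ χ₂ : R →+* ℂ) (F : V ≃ₗ[ℂ] (Fin 2 → ℂ)), χ₁ a₀ = r₁ ∧ χ₂ a₀ = r₂ ∧
      ∀ a v, F (T a v) = ![χ₁ a * F v 0, χ₂ a * F v 1] := by
  obtain ⟨v₁, hv₁⟩ := h₂
  obtain ⟨v₂, hv₂⟩ := h₁
  -- The quadratic relation sends the image of T a₀ - r₂ into the r₁-eigenspace and vice versa. That
  -- T a₀ is neither of the two scalars makes both eigenvectors nonzero.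
  set e₁ := T a₀ v₁ - r₂ • v₁ with he₁
  set e₂ := T a₀ v₂ - r₁ • v₂ with he₂
  have hne₁ : e₁ ≠ 0 := sub_ne_zero.2 hv₁
  have hne₂ : e₂ ≠ 0 := sub_ne_zero.2 hv₂
  have hT₁ : T a₀ e₁ = r₁ • e₁ := by rw [he₁, map_sub, map_smul, hT]; module
  have hT₂ : T a₀ e₂ = r₂ • e₂ := by rw [he₂, map_sub, map_smul, hT]; module
  have hli : LinearIndependent ℂ ![e₁, e₂] := by
    rw [LinearIndependent.pair_iff]
    intro s t hst
    have h1 := congrArg (T a₀) hst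
    simp only [map_add, map_smul, hT₁, hT₂, map_zero] at h1
    have h2 : ((r₁ - r₂) * s) • e₁ = 0 := by
      calc ((r₁ - r₂) * s) • e₁ = (s • r₁ • e₁ + t • r₂ • e₂) - r₂ • (s • e₁ + t • e₂) := by module
        _ = 0 := by rw [h1, hst]; simp
    have hs : s = 0 := by
      rcases smul_eq_zero.1 h2 with h | h
      · exact (mul_eq_zero.1 h).resolve_left (sub_ne_zero.2 hr)
      · exact absurd h hne₁
    rw [hs, zero_smul, zero_add] at hst
    exact ⟨hs, (smul_eq_zero.1 hst).resolve_right hne₂⟩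
  let b := basisOfLinearIndependentOfCardEqFinrank hli (by simp [hV])
  have hb0 : b 0 = e₁ := by simp [b]
  have hb1 : b 1 = e₂ := by simp [b]
  have hexp : ∀ v, v = b.equivFun v 0 • e₁ + b.equivFun v 1 • e₂ := by
    intro v
    conv_lhs => rw [← b.sum_equivFun v]
    rw [Fin.sum_univ_two, hb0, hb1]
  have hcomm : ∀ a v, T a₀ (T a v) = T a (T a₀ v) := by
    intro a v
    rw [← Module.End.mul_apply, ← Module.End.mul_apply, ← map_mul, ← map_mul, mul_comm]
  have hc₁ : ∀ a, ∃ c : ℂ, T a e₁ = c • e₁ := by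
    intro a
    set x := T a e₁ with hx
    have hTx : T a₀ x = r₁ • x := by rw [hx, hcomm, hT₁, map_smul]
    have h1 := hexp x
    set p := b.equivFun x 0
    set q := b.equivFun x 1
    refine ⟨p, ?_⟩
    rw [h1] at hTx
    simp only [map_add, map_smul, hT₁, hT₂] at hTx
    have h2 : ((r₂ - r₁) * q) • e₂ = 0 := by
      calc ((r₂ - r₁) * q) • e₂ = (p • r₁ • e₁ + q • r₂ • e₂) - r₁ • (p • e₁ + q • e₂) := by module
        _ = 0 := by rw [hTx]; simp
    have hq : q = 0 := by
      rcases smul_eq_zero.1 h2 with h | h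
      · exact (mul_eq_zero.1 h).resolve_left (sub_ne_zero.2 hr.symm)
      · exact absurd h hne₂
    rw [h1, hq]; simp
  have hc₂ : ∀ a, ∃ c : ℂ, T a e₂ = c • e₂ := by
    intro a
    set x := T a e₂ with hx
    have hTx : T a₀ x = r₂ • x := by rw [hx, hcomm, hT₂, map_smul]
    have h1 := hexp x
    set p := b.equivFun x 0
    set q := b.equivFun x 1
    refine ⟨q, ?_⟩
    rw [h1] at hTx
    simp only [map_add, map_smul, hT₁, hT₂] at hTx
    have h2 : ((r₁ - r₂) * p) • e₁ = 0 := by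
      calc ((r₁ - r₂) * p) • e₁ = (p • r₁ • e₁ + q • r₂ • e₂) - r₂ • (p • e₁ + q • e₂) := by module
        _ = 0 := by rw [hTx]; simp
    have hp : p = 0 := by
      rcases smul_eq_zero.1 h2 with h | h
      · exact (mul_eq_zero.1 h).resolve_left (sub_ne_zero.2 hr)
      · exact absurd h hne₁
    rw [h1, hp]; simp
  obtain ⟨χ₁, hχ₁⟩ := exists_character T hne₁ hc₁
  obtain ⟨χ₂, hχ₂⟩ := exists_character T hne₂ hc₂
  refine ⟨χ₁, χ₂, b.equivFun, ?_, ?_, fun a v => ?_⟩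
  · exact smul_left_injective ℂ hne₁ (by simp only [← hχ₁, hT₁])
  · exact smul_left_injective ℂ hne₂ (by simp only [← hχ₂, hT₂])
  · have hv : T a v = (χ₁ a * b.equivFun v 0) • b 0 + (χ₂ a * b.equivFun v 1) • b 1 := by
      conv_lhs => rw [hexp v]
      rw [map_add, map_smul, map_smul, hχ₁, hχ₂, hb0, hb1]; module
    rw [hv]
    ext i
    fin_cases i <;> simp

/-- A surface with complex multiplication is the quotient of `ℂ²` by the image of a module under
the two embeddings of a CM type. -/
theorem PPAV.HasCM.exists_uniformizes {A : PPAV 2} (hA : A.HasCM K)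
    {ω : 𝓞 (maximalRealSubfield K)} (hω : Algebra.adjoin ℤ {ω} = ⊤) :
    ∃ (ψ₁ ψ₂ : K →+* ℂ) (𝔞 : Submodule (𝓞 K) K) (F : (Fin 2 → ℂ) ≃ₗ[ℂ] (Fin 2 → ℂ)),
      IsPair ω ψ₁ ψ₂ ∧ Uniformizes A ψ₁ ψ₂ 𝔞 F := by
  obtain ⟨h4, ι, -⟩ := hA
  replace h4 : Module.finrank ℚ K = 4 := h4
  have h2 := finrank_maximalRealSubfield h4
  obtain ⟨t, d, hq, ht⟩ := exists_sq_eq h2 ω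
  let T : 𝓞 K →+* Module.End ℂ (Fin 2 → ℂ) := A.endRing.subtype.comp ι
  have hTmem : ∀ a, ∀ v ∈ A.lattice, T a v ∈ A.lattice := fun a => (ι a).2
  let a₀ : 𝓞 K := algebraMap (𝓞 (maximalRealSubfield K)) (𝓞 K) ω
  have ha₀ : (a₀ : K) = realInt ω := rfl
  obtain ⟨v₀, hv₀, hv₀0⟩ := A.exists_ne_zero_mem
  obtain φ : K →+* ℂ := Classical.choice inferInstance
  obtain ⟨φ', hφ⟩ := exists_isPair h4 hω φ
  have hnotscalar : ∀ σ : K →+* ℂ, ∃ v, T a₀ v ≠ σ (realInt ω) • v := by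
    -- If ω acted as the real number σ(ω), that number would be the ratio of the two integers E(ωv₀,
    -- u) and E(v₀, u), but ω is irrational.
    intro σ
    by_contra! hc
    obtain ⟨u, hu, hne⟩ : ∃ u ∈ A.lattice, A.form v₀ u ≠ 0 := by
      by_contra! hcc
      exact hv₀0 (A.eq_zero_of_form hcc)
    obtain ⟨m, hm⟩ := A.integral v₀ hv₀ u hu
    obtain ⟨k, hk⟩ := A.integral _ (hTmem a₀ v₀ hv₀) u hu
    have hreal := embedding_real_eq σ (conj_realInt ω)
    have hsm : T a₀ v₀ = (σ (realInt ω)).re • v₀ := by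
      rw [hc, hreal]; ext i; simp
    rw [hsm, map_smul, LinearMap.smul_apply, hm, smul_eq_mul] at hk
    rw [hm] at hne
    refine realInt_ne_rat h2 hω ((k : ℚ) / m) (σ.injective ?_)
    rw [hreal]
    have : (σ (realInt ω)).re = k / m := by field_simp; linear_combination hk
    rw [this]; simp
  have hsum := hφ.add_eq hq
  have hsq := embedding_sq φ hq
  have hprod : φ (realInt ω) * φ' (realInt ω) = d := by
    have : φ' (realInt ω) = t - φ (realInt ω) := by linear_combination hsum
    rw [this]; linear_combination -hsq
  have ha₀sq : a₀ * a₀ = (t : 𝓞 K) * a₀ - d := by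
    change algebraMap _ _ ω * algebraMap _ _ ω = _
    rw [← map_mul, ← sq, hq]; simp [a₀]
  have hquad : ∀ v, T a₀ (T a₀ v) = (φ (realInt ω) + φ' (realInt ω)) • T a₀ v -
      (φ (realInt ω) * φ' (realInt ω)) • v := by
    intro v
    rw [← Module.End.mul_apply, ← map_mul, ha₀sq, hsum, hprod, map_sub, map_mul, map_intCast,
      map_intCast, LinearMap.sub_apply, Module.End.mul_apply]
    ext i; simp [Module.End.intCast_apply]
  obtain ⟨χ₁, χ₂, F₀, hχ₁, hχ₂, hF₀⟩ := exists_coordinates (by simp) T a₀ hφ hquad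
    (hnotscalar φ) (hnotscalar φ')
  obtain ⟨ψ₁, hψ₁⟩ := exists_embedding_of_character χ₁
  obtain ⟨ψ₂, hψ₂⟩ := exists_embedding_of_character χ₂
  have hpair : IsPair ω ψ₁ ψ₂ := by
    rw [IsPair, ← ha₀, hψ₁, hψ₂, hχ₁, hχ₂]; exact hφ
  simp only [← hψ₁, ← hψ₂] at hF₀
  -- every lattice vector is a multiple of `v₀` by an element of `K`
  let P : K →ₗ[ℚ] (Fin 2 → ℂ) :=
    { toFun := fun x => F₀.symm ![ψ₁ x * F₀ v₀ 0, ψ₂ x * F₀ v₀ 1]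
      map_add' := fun x y => by
        rw [← map_add]; congr 1; ext i; fin_cases i <;> simp <;> ring
      map_smul' := fun q x => by
        have hs : ∀ v : Fin 2 → ℂ, q • v = (q : ℂ) • v := fun v => by
          ext i; simp [Rat.smul_def]
        rw [RingHom.id_apply, hs, ← map_smul]
        congr 1; ext i; fin_cases i <;> simp [Rat.smul_def] <;> ring }
  have hP : ∀ x, F₀ (P x) = ![ψ₁ x * F₀ v₀ 0, ψ₂ x * F₀ v₀ 1] := fun x =>
    LinearEquiv.apply_symm_apply _ _
  have hPinj : Function.Injective P := by
    rw [injective_iff_map_eq_zero]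
    intro x hx
    have h1 := hP x
    rw [hx, map_zero] at h1
    by_contra hx0
    apply hv₀0
    have e0 := congrFun h1 0
    have e1 := congrFun h1 1
    simp [hx0] at e0 e1
    apply F₀.injective
    ext i
    fin_cases i
    · simpa using e0
    · simpa using e1
  set U : Submodule ℚ (Fin 2 → ℂ) := Submodule.span ℚ (A.lattice : Set (Fin 2 → ℂ)) with hU
  have hPU : LinearMap.range P ≤ U := by
    rintro _ ⟨x, rfl⟩
    obtain ⟨a, n, hn, hx⟩ := exists_int_mul_eq x
    have h1 : (n : ℚ) • P x = T a v₀ := by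
      rw [← map_smul]
      apply F₀.injective
      have h3 : (n : ℚ) • x = a := by rw [← hx, Rat.smul_def]; simp
      rw [hP, hF₀, h3]
    have h3 : P x = (n : ℚ)⁻¹ • T a v₀ := by
      rw [← h1, smul_smul, inv_mul_cancel₀ (by exact_mod_cast hn), one_smul]
    rw [h3]
    exact U.smul_mem _ (Submodule.subset_span (hTmem a v₀ hv₀))
  obtain ⟨b, -⟩ := A.principal
  have hUb : U ≤ Submodule.span ℚ (Set.range fun i => (b i : Fin 2 → ℂ)) := by
    rw [hU, Submodule.span_le]
    intro u hu
    have hu' : (⟨u, hu⟩ : A.lattice) = ∑ j, b.repr ⟨u, hu⟩ j • b j := (b.sum_repr _).symm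
    have hu'' := congrArg (Subtype.val) hu'
    push_cast at hu''
    rw [hu'']
    refine Submodule.sum_mem _ fun j _ => ?_
    rw [← Int.cast_smul_eq_zsmul ℚ]
    exact Submodule.smul_mem _ _ (Submodule.subset_span ⟨j, rfl⟩)
  have hfd : FiniteDimensional ℚ (Submodule.span ℚ (Set.range fun i => (b i : Fin 2 → ℂ))) :=
    FiniteDimensional.span_of_finite ℚ (Set.finite_range _)
  -- The image of P has dimension 4 and lies in the ℚ-span of the lattice, whose dimension is at
  -- most 4. So the two coincide, and every lattice vector is P(x) for some x.
  have hfr : Module.finrank ℚ (LinearMap.range P) = 4 := by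
    rw [LinearMap.finrank_range_of_inj hPinj, h4]
  have hle4 : Module.finrank ℚ (Submodule.span ℚ (Set.range fun i => (b i : Fin 2 → ℂ))) ≤ 4 :=
    (finrank_range_le_card (R := ℚ) fun i => (b i : Fin 2 → ℂ)).trans (by simp)
  have hrange : LinearMap.range P = Submodule.span ℚ (Set.range fun i => (b i : Fin 2 → ℂ)) :=
    Submodule.eq_of_le_of_finrank_le (hPU.trans hUb) (by rw [hfr]; exact hle4)
  have hlat : ∀ v ∈ A.lattice, ∃ x, P x = v := by
    intro v hv
    have : v ∈ LinearMap.range P := by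
      rw [hrange]; exact hUb (Submodule.subset_span hv)
    exact this
  -- If a coordinate of v₀ vanished, it would vanish on the whole lattice, which could not span ℂ².
  have hl : ∀ i, F₀ v₀ i ≠ 0 := by
    intro i h0
    have hle : (⊤ : Submodule ℝ (Fin 2 → ℂ)) ≤
        LinearMap.ker ((LinearMap.proj i ∘ₗ F₀.toLinearMap).restrictScalars ℝ) := by
      rw [← A.full, Submodule.span_le]
      intro u hu
      obtain ⟨x, rfl⟩ := hlat u hu
      change F₀ (P x) i = 0
      rw [hP]
      fin_cases i
      · simp only [Fin.zero_eta] at h0; simp [h0]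
      · simp only [Fin.mk_one] at h0; simp [h0]
    have h1 : F₀ (F₀.symm 1) i = 0 := hle (Submodule.mem_top (x := F₀.symm 1))
    simp at h1
  -- The coordinates are normalized so that v₀ becomes (1, 1) and P(x) becomes (ψ₁ x, ψ₂ x).
  set F := F₀.trans (diagEquiv (inv_ne_zero (hl 0)) (inv_ne_zero (hl 1))) with hF
  have hFP : ∀ x, F (P x) = ![ψ₁ x, ψ₂ x] := by
    intro x
    have := hl 0
    have := hl 1
    rw [hF, LinearEquiv.trans_apply, hP, diagEquiv_apply]
    ext i; fin_cases i <;> simp <;> field_simp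
  let 𝔞 : Submodule (𝓞 K) K :=
    { carrier := {x | P x ∈ A.lattice}
      add_mem' := fun {x y} hx hy => by
        change P (x + y) ∈ A.lattice
        rw [map_add]; exact A.lattice.add_mem hx hy
      zero_mem' := by
        change P 0 ∈ A.lattice
        rw [map_zero]; exact A.lattice.zero_mem
      smul_mem' := fun a x hx => by
        change P (a • x) ∈ A.lattice
        have : P (a • x) = T a (P x) := by
          apply F₀.injective
          have hax : a • x = (a : K) * x := rfl
          rw [hF₀, hP, hP, hax]
          ext i; fin_cases i <;> simp [mul_assoc]
        rw [this]
        exact hTmem a _ hx }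
  refine ⟨ψ₁, ψ₂, 𝔞, F, hpair, fun v => ⟨fun hv => ?_, ?_⟩⟩
  · obtain ⟨x, rfl⟩ := hlat v hv
    exact ⟨x, hv, hFP x⟩
  · rintro ⟨x, hx, hFx⟩
    have : v = P x := F.injective (by rw [hFx, hFP])
    rw [this]
    exact hx

end

/-! ### The polarization as a trace form. -/

section

variable {K : Type*} [Field K] [NumberField K] [IsCMField K]
  {ω : 𝓞 (maximalRealSubfield K)}

theorem IsPair.trace_eq (h2 : Module.finrank ℚ (maximalRealSubfield K) = 2)
    (hω : Algebra.adjoin ℤ {ω} = ⊤) {ψ₁ ψ₂ : K →+* ℂ} (h : IsPair ω ψ₁ ψ₂) (x : K) :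
    ((Algebra.trace ℚ K x : ℚ) : ℂ) =
      ψ₁ x + ψ₂ x + (starRingEnd ℂ) (ψ₁ x) + (starRingEnd ℂ) (ψ₂ x) := by
  classical
  have h1 := trace_eq_sum_embeddings (K := ℚ) ℂ (x := x)
  rw [eq_ratCast, ← Fintype.sum_equiv (RingHom.equivRatAlgHom K ℂ) (fun f => f x)
    (fun φ => φ x) (fun _ => by simp [RingHom.equivRatAlgHom_apply])] at h1
  rw [h1]
  have huniv : (Finset.univ : Finset (K →+* ℂ)) =
      {ψ₁, ψ₂, ComplexEmbedding.conjugate ψ₁, ComplexEmbedding.conjugate ψ₂} := by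
    ext σ
    simpa using h.cases h2 hω σ
  have hne : ∀ {σ τ : K →+* ℂ}, IsPair ω σ τ → σ ≠ τ := fun hp e => hp (by rw [e])
  rw [huniv, Finset.sum_insert, Finset.sum_insert, Finset.sum_insert, Finset.sum_singleton]
  · simp only [conj_conjugate_apply]; ring
  · simpa using hne h.conjugate_left.conjugate_right
  · simpa using ⟨hne h.symm.conjugate_right, (conjugate_ne ψ₂).symm⟩
  · simpa using ⟨hne h, (conjugate_ne ψ₁).symm, hne h.conjugate_right⟩

theorem exists_trace_eq (f : K →ₗ[ℚ] ℚ) : ∃ s : K, ∀ x, f x = Algebra.trace ℚ K (x * s) := by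
  refine ⟨(LinearMap.BilinForm.toDual _ (traceForm_nondegenerate ℚ K)).symm f, fun x => ?_⟩
  have := LinearMap.BilinForm.apply_toDual_symm_apply (hB := traceForm_nondegenerate ℚ K) f x
  rw [← this, Algebra.traceForm_apply, mul_comm]

section lattice

variable {A : PPAV 2} {ψ₁ ψ₂ : K →+* ℂ} {𝔞 : Submodule (𝓞 K) K}
  {F : (Fin 2 → ℂ) ≃ₗ[ℂ] (Fin 2 → ℂ)}

theorem Uniformizes.mem_iff (h : Uniformizes A ψ₁ ψ₂ (𝔞 : Set K) F) (x : K) :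
    F.symm ![ψ₁ x, ψ₂ x] ∈ A.lattice ↔ x ∈ 𝔞 := by
  rw [h]
  constructor
  · rintro ⟨y, hy, hxy⟩
    rw [LinearEquiv.apply_symm_apply] at hxy
    have := congrFun hxy 0
    simp only [Matrix.cons_val_zero] at this
    rwa [ψ₁.injective this]
  · intro hx
    exact ⟨x, hx, by simp⟩

theorem Uniformizes.exists_ne_zero (h : Uniformizes A ψ₁ ψ₂ (𝔞 : Set K) F) :
    ∃ x ∈ 𝔞, x ≠ 0 := by
  obtain ⟨v, hv, hv0⟩ := A.exists_ne_zero_mem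
  obtain ⟨x, hx, hFx⟩ := (h v).1 hv
  refine ⟨x, hx, ?_⟩
  rintro rfl
  apply hv0
  apply F.injective
  rw [hFx, map_zero]
  ext i; fin_cases i <;> simp

theorem Uniformizes.exists_int_mul_mem (h : Uniformizes A ψ₁ ψ₂ (𝔞 : Set K) F) (x : K) :
    ∃ n : ℤ, n ≠ 0 ∧ (n : K) * x ∈ 𝔞 := by
  obtain ⟨y, hy, hy0⟩ := h.exists_ne_zero
  obtain ⟨a, n, hn, hx⟩ := exists_int_mul_eq (x / y)
  refine ⟨n, hn, ?_⟩
  have : (n : K) * x = a • y := by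
    change _ = (a : K) * y
    rw [← hx]; field_simp
  rw [this]
  exact 𝔞.smul_mem a hy

/-- The form of `A` in the coordinates `F`. -/
def coordForm (A : PPAV 2) (F : (Fin 2 → ℂ) ≃ₗ[ℂ] (Fin 2 → ℂ)) (u v : Fin 2 → ℂ) : ℝ :=
  A.form (F.symm u) (F.symm v)

theorem coordForm_add_left (u u' v : Fin 2 → ℂ) :
    coordForm A F (u + u') v = coordForm A F u v + coordForm A F u' v := by simp [coordForm]

theorem coordForm_add_right (u v v' : Fin 2 → ℂ) :
    coordForm A F u (v + v') = coordForm A F u v + coordForm A F u v' := by simp [coordForm]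

theorem symm_real_smul (r : ℝ) (v : Fin 2 → ℂ) : F.symm ((r : ℂ) • v) = r • F.symm v := by
  rw [map_smul]; ext i; simp

theorem coordForm_smul_left (r : ℝ) (u v : Fin 2 → ℂ) :
    coordForm A F ((r : ℂ) • u) v = r * coordForm A F u v := by
  rw [coordForm, symm_real_smul]; simp [coordForm]

theorem coordForm_smul_right (r : ℝ) (u v : Fin 2 → ℂ) :
    coordForm A F u ((r : ℂ) • v) = r * coordForm A F u v := by
  rw [coordForm, symm_real_smul]; simp [coordForm]

theorem coordForm_I (u v : Fin 2 → ℂ) :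
    coordForm A F (Complex.I • u) (Complex.I • v) = coordForm A F u v := by
  simp only [coordForm, map_smul, A.compatible]

theorem coordForm_I_right (u v : Fin 2 → ℂ) :
    coordForm A F u (Complex.I • v) = -coordForm A F (Complex.I • u) v := by
  rw [← coordForm_I u, smul_smul, Complex.I_mul_I, coordForm, coordForm]
  simp

/-- The coefficient `H` of the form: `coordForm u v = ∑ Re (H eⱼ v uⱼ)`. -/
def coordCoeff (A : PPAV 2) (F : (Fin 2 → ℂ) ≃ₗ[ℂ] (Fin 2 → ℂ)) (e v : Fin 2 → ℂ) : ℂ :=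
  coordForm A F e v - Complex.I * coordForm A F (Complex.I • e) v

theorem complex_smul_eq (c : ℂ) (u : Fin 2 → ℂ) :
    c • u = (c.re : ℂ) • u + (c.im : ℂ) • (Complex.I • u) := by
  rw [smul_smul, ← add_smul, mul_comm, mul_comm, Complex.re_add_im]

theorem coordForm_complex_smul (c : ℂ) (e v : Fin 2 → ℂ) :
    coordForm A F (c • e) v = (coordCoeff A F e v * c).re := by
  rw [complex_smul_eq, coordForm_add_left, coordForm_smul_left, coordForm_smul_left, coordCoeff]
  simp
  ring

/-- The invariance of the form under i makes the coefficient conjugate-linear in the second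
argument. -/
theorem coordCoeff_complex_smul (c : ℂ) (e v : Fin 2 → ℂ) :
    coordCoeff A F e (c • v) = coordCoeff A F e v * (starRingEnd ℂ) c := by
  rw [complex_smul_eq c v]
  simp only [coordCoeff, coordForm_add_right, coordForm_smul_right, coordForm_I_right]
  have h : coordForm A F (Complex.I • Complex.I • e) v = -coordForm A F e v := by
    rw [smul_smul, Complex.I_mul_I, coordForm, coordForm]; simp
  rw [h]
  apply Complex.ext <;> simp <;> ring

theorem vec_decomp (v : Fin 2 → ℂ) : v = v 0 • ![1, 0] + v 1 • ![0, 1] := by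
  ext i; fin_cases i <;> simp

theorem coordCoeff_eq (e v : Fin 2 → ℂ) : coordCoeff A F e v =
    coordCoeff A F e ![1, 0] * (starRingEnd ℂ) (v 0) +
      coordCoeff A F e ![0, 1] * (starRingEnd ℂ) (v 1) := by
  rw [← coordCoeff_complex_smul, ← coordCoeff_complex_smul]
  conv_lhs => rw [vec_decomp v]
  simp only [coordCoeff, coordForm_add_right]
  push_cast; ring

theorem coordForm_eq (u v : Fin 2 → ℂ) : coordForm A F u v =
    (coordCoeff A F ![1, 0] v * u 0).re + (coordCoeff A F ![0, 1] v * u 1).re := by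
  rw [← coordForm_complex_smul, ← coordForm_complex_smul, ← coordForm_add_left, ← vec_decomp]

/-- The form of a surface with complex multiplication is a trace form. -/
theorem Uniformizes.exists_form_eq (hK : IsPrimitiveQuarticCMField K)
    (hω : Algebra.adjoin ℤ {ω} = ⊤) (hp : IsPair ω ψ₁ ψ₂)
    (h : Uniformizes A ψ₁ ψ₂ (𝔞 : Set K) F) :
    ∃ κ : K, IsCMField.complexConj K κ = -κ ∧ ∀ u v, A.form u v =
      -2 * (ψ₁ κ).im * (F u 0 * (starRingEnd ℂ) (F v 0)).im -
        2 * (ψ₂ κ).im * (F u 1 * (starRingEnd ℂ) (F v 1)).im := by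
  have h2 := hK.finrank_real
  set P : K → (Fin 2 → ℂ) := fun x => ![ψ₁ x, ψ₂ x] with hP
  have hPadd : ∀ x y, P (x + y) = P x + P y := by
    intro x y; ext i; fin_cases i <;> simp [hP]
  have hPmul : ∀ (q : ℚ) x, P (q • x) = ((q : ℝ) : ℂ) • P x := by
    intro q x; ext i; fin_cases i <;> simp [hP, Rat.smul_def]
  have hrat : ∀ x y, ∃ q : ℚ, coordForm A F (P x) (P y) = q := by
    intro x y
    obtain ⟨n, hn, hnx⟩ := h.exists_int_mul_mem x
    obtain ⟨m, hm, hmy⟩ := h.exists_int_mul_mem y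
    obtain ⟨k, hk⟩ := A.integral _ ((h.mem_iff _).2 hnx) _ ((h.mem_iff _).2 hmy)
    have e1 : ((n : K) * x) = (n : ℚ) • x := by simp [Rat.smul_def]
    have e2 : ((m : K) * y) = (m : ℚ) • y := by simp [Rat.smul_def]
    rw [e1, e2] at hk
    change coordForm A F (P _) (P _) = _ at hk
    rw [hPmul, hPmul, coordForm_smul_left, coordForm_smul_right] at hk
    have hnR : (n : ℝ) ≠ 0 := by exact_mod_cast hn
    have hmR : (m : ℝ) ≠ 0 := by exact_mod_cast hm
    refine ⟨k / (n * m), ?_⟩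
    push_cast at hk ⊢
    field_simp
    linear_combination hk
  choose B hB using hrat
  have hS : ∀ y, ∃ s : K, ∀ x, B x y = Algebra.trace ℚ K (x * s) := by
    intro y
    let f : K →ₗ[ℚ] ℚ :=
      { toFun := fun x => B x y
        map_add' := fun x x' => by
          have : ((B (x + x') y : ℚ) : ℝ) = ((B x y + B x' y : ℚ) : ℝ) := by
            push_cast; rw [← hB, ← hB, ← hB, hPadd, coordForm_add_left]
          exact_mod_cast this
        map_smul' := fun q x => by
          have : ((B (q • x) y : ℚ) : ℝ) = ((q * B x y : ℚ) : ℝ) := by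
            push_cast; rw [← hB, ← hB, hPmul, coordForm_smul_left]
          exact_mod_cast this }
    exact exists_trace_eq f
  choose S hS using hS
  have hform : ∀ x y, ((coordForm A F (P x) (P y) : ℝ) : ℂ) =
      ψ₁ (x * S y) + ψ₂ (x * S y) + (starRingEnd ℂ) (ψ₁ (x * S y)) +
        (starRingEnd ℂ) (ψ₂ (x * S y)) := by
    intro x y
    rw [← hp.trace_eq h2 hω, ← hS, hB]; simp
  have hre : ∀ c : ℂ, ((c.re : ℝ) : ℂ) = (c + (starRingEnd ℂ) c) / 2 := by
    intro c; rw [Complex.add_conj]; push_cast; ring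
  -- The form at (x, y) is both the trace of x S(y) and the real part given by the coefficients.
  -- Independence of the four embeddings equates the coefficients.
  have hcoef : ∀ y, coordCoeff A F ![1, 0] (P y) = 2 * ψ₁ (S y) ∧
      coordCoeff A F ![0, 1] (P y) = 2 * ψ₂ (S y) := by
    intro y
    set c₁ := coordCoeff A F ![1, 0] (P y)
    set c₂ := coordCoeff A F ![0, 1] (P y)
    have hind := hp.independent h2 hω (a := c₁ / 2 - ψ₁ (S y)) (b := c₂ / 2 - ψ₂ (S y))
      (c := (starRingEnd ℂ) c₁ / 2 - (starRingEnd ℂ) (ψ₁ (S y)))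
      (d := (starRingEnd ℂ) c₂ / 2 - (starRingEnd ℂ) (ψ₂ (S y))) (fun x => by
        have e := hform x y
        rw [coordForm_eq] at e
        push_cast at e
        rw [hre, hre] at e
        simp only [hP, Matrix.cons_val_zero, Matrix.cons_val_one, map_mul] at e
        linear_combination e)
    exact ⟨by linear_combination 2 * hind.1, by linear_combination 2 * hind.2.1⟩
  have hpc : IsPair ω (ComplexEmbedding.conjugate ψ₁) (ComplexEmbedding.conjugate ψ₂) :=
    hp.conjugate_left.conjugate_right
  obtain ⟨y₀, hy₀⟩ : ∃ y, S y ≠ 0 := by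
    by_contra! hc
    obtain ⟨v, hv, hv0⟩ := A.exists_ne_zero_mem
    apply hv0
    apply A.eq_zero_of_form
    intro u hu
    obtain ⟨x, hx, hFx⟩ := (h u).1 hu
    obtain ⟨y, hy, hFy⟩ := (h v).1 hv
    have e := hform y x
    rw [hc, mul_zero, map_zero, map_zero] at e
    have e' : coordForm A F (P y) (P x) = A.form v u := by
      rw [coordForm]
      congr 1
      · rw [hP]; simp only [← hFy]; simp
      · rw [hP]; simp only [← hFx]; simp
    rw [e'] at e
    simpa using e
  -- By conjugate-linearity of the coefficients, S is complex linear from the conjugate CM type to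
  -- the given one. So `semilinear` applies to S with the conjugate type as source.
  have hT₁ : ∀ y, ψ₁ (S y) = coordCoeff A F ![1, 0] ![1, 0] / 2 *
      ComplexEmbedding.conjugate ψ₁ y +
      coordCoeff A F ![1, 0] ![0, 1] / 2 * ComplexEmbedding.conjugate ψ₂ y := by
    intro y
    have e := (hcoef y).1
    rw [coordCoeff_eq] at e
    simp only [hP, Matrix.cons_val_zero, Matrix.cons_val_one] at e
    rw [conj_conjugate_apply, conj_conjugate_apply]
    linear_combination -e / 2
  have hT₂ : ∀ y, ψ₂ (S y) = coordCoeff A F ![0, 1] ![1, 0] / 2 *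
      ComplexEmbedding.conjugate ψ₁ y +
      coordCoeff A F ![0, 1] ![0, 1] / 2 * ComplexEmbedding.conjugate ψ₂ y := by
    intro y
    have e := (hcoef y).2
    rw [coordCoeff_eq] at e
    simp only [hP, Matrix.cons_val_zero, Matrix.cons_val_one] at e
    rw [conj_conjugate_apply, conj_conjugate_apply]
    linear_combination -e / 2
  obtain ⟨κ, s, hκ0, hSs, hs⟩ := hK.semilinear hω hpc hp hy₀ hT₁ hT₂
  -- In the exchanged case s would be an involution, hence fix ω, and then `ψ₁` and `ψ₂` would agree
  -- on ω.
  have hsc : ∀ x, s x = IsCMField.complexConj K x := by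
    rcases hs with ⟨h1, -⟩ | ⟨h1, h1'⟩
    · intro x
      apply ψ₁.injective
      rw [h1, conj_conjugate_apply, embedding_conj]
    · exfalso
      have hinv : ∀ x, s (s x) = x := by
        intro x
        apply ψ₁.injective
        rw [h1, conj_conjugate_apply, h1', conj_conjugate_apply, Complex.conj_conj]
      have hw := hK.fixes_of_involutive hω hinv
      have e := h1 (realInt ω)
      rw [hw, conjugate_realInt] at e
      exact hp e
  have hSκ : ∀ y, S y = κ * IsCMField.complexConj K y := fun y => by rw [hSs, hsc]
  have hc1 := hp.independent h2 hω (a := 0) (b := 0)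
    (c := coordCoeff A F ![1, 0] ![1, 0] / 2 - ψ₁ κ) (d := coordCoeff A F ![1, 0] ![0, 1] / 2)
    (fun y => by
      have e := hT₁ y
      rw [hSκ, map_mul, embedding_conj, conj_conjugate_apply, conj_conjugate_apply] at e
      linear_combination -e)
  have hc2 := hp.independent h2 hω (a := 0) (b := 0)
    (c := coordCoeff A F ![0, 1] ![1, 0] / 2) (d := coordCoeff A F ![0, 1] ![0, 1] / 2 - ψ₂ κ)
    (fun y => by
      have e := hT₂ y
      rw [hSκ, map_mul, embedding_conj, conj_conjugate_apply, conj_conjugate_apply] at e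
      linear_combination -e)
  -- Skew-symmetry at (x, 1) says that the trace of x(κ + κ̄) vanishes for every x.
  have hskew : IsCMField.complexConj K κ = -κ := by
    have hk := hp.independent h2 hω (a := ψ₁ (κ + IsCMField.complexConj K κ))
      (b := ψ₂ (κ + IsCMField.complexConj K κ))
      (c := (starRingEnd ℂ) (ψ₁ (κ + IsCMField.complexConj K κ)))
      (d := (starRingEnd ℂ) (ψ₂ (κ + IsCMField.complexConj K κ))) (fun x => by
        have e1 := hform x 1
        have e2 := hform 1 x
        have e3 : coordForm A F (P x) (P 1) = -coordForm A F (P 1) (P x) := A.form_skew _ _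
        rw [e3] at e1
        push_cast at e1
        rw [e2] at e1
        simp only [hSκ, map_one, mul_one, one_mul, map_mul, map_add, embedding_conj,
          Complex.conj_conj] at e1 ⊢
        linear_combination -e1)
    have hz : κ + IsCMField.complexConj K κ = 0 :=
      (map_eq_zero_iff ψ₁ ψ₁.injective).1 hk.1
    linear_combination hz
  refine ⟨κ, hskew, fun u v => ?_⟩
  have e := coordForm_eq (A := A) (F := F) (F u) (F v)
  have e' : coordForm A F (F u) (F v) = A.form u v := by simp [coordForm]
  rw [e', coordCoeff_eq, coordCoeff_eq ![0, 1]] at e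
  have k1 : coordCoeff A F ![1, 0] ![1, 0] = 2 * ψ₁ κ := by linear_combination 2 * hc1.2.2.1
  have k2 : coordCoeff A F ![1, 0] ![0, 1] = 0 := by linear_combination 2 * hc1.2.2.2
  have k3 : coordCoeff A F ![0, 1] ![1, 0] = 0 := by linear_combination 2 * hc2.2.2.1
  have k4 : coordCoeff A F ![0, 1] ![0, 1] = 2 * ψ₂ κ := by linear_combination 2 * hc2.2.2.2
  rw [k1, k2, k3, k4] at e
  rw [e]
  have r1 := embedding_re_eq_zero ψ₁ hskew
  have r2 := embedding_re_eq_zero ψ₂ hskew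
  simp [r1, r2]
  ring

end lattice

end

/-! ### The alternating form over the integers of K₀ and the generator z. -/

section

variable {K : Type*} [Field K] [NumberField K] [IsCMField K]
  {ω : 𝓞 (maximalRealSubfield K)}

/-- The trace form on the real quadratic integers divided by the different. -/
theorem IsPair.sum_div_delta (h2 : Module.finrank ℚ (maximalRealSubfield K) = 2)
    {ψ₁ ψ₂ : K →+* ℂ} (hp : IsPair ω ψ₁ ψ₂) (a b : ℚ) :
    ψ₁ ((a + b * realInt ω) / delta ω) + ψ₂ ((a + b * realInt ω) / delta ω) = b := by
  have hd : ψ₁ (realInt ω) - ψ₂ (realInt ω) ≠ 0 := sub_ne_zero.2 hp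
  rw [map_div₀, map_div₀, hp.map_delta_right h2, hp.map_delta h2]
  simp only [map_add, map_mul, map_ratCast]
  field_simp
  ring

section lattice

variable {A : PPAV 2} {ψ₁ ψ₂ : K →+* ℂ} {𝔞 : Submodule (𝓞 K) K}
  {F : (Fin 2 → ℂ) ≃ₗ[ℂ] (Fin 2 → ℂ)}

/-- The alternating form `(x, y) ↦ δ κ (x ȳ - x̄ y)`. -/
def realForm (ω : 𝓞 (maximalRealSubfield K)) (κ x y : K) : K :=
  delta ω * κ * (x * IsCMField.complexConj K y - IsCMField.complexConj K x * y)

theorem conj_realForm {κ : K} (hκ : IsCMField.complexConj K κ = -κ) (x y : K) :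
    IsCMField.complexConj K (realForm ω κ x y) = realForm ω κ x y := by
  simp only [realForm, map_mul, map_sub, conj_delta, hκ, IsCMField.complexConj_apply_apply]
  ring

/-- The right side is the trace from K₀ to ℚ, and ψ(w - w̄) = 2i Im ψ(w) matches it with the
imaginary parts in the form. The factor `r` lets this trace be tested against multiples of
`realForm`. -/
theorem form_eq_sum (h2 : Module.finrank ℚ (maximalRealSubfield K) = 2)
    (hω : Algebra.adjoin ℤ {ω} = ⊤) {κ : K}
    (hκ : IsCMField.complexConj K κ = -κ)
    (hform : ∀ u v, A.form u v = -2 * (ψ₁ κ).im * (F u 0 * (starRingEnd ℂ) (F v 0)).im -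
        2 * (ψ₂ κ).im * (F u 1 * (starRingEnd ℂ) (F v 1)).im) {r : K}
    (hr : IsCMField.complexConj K r = r) (x y : K) :
    ((A.form (F.symm ![ψ₁ (r * x), ψ₂ (r * x)]) (F.symm ![ψ₁ y, ψ₂ y]) : ℝ) : ℂ) =
      ψ₁ (r * realForm ω κ x y / delta ω) + ψ₂ (r * realForm ω κ x y / delta ω) := by
  have hδ := delta_ne_zero h2 hω
  have hr' : r * realForm ω κ x y / delta ω =
      κ * (r * x * IsCMField.complexConj K y - IsCMField.complexConj K (r * x *
        IsCMField.complexConj K y)) := by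
    rw [map_mul, map_mul, hr, IsCMField.complexConj_apply_apply, realForm]
    field_simp
  have hψ : ∀ ψ : K →+* ℂ, ψ (r * realForm ω κ x y / delta ω) =
      ((-2 * (ψ κ).im * (ψ (r * x) * (starRingEnd ℂ) (ψ y)).im : ℝ) : ℂ) := by
    intro ψ
    have hk : ψ κ = Complex.I * ((ψ κ).im : ℂ) :=
      Complex.ext (by simp [embedding_re_eq_zero ψ hκ]) (by simp)
    rw [hr', map_mul, sub_conj_im, map_mul ψ (r * x), embedding_conj, hk]
    push_cast
    simp only [Complex.mul_im, Complex.I_re, Complex.I_im, Complex.ofReal_re, Complex.ofReal_im,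
      zero_mul, one_mul, zero_add]
    linear_combination 2 * ((ψ κ).im : ℂ) * (((ψ (r * x)).re * ((starRingEnd ℂ) (ψ y)).im +
      (ψ (r * x)).im * ((starRingEnd ℂ) (ψ y)).re : ℝ) : ℂ) * Complex.I_sq
  rw [hψ, hψ, hform]
  simp only [LinearEquiv.apply_symm_apply, Matrix.cons_val_zero, Matrix.cons_val_one]
  push_cast
  ring

/-- The trace of (a + bω)/δ is b. Write `realForm` as a + bω. The integer values of the polarization
at (x, y) and (ωx, y) are b and a + bt, so a and b are integers. -/
theorem Uniformizes.realForm_mem (h2 : Module.finrank ℚ (maximalRealSubfield K) = 2)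
    (hω : Algebra.adjoin ℤ {ω} = ⊤) (hp : IsPair ω ψ₁ ψ₂)
    (h : Uniformizes A ψ₁ ψ₂ (𝔞 : Set K) F) {κ : K}
    (hκ : IsCMField.complexConj K κ = -κ)
    (hform : ∀ u v, A.form u v = -2 * (ψ₁ κ).im * (F u 0 * (starRingEnd ℂ) (F v 0)).im -
        2 * (ψ₂ κ).im * (F u 1 * (starRingEnd ℂ) (F v 1)).im) {x y : K} (hx : x ∈ 𝔞)
    (hy : y ∈ 𝔞) : ∃ a, realInt a = realForm ω κ x y := by
  obtain ⟨t, n, hq, ht⟩ := exists_sq_eq h2 ω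
  obtain ⟨D, hD⟩ := mem_real_of_conj (conj_realForm (ω := ω) hκ x y)
  obtain ⟨a, b, hab⟩ := exists_rat_coord h2 hω D
  rw [hD] at hab
  have hqw : realInt ω ^ 2 = t * realInt ω - n := by rw [← map_pow, hq]; simp
  have key : ∀ s : 𝓞 (maximalRealSubfield K), ∃ k : ℤ,
      ψ₁ (realInt s * realForm ω κ x y / delta ω) +
        ψ₂ (realInt s * realForm ω κ x y / delta ω) = k := by
    intro s
    have hsx : realInt s * x ∈ 𝔞 := by
      have : realInt s * x = (algebraMap (𝓞 (maximalRealSubfield K)) (𝓞 K) s) • x := rfl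
      rw [this]
      exact 𝔞.smul_mem _ hx
    obtain ⟨k, hk⟩ := A.integral _ ((h.mem_iff _).2 hsx) _ ((h.mem_iff _).2 hy)
    refine ⟨k, ?_⟩
    rw [← form_eq_sum h2 hω hκ hform (conj_realInt s), hk]; simp
  obtain ⟨k, hk⟩ := key 1
  obtain ⟨l, hl⟩ := key ω
  rw [map_one, one_mul, hab, hp.sum_div_delta h2] at hk
  have hwD : realInt ω * realForm ω κ x y =
      ((-(b * n) : ℚ) : K) + ((a + b * t : ℚ) : K) * realInt ω := by
    rw [hab]; push_cast; linear_combination (b : K) * hqw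
  rw [hwD, hp.sum_div_delta h2] at hl
  have hb : b = k := by exact_mod_cast hk
  have ha : a = l - k * t := by
    have : a + b * t = l := by exact_mod_cast hl
    rw [hb] at this
    linear_combination this
  refine ⟨(l - k * t : ℤ) + (k : ℤ) * ω, ?_⟩
  rw [hab, ha, hb]
  simp

/-- Unimodularity over ℤ is carried over to K₀: values in a common maximal ideal P would allow 𝔞 to
be enlarged inside its dual by P⁻¹. The Dedekind lemma then gives the value 1. -/
theorem Uniformizes.exists_realForm_eq_one (hK : IsPrimitiveQuarticCMField K)
    (hω : Algebra.adjoin ℤ {ω} = ⊤) (hp : IsPair ω ψ₁ ψ₂)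
    (h : Uniformizes A ψ₁ ψ₂ (𝔞 : Set K) F) {κ : K}
    (hκ : IsCMField.complexConj K κ = -κ)
    (hform : ∀ u v, A.form u v = -2 * (ψ₁ κ).im * (F u 0 * (starRingEnd ℂ) (F v 0)).im -
        2 * (ψ₂ κ).im * (F u 1 * (starRingEnd ℂ) (F v 1)).im) :
    ∃ x ∈ 𝔞, ∃ y ∈ 𝔞, realForm ω κ x y = 1 := by
  have h2 := hK.finrank_real
  let M : Submodule (𝓞 (maximalRealSubfield K)) K := 𝔞.restrictScalars _
  have hsmul : ∀ (a : 𝓞 (maximalRealSubfield K)) (x : K), a • x = realInt a * x := fun _ _ => rfl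
  choose d hd using fun x y : M => h.realForm_mem h2 hω hp hκ hform x.2 y.2
  let S : M →ₗ[𝓞 (maximalRealSubfield K)] M →ₗ[𝓞 (maximalRealSubfield K)]
      𝓞 (maximalRealSubfield K) := LinearMap.mk₂ _ d
    (fun x x' y => realInt_injective (by
      rw [map_add, hd, hd, hd, realForm, realForm, realForm, Submodule.coe_add, map_add]; ring))
    (fun a x y => realInt_injective (by
      rw [smul_eq_mul, map_mul, hd, hd, realForm, realForm, Submodule.coe_smul, hsmul, map_mul,
        conj_realInt]; ring))
    (fun x y y' => realInt_injective (by
      rw [map_add, hd, hd, hd, realForm, realForm, realForm, Submodule.coe_add, map_add]; ring))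
    (fun a x y => realInt_injective (by
      rw [smul_eq_mul, map_mul, hd, hd, realForm, realForm, Submodule.coe_smul, hsmul, map_mul,
        conj_realInt]; ring))
  have hS : ∀ x y, realInt (S x y) = realForm ω κ x y := hd
  obtain ⟨x, y, hxy⟩ := exists_eq_one_of_alternating S
    (fun x => realInt_injective (by rw [hS, realForm, map_zero]; ring)) (by
    intro P hP
    by_contra! hc
    have hP0 : P ≠ ⊥ := Ring.ne_bot_of_isMaximal_of_not_isField hP (RingOfIntegers.not_isField _)
    -- This r lies in P⁻¹ but is not integral. As all values lie in P, the multiples r x pair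
    -- integrally with 𝔞, so self-duality of the lattice gives r𝔞 ⊆ 𝔞. Since 𝔞 is finitely generated
    -- over ℤ, r is integral after all.
    obtain ⟨r, hr, hr1⟩ := FractionalIdeal.exists_notMem_one_of_ne_bot
      (K := maximalRealSubfield K) hP0 hP.ne_top
    apply hr1
    have hP0' : (P : FractionalIdeal (𝓞 (maximalRealSubfield K))⁰ (maximalRealSubfield K)) ≠ 0 :=
      FractionalIdeal.coeIdeal_ne_zero.2 hP0
    rw [FractionalIdeal.mem_inv_iff hP0'] at hr
    have hrP : ∀ p ∈ P, ∃ q : 𝓞 (maximalRealSubfield K), (r : K) * realInt p = realInt q := by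
      intro p hp
      obtain ⟨q, hq⟩ := (FractionalIdeal.mem_one_iff _).1
        (hr _ ((FractionalIdeal.mem_coeIdeal _).2 ⟨p, hp, rfl⟩))
      exact ⟨q, congrArg (Subtype.val) hq.symm⟩
    have hr𝔞 : ∀ x ∈ 𝔞, (r : K) * x ∈ 𝔞 := by
      intro x hx
      rw [← h.mem_iff]
      apply A.mem_lattice_of_form
      intro u hu
      obtain ⟨y, hy, hFy⟩ := (h u).1 hu
      have hu' : u = F.symm ![ψ₁ y, ψ₂ y] := by rw [← hFy]; simp
      obtain ⟨q, hq⟩ := hrP _ (hc ⟨x, hx⟩ ⟨y, hy⟩)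
      rw [hS] at hq
      obtain ⟨m, n, rfl⟩ := exists_int_coord h2 hω q
      refine ⟨n, Complex.ofReal_injective ?_⟩
      have e := hp.sum_div_delta h2 m n
      rw [hu', form_eq_sum h2 hω hκ hform (conj_real r), hq]
      simpa using e
    have hint : IsIntegral ℤ (r : K) := by
      refine isIntegral_of_smul_mem_submodule (M := K) (𝔞.restrictScalars ℤ) ?_ ?_ (r : K) hr𝔞
      · obtain ⟨x, hx, hx0⟩ := h.exists_ne_zero
        exact fun e => hx0 ((Submodule.eq_bot_iff _).1 e x hx)
      · obtain ⟨b, -⟩ := A.principal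
        have : Module.Finite ℤ A.lattice := Module.Finite.of_basis b
        let f : 𝔞.restrictScalars ℤ →ₗ[ℤ] A.lattice :=
          { toFun := fun x => ⟨F.symm ![ψ₁ x, ψ₂ x], (h.mem_iff _).2 x.2⟩
            map_add' := fun x y => by
              apply Subtype.ext
              change F.symm _ = F.symm _ + F.symm _
              rw [← map_add]; congr 1; ext i; fin_cases i <;> simp
            map_smul' := fun n x => by
              apply Subtype.ext
              change F.symm _ = n • F.symm _
              rw [← map_zsmul]; congr 1; ext i; fin_cases i <;> simp }
        have hf : Function.Injective f := by
          intro x y hxy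
          have e := congrFun (F.symm.injective (congrArg Subtype.val hxy)) 0
          exact Subtype.ext (ψ₁.injective e)
        have : Module.Finite ℤ (𝔞.restrictScalars ℤ) := Module.Finite.of_injective f hf
        exact Module.Finite.iff_fg.1 this
    have hint' : IsIntegral ℤ r := by
      rwa [← isIntegral_algHom_iff (maximalRealSubfield K).subtype.toIntAlgHom
        Subtype.val_injective]
    exact (FractionalIdeal.mem_one_iff _).2 ⟨⟨r, hint'⟩, rfl⟩)
  refine ⟨x, x.2, y, y.2, ?_⟩
  rw [← hS, hxy, map_one]

/-- Every surface with complex multiplication is given by an ideal `z 𝓞 + 𝓞`. -/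
theorem Uniformizes.exists_isUniformizedBy (hK : IsPrimitiveQuarticCMField K)
    (hω : Algebra.adjoin ℤ {ω} = ⊤) (hp : IsPair ω ψ₁ ψ₂)
    (h : Uniformizes A ψ₁ ψ₂ (𝔞 : Set K) F) :
    ∃ z : K, IsUniformizedBy A ω ψ₁ ψ₂ z ∧ ∃ C : ClassGroup (𝓞 K), IsIdealClassOf z C := by
  have h2 := hK.finrank_real
  obtain ⟨κ, hκ, hform⟩ := h.exists_form_eq hK hω hp
  obtain ⟨x, hx, y, hy, hxy⟩ := h.exists_realForm_eq_one hK hω hp hκ hform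
  have hy0 : y ≠ 0 := by
    rintro rfl
    simp [realForm] at hxy
  have hsmul : ∀ (a : 𝓞 (maximalRealSubfield K)), ∀ m ∈ 𝔞, realInt a * m ∈ 𝔞 := fun a m hm =>
    𝔞.smul_mem (algebraMap (𝓞 (maximalRealSubfield K)) (𝓞 K) a) hm
  have hmem : ∀ m, y⁻¹ * m ∈ idealSet (x / y) ↔ m ∈ 𝔞 := by
    intro m
    constructor
    · rintro ⟨a, b, hab⟩
      have : m = realInt a * x + realInt b * y := by
        field_simp at hab
        linear_combination hab
      rw [this]
      exact 𝔞.add_mem (hsmul a x hx) (hsmul b y hy)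
    · intro hm
      obtain ⟨a, ha⟩ := h.realForm_mem h2 hω hp hκ hform hm hy
      obtain ⟨b, hb⟩ := h.realForm_mem h2 hω hp hκ hform hx hm
      refine ⟨a, b, ?_⟩
      rw [ha, hb]
      -- Cramer's rule for D(x, y) = 1: the coefficients of m with respect to x and y are D(m, y)
      -- and D(x, m), which are integral.
      have : m = realForm ω κ m y * x + realForm ω κ x m * y := by
        calc m = realForm ω κ x y * m := by rw [hxy, one_mul]
          _ = _ := by simp only [realForm]; ring
      field_simp
      linear_combination this
  refine ⟨x / y, ⟨_, h.rescale (inv_ne_zero hy0) hmem, fun u v => ?_⟩, ?_⟩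
  -- The equation D(x, y) = 1, divided through by yȳ, reads δκ yȳ (z - z̄) = 1 with z = x/y. It
  -- eliminates κ from the form in favour of δ and Im z.
  · have hφ : ∀ ψ : K →+* ℂ, -2 * (ψ κ).im * Complex.normSq (ψ y) * (ψ (delta ω)).re *
        (ψ (x / y)).im = 1 := by
      intro ψ
      have e : delta ω * κ * (y * IsCMField.complexConj K y) *
          (x / y - IsCMField.complexConj K (x / y)) = 1 := by
        have hcy : IsCMField.complexConj K y ≠ 0 := by simpa using hy0
        rw [← hxy, realForm, map_div₀]
        field_simp
      have e' := congrArg ψ e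
      have hk : ψ κ = Complex.I * ((ψ κ).im : ℂ) :=
        Complex.ext (by simp [embedding_re_eq_zero ψ hκ]) (by simp)
      have hd := embedding_real_eq ψ (conj_delta ω)
      rw [map_mul, sub_conj_im, map_mul, map_mul, map_mul, embedding_conj, Complex.mul_conj, hk,
        hd, map_one] at e'
      apply Complex.ofReal_injective
      push_cast
      linear_combination e' - 2 * ((ψ κ).im : ℂ) * (Complex.normSq (ψ y) : ℂ) *
        ((ψ (delta ω)).re : ℂ) * ((ψ (x / y)).im : ℂ) * Complex.I_sq
    have hmul : ∀ a p q : ℂ, ((a * p) * (starRingEnd ℂ) (a * q)).im =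
        Complex.normSq a * (p * (starRingEnd ℂ) q).im := by
      intro a p q
      rw [map_mul, mul_mul_mul_comm, Complex.mul_conj, Complex.im_ofReal_mul]
    have hterm : ∀ (ψ : K →+* ℂ) (p q : ℂ), -2 * (ψ κ).im * (p * (starRingEnd ℂ) q).im =
        ((ψ y⁻¹ * p) * (starRingEnd ℂ) (ψ y⁻¹ * q)).im / ((ψ (delta ω)).re * (ψ (x / y)).im) := by
      intro ψ p q
      have e := hφ ψ
      have hn : Complex.normSq (ψ y) ≠ 0 := by simpa using hy0
      have hne : (ψ (delta ω)).re * (ψ (x / y)).im ≠ 0 := by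
        intro h0
        rw [mul_assoc, h0, mul_zero] at e
        exact zero_ne_one e
      rw [hmul, map_inv₀, Complex.normSq_inv, eq_div_iff hne, eq_inv_mul_iff_mul_eq₀ hn]
      linear_combination (p * (starRingEnd ℂ) q).im * e
    rw [hform, standardForm]
    simp only [LinearEquiv.trans_apply, diagEquiv_apply, Matrix.cons_val_zero, Matrix.cons_val_one]
    rw [← hterm, ← hterm]
    ring
  · have hone : (1 : K) ∈ idealSet (x / y) := ⟨0, 1, by simp⟩
    have hz : x / y ∈ idealSet (x / y) := ⟨1, 0, by simp⟩
    have hmul : ∀ (a : 𝓞 K), ∀ m ∈ idealSet (x / y), a • m ∈ idealSet (x / y) := by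
      intro a m hm
      have h1 : y * m ∈ 𝔞 := (hmem _).1 (by rwa [inv_mul_cancel_left₀ hy0])
      have h3 := (hmem _).2 (𝔞.smul_mem a h1)
      have : y⁻¹ * (a • (y * m)) = a • m := by
        change y⁻¹ * ((a : K) * (y * m)) = (a : K) * m
        field_simp
      rwa [this] at h3
    let N : Submodule (𝓞 K) K :=
      { carrier := idealSet (x / y)
        add_mem' := by
          rintro _ _ ⟨a, b, rfl⟩ ⟨a', b', rfl⟩
          exact ⟨a + a', b + b', by simp; ring⟩
        zero_mem' := ⟨0, 0, by simp⟩
        smul_mem' := hmul }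
    have hN : N = Submodule.span (𝓞 K) {x / y, 1} := by
      apply le_antisymm
      · rintro _ ⟨a, b, rfl⟩
        have e1 : x / y * realInt a = (algebraMap (𝓞 (maximalRealSubfield K)) (𝓞 K) a) • (x / y) :=
          mul_comm _ _
        have e2 : realInt b = (algebraMap (𝓞 (maximalRealSubfield K)) (𝓞 K) b) • (1 : K) :=
          (mul_one _).symm
        rw [e1, e2]
        exact Submodule.add_mem _ (Submodule.smul_mem _ _ (Submodule.subset_span (by simp)))
          (Submodule.smul_mem _ _ (Submodule.subset_span (by simp)))
      · rw [Submodule.span_le]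
        rintro m (rfl | rfl)
        · exact hz
        · exact hone
    have hfg : N.FG := by
      rw [hN]
      exact Submodule.fg_span (by simp)
    let I : FractionalIdeal (𝓞 K)⁰ K := ⟨N, FractionalIdeal.isFractional_of_fg hfg⟩
    have hI0 : I ≠ 0 := by
      intro e
      have : (1 : K) ∈ I := hone
      rw [e, FractionalIdeal.mem_zero_iff] at this
      exact one_ne_zero this
    exact ⟨_, Units.mk0 I hI0, rfl, rfl⟩

end lattice

end

/-! ### Ideal classes, units and isomorphisms. -/

section

variable {K : Type*} [Field K] [NumberField K]

theorem mem_signedMultiples {ε : (𝓞 (maximalRealSubfield K))ˣ} {R : Set K} {x : K} :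
    x ∈ signedMultiples ε R ↔ ∃ z ∈ R, ∃ u : (𝓞 (maximalRealSubfield K))ˣ,
      (u = 1 ∨ u = -1 ∨ u = ε ∨ u = -ε) ∧ x = realInt (u : 𝓞 (maximalRealSubfield K)) * z := by
  constructor
  · rintro ⟨z, hz, h | h | h | h⟩
    · exact ⟨z, hz, 1, by simp, by simp [h]⟩
    · exact ⟨z, hz, -1, by simp, by simp [h]⟩
    · exact ⟨z, hz, ε, by simp, h⟩
    · exact ⟨z, hz, -ε, by simp, by rw [h, Units.val_neg, map_neg, realInt_apply, neg_mul]⟩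
  · rintro ⟨z, hz, u, rfl | rfl | rfl | rfl, rfl⟩
    · exact ⟨z, hz, by simp⟩
    · exact ⟨z, hz, by simp⟩
    · exact ⟨z, hz, Or.inr (Or.inr (Or.inl rfl))⟩
    · exact ⟨z, hz, Or.inr (Or.inr (Or.inr (by
        rw [Units.val_neg, map_neg, realInt_apply, neg_mul])))⟩

theorem realInt_unit_mul_inv (u : (𝓞 (maximalRealSubfield K))ˣ) :
    realInt (u : 𝓞 (maximalRealSubfield K)) *
      realInt ((u⁻¹ : (𝓞 (maximalRealSubfield K))ˣ) : 𝓞 (maximalRealSubfield K)) = 1 := by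
  rw [← map_mul, Units.mul_inv, map_one]

theorem realInt_unit_ne_zero (u : (𝓞 (maximalRealSubfield K))ˣ) :
    realInt (u : 𝓞 (maximalRealSubfield K)) ≠ 0 :=
  left_ne_zero_of_mul_eq_one (realInt_unit_mul_inv u)

theorem mem_idealSet_smul (z : K) (r : 𝓞 (maximalRealSubfield K)) {x : K} (hx : x ∈ idealSet z) :
    realInt r * x ∈ idealSet z := by
  obtain ⟨a, b, rfl⟩ := hx
  exact ⟨r * a, r * b, by simp; ring⟩

theorem mem_idealSet_unit_smul (z : K) (u : (𝓞 (maximalRealSubfield K))ˣ) {x : K} :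
    realInt (u : 𝓞 (maximalRealSubfield K)) * x ∈ idealSet z ↔ x ∈ idealSet z := by
  refine ⟨fun h => ?_, mem_idealSet_smul z _⟩
  have := mem_idealSet_smul z
    ((u⁻¹ : (𝓞 (maximalRealSubfield K))ˣ) : 𝓞 (maximalRealSubfield K)) h
  rwa [← mul_assoc, mul_comm (realInt _) (realInt _), realInt_unit_mul_inv, one_mul] at this

theorem idealSet_unit_mul (u : (𝓞 (maximalRealSubfield K))ˣ) (z : K) :
    idealSet (realInt (u : 𝓞 (maximalRealSubfield K)) * z) = idealSet z := by
  ext x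
  constructor
  · rintro ⟨a, b, rfl⟩
    exact ⟨u * a, b, by rw [map_mul]; ring⟩
  · rintro ⟨a, b, rfl⟩
    refine ⟨((u⁻¹ : (𝓞 (maximalRealSubfield K))ˣ) : 𝓞 (maximalRealSubfield K)) * a, b, ?_⟩
    rw [map_mul]
    linear_combination -z * realInt a * realInt_unit_mul_inv u

theorem IsIdealClassOf.of_idealSet_eq {z z' : K} {C : ClassGroup (𝓞 K)} (h : IsIdealClassOf z C)
    (hz : idealSet z' = idealSet z) : IsIdealClassOf z' C := by
  obtain ⟨I, hI, hC⟩ := h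
  exact ⟨I, hI.trans hz.symm, hC⟩

theorem IsIdealClassOf.exists_submodule {z : K} {C : ClassGroup (𝓞 K)} (h : IsIdealClassOf z C) :
    ∃ 𝔞 : Submodule (𝓞 K) K, (𝔞 : Set K) = idealSet z := by
  obtain ⟨I, hI, -⟩ := h
  exact ⟨((I : FractionalIdeal (𝓞 K)⁰ K) : Submodule (𝓞 K) K), hI⟩

theorem mem_spanSingleton_mul_iff {κ : K} (hκ : κ ≠ 0) (J : FractionalIdeal (𝓞 K)⁰ K) (x : K) :
    κ * x ∈ FractionalIdeal.spanSingleton (𝓞 K)⁰ κ * J ↔ x ∈ J := by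
  rw [FractionalIdeal.mem_singleton_mul]
  constructor
  · rintro ⟨y, hy, hxy⟩
    rwa [mul_left_cancel₀ hκ hxy]
  · exact fun h => ⟨x, h, rfl⟩

theorem eq_spanSingleton_mul {κ : K} (hκ : κ ≠ 0) {I J : FractionalIdeal (𝓞 K)⁰ K}
    (h : ∀ x, κ * x ∈ J ↔ x ∈ I) : J = FractionalIdeal.spanSingleton (𝓞 K)⁰ κ * I := by
  ext x
  have hx : x = κ * (κ⁻¹ * x) := by field_simp
  rw [hx, h, mem_spanSingleton_mul_iff hκ]

theorem IsIdealClassOf.exists_mul {z z' : K} {C : ClassGroup (𝓞 K)} (h : IsIdealClassOf z C)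
    (h' : IsIdealClassOf z' C) :
    ∃ μ : K, μ ≠ 0 ∧ ∀ x, μ * x ∈ idealSet z' ↔ x ∈ idealSet z := by
  obtain ⟨I, hI, hIC⟩ := h
  obtain ⟨J, hJ, hJC⟩ := h'
  have h1 : ClassGroup.mk K (J / I) = 1 := by rw [map_div, hIC, hJC, div_self']
  rw [ClassGroup.mk_eq_one_iff, FractionalIdeal.isPrincipal_iff] at h1
  obtain ⟨μ, hμ⟩ := h1
  have hμ0 : μ ≠ 0 := by
    rintro rfl
    rw [FractionalIdeal.spanSingleton_zero] at hμ
    exact (J / I).ne_zero hμ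
  have hJI : (J : FractionalIdeal (𝓞 K)⁰ K) = FractionalIdeal.spanSingleton (𝓞 K)⁰ μ * I := by
    rw [← hμ, ← Units.val_mul, div_mul_cancel]
  refine ⟨μ, hμ0, fun x => ?_⟩
  have e1 : ∀ y, y ∈ idealSet z ↔ y ∈ (I : FractionalIdeal (𝓞 K)⁰ K) := fun y =>
    (Set.ext_iff.1 hI y).symm
  have e2 : ∀ y, y ∈ idealSet z' ↔ y ∈ (J : FractionalIdeal (𝓞 K)⁰ K) := fun y =>
    (Set.ext_iff.1 hJ y).symm
  rw [e1, e2, hJI, mem_spanSingleton_mul_iff hμ0]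

theorem IsIdealClassOf.of_mul {z z' κ : K} {C C' : ClassGroup (𝓞 K)} (h : IsIdealClassOf z C)
    (h' : IsIdealClassOf z' C') (hκ : κ ≠ 0) (hab : ∀ x, κ * x ∈ idealSet z' ↔ x ∈ idealSet z) :
    C' = C := by
  obtain ⟨I, hI, rfl⟩ := h
  obtain ⟨J, hJ, rfl⟩ := h'
  have e1 : ∀ y, y ∈ idealSet z ↔ y ∈ (I : FractionalIdeal (𝓞 K)⁰ K) := fun y =>
    (Set.ext_iff.1 hI y).symm
  have e2 : ∀ y, y ∈ idealSet z' ↔ y ∈ (J : FractionalIdeal (𝓞 K)⁰ K) := fun y =>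
    (Set.ext_iff.1 hJ y).symm
  simp only [e1, e2] at hab
  have hJI := eq_spanSingleton_mul hκ hab
  rw [← div_eq_one, ← map_div, ClassGroup.mk_eq_one_iff, FractionalIdeal.isPrincipal_iff]
  refine ⟨κ, ?_⟩
  rw [div_eq_mul_inv, Units.val_mul, hJI, mul_assoc, Units.mul_inv, mul_one]

/-- The ideal is invertible and cancels, so the principal ideal generated by κ is the unit ideal. -/
theorem IsIdealClassOf.exists_unit {z κ : K} {C : ClassGroup (𝓞 K)} (h : IsIdealClassOf z C)
    (hκ : κ ≠ 0) (hab : ∀ x, κ * x ∈ idealSet z ↔ x ∈ idealSet z) :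
    ∃ k : (𝓞 K)ˣ, ((k : 𝓞 K) : K) = κ := by
  obtain ⟨I, hI, rfl⟩ := h
  have e1 : ∀ y, y ∈ idealSet z ↔ y ∈ (I : FractionalIdeal (𝓞 K)⁰ K) := fun y =>
    (Set.ext_iff.1 hI y).symm
  simp only [e1] at hab
  have hJI := eq_spanSingleton_mul hκ hab
  have h1 : FractionalIdeal.spanSingleton (𝓞 K)⁰ κ = 1 := by
    calc FractionalIdeal.spanSingleton (𝓞 K)⁰ κ
        = FractionalIdeal.spanSingleton (𝓞 K)⁰ κ * I *
          ((I⁻¹ : (FractionalIdeal (𝓞 K)⁰ K)ˣ) : FractionalIdeal (𝓞 K)⁰ K) := by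
          rw [mul_assoc, Units.mul_inv, mul_one]
      _ = 1 := by rw [← hJI, Units.mul_inv]
  obtain ⟨a, ha⟩ := (FractionalIdeal.mem_one_iff _).1
    (h1 ▸ FractionalIdeal.mem_spanSingleton_self (𝓞 K)⁰ κ)
  obtain ⟨b, hb⟩ := (FractionalIdeal.mem_spanSingleton _).1
    (h1 ▸ FractionalIdeal.one_mem_one (𝓞 K)⁰ : (1 : K) ∈ FractionalIdeal.spanSingleton (𝓞 K)⁰ κ)
  have hab1 : a * b = 1 := by
    apply RingOfIntegers.ext
    change (a : K) * (b : K) = 1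
    rw [mul_comm, ← hb, ← ha]
    rfl
  exact ⟨⟨a, b, hab1, by rw [mul_comm, hab1]⟩, ha⟩

variable [IsCMField K] {ω : 𝓞 (maximalRealSubfield K)}

theorem IsUniformizedBy.pos {A : PPAV 2} {ψ₁ ψ₂ : K →+* ℂ} {z : K}
    (h : IsUniformizedBy A ω ψ₁ ψ₂ z) :
    0 < (ψ₁ (delta ω)).re * (ψ₁ z).im ∧ 0 < (ψ₂ (delta ω)).re * (ψ₂ z).im := by
  obtain ⟨F, -, hE⟩ := h
  constructor
  · have h1 := A.positive (F.symm ![1, 0]) (by simp)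
    rw [hE, map_smul] at h1
    simp only [standardForm] at h1
    simp at h1
    rwa [← mul_inv, inv_pos, mul_comm] at h1
  · have h1 := A.positive (F.symm ![0, 1]) (by simp)
    rw [hE, map_smul] at h1
    simp only [standardForm] at h1
    simp at h1
    rwa [← mul_inv, inv_pos, mul_comm] at h1

/-- Positivity on each coordinate axis makes ψⱼ(δ) Im ψⱼ(z) positive, and δ is positive under `ψ₁`
and negative under `ψ₂`. This is the source of the sign conditions on z. -/
theorem IsUniformizedBy.im_pos (h2 : Module.finrank ℚ (maximalRealSubfield K) = 2)
    {A : PPAV 2} {ψ₁ ψ₂ : K →+* ℂ} {z : K} (h : IsUniformizedBy A ω ψ₁ ψ₂ z)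
    (hlt : (ψ₂ (realInt ω)).re < (ψ₁ (realInt ω)).re) : 0 < (ψ₁ z).im ∧ (ψ₂ z).im < 0 := by
  have hp := isPair_of_re_lt hlt
  obtain ⟨h₁, h₂⟩ := h.pos
  rw [hp.map_delta h2, Complex.sub_re] at h₁
  rw [hp.symm.map_delta h2, Complex.sub_re] at h₂
  exact ⟨(mul_pos_iff_of_pos_left (by linarith)).1 h₁, by nlinarith⟩

theorem IsUniformizedBy.ne_conj {A : PPAV 2} {ψ₁ ψ₂ : K →+* ℂ} {z : K}
    (h : IsUniformizedBy A ω ψ₁ ψ₂ z) : z - IsCMField.complexConj K z ≠ 0 := by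
  intro h0
  have h1 := h.pos.1
  rw [embedding_im_eq_zero ψ₁ (sub_eq_zero.1 h0).symm, mul_zero] at h1
  exact lt_irrefl _ h1

/-- The vector (μz, μ) is an integral matrix applied to (z', 1), and so is its conjugate. Taking 2 ×
2 determinants gives the relation, with a equal to the determinant of that matrix. -/
theorem exists_realInt_mul_sub_conj {z z' μ : K} (h₁ : μ * z ∈ idealSet z')
    (h₂ : μ ∈ idealSet z') : ∃ a : 𝓞 (maximalRealSubfield K),
    μ * IsCMField.complexConj K μ * (z - IsCMField.complexConj K z) =
      realInt a * (z' - IsCMField.complexConj K z') := by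
  obtain ⟨a, b, hab⟩ := h₁
  obtain ⟨a', b', hab'⟩ := h₂
  have hc := congrArg (IsCMField.complexConj K) hab
  have hc' := congrArg (IsCMField.complexConj K) hab'
  simp only [map_mul, map_add, conj_realInt] at hc hc'
  refine ⟨a * b' - a' * b, ?_⟩
  rw [map_sub, map_mul, map_mul]
  calc _ = (μ * z) * IsCMField.complexConj K μ -
        (IsCMField.complexConj K μ * IsCMField.complexConj K z) * μ := by ring
    _ = _ := by rw [hab, hc, hc', hab']; ring

/-- The determinant of a change of basis. -/
theorem exists_unit_mul_sub_conj {z z' μ : K} (hz : z - IsCMField.complexConj K z ≠ 0)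
    (hμ : μ ≠ 0) (hab : ∀ x, μ * x ∈ idealSet z' ↔ x ∈ idealSet z) :
    ∃ u : (𝓞 (maximalRealSubfield K))ˣ,
    μ * IsCMField.complexConj K μ * (z - IsCMField.complexConj K z) =
      realInt (u : 𝓞 (maximalRealSubfield K)) * (z' - IsCMField.complexConj K z') := by
  have hone : ∀ y : K, (1 : K) ∈ idealSet y := fun y => ⟨0, 1, by simp⟩
  have hself : ∀ y : K, y ∈ idealSet y := fun y => ⟨1, 0, by simp⟩
  obtain ⟨a, ha⟩ := exists_realInt_mul_sub_conj ((hab z).2 (hself z))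
    (by simpa using (hab 1).2 (hone z))
  obtain ⟨b, hb⟩ := exists_realInt_mul_sub_conj (z := z') (z' := z) (μ := μ⁻¹)
    ((hab _).1 (by rw [mul_inv_cancel_left₀ hμ]; exact hself z'))
    ((hab _).1 (by rw [mul_inv_cancel₀ hμ]; exact hone z'))
  have hcμ : IsCMField.complexConj K μ ≠ 0 := by simpa using hμ
  have hab1 : a * b = 1 := by
    apply realInt_injective
    rw [map_mul, map_one]
    apply mul_right_cancel₀ hz
    rw [map_inv₀] at hb
    rw [mul_assoc, ← hb, one_mul]
    calc _ = μ⁻¹ * (IsCMField.complexConj K μ)⁻¹ *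
          (realInt a * (z' - IsCMField.complexConj K z')) := by ring
      _ = _ := by rw [← ha]; field_simp
  exact ⟨⟨a, b, hab1, by rw [mul_comm, hab1]⟩, ha⟩

/-- The representative z of the class of z₀ differs from it by some μ and a unit u = v²u₀. Replacing
μ by μ/v absorbs the square, and u₀z has the same ideal as z. -/
theorem IsUniformizedBy.exists_signedMultiple {A : PPAV 2} {ψ₁ ψ₂ : K →+* ℂ} {z₀ : K}
    {ε : (𝓞 (maximalRealSubfield K))ˣ}
    (hε : Odd (Subgroup.closure ({-1, ε} : Set (𝓞 (maximalRealSubfield K))ˣ)).index)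
    {R : Set K} (hR : RepresentsIdealClasses R) (h : IsUniformizedBy A ω ψ₁ ψ₂ z₀)
    {C : ClassGroup (𝓞 K)} (hC : IsIdealClassOf z₀ C) :
    ∃ z ∈ signedMultiples ε R, IsUniformizedBy A ω ψ₁ ψ₂ z := by
  obtain ⟨z, ⟨hzR, hzC⟩, -⟩ := hR.2 C ⟨z₀, hC⟩
  obtain ⟨μ, hμ, hab⟩ := hC.exists_mul hzC
  obtain ⟨u, hu⟩ := exists_unit_mul_sub_conj h.ne_conj hμ hab
  obtain ⟨v, u₀, huv, hu₀⟩ := exists_unit_eq_sq_mul hε u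
  have hv := realInt_unit_ne_zero v
  refine ⟨_, mem_signedMultiples.2 ⟨z, hzR, u₀, hu₀, rfl⟩,
    h.rescale (μ := μ / realInt (v : 𝓞 (maximalRealSubfield K))) (div_ne_zero hμ hv)
      (fun x => ?_) ?_⟩
  · rw [idealSet_unit_mul, ← mem_idealSet_unit_smul z v, ← hab]
    field_simp
  · rw [map_div₀, conj_realInt, map_mul, conj_realInt]
    have huv' : realInt (u : 𝓞 (maximalRealSubfield K)) =
        realInt (v : 𝓞 (maximalRealSubfield K)) ^ 2 *
          realInt (u₀ : 𝓞 (maximalRealSubfield K)) := by rw [huv]; simp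
    rw [huv'] at hu
    field_simp
    linear_combination -hu

/-- Replacing the CM type by its composite with s amounts to replacing 𝔞 by s⁻¹𝔞, again an
O_K-module because s preserves integrality. -/
theorem Uniformizes.comp_aut {A : PPAV 2} {ψ₁ ψ₂ χ₁ χ₂ : K →+* ℂ} {𝔞 : Submodule (𝓞 K) K}
    {F : (Fin 2 → ℂ) ≃ₗ[ℂ] (Fin 2 → ℂ)} (h : Uniformizes A ψ₁ ψ₂ (𝔞 : Set K) F)
    (s : K ≃ₐ[ℚ] K) (hs₁ : ∀ x, ψ₁ (s x) = χ₁ x) (hs₂ : ∀ x, ψ₂ (s x) = χ₂ x) :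
    ∃ 𝔟 : Submodule (𝓞 K) K, Uniformizes A χ₁ χ₂ (𝔟 : Set K) F := by
  refine ⟨{ carrier := {x | s x ∈ 𝔞}
            add_mem' := fun {x y} hx hy => by
              change s (x + y) ∈ 𝔞
              rw [map_add]; exact 𝔞.add_mem hx hy
            zero_mem' := by
              change s 0 ∈ 𝔞
              rw [map_zero]; exact 𝔞.zero_mem
            smul_mem' := fun a x hx => by
              change s ((a : K) * x) ∈ 𝔞
              rw [map_mul]
              have hi : IsIntegral ℤ (s (a : K)) :=
                a.isIntegral_coe.map (s : K →+* K).toIntAlgHom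
              exact 𝔞.smul_mem (⟨_, hi⟩ : 𝓞 K) hx }, fun v => ?_⟩
  rw [h v]
  constructor
  · rintro ⟨y, hy, hF⟩
    refine ⟨s.symm y, by change s (s.symm y) ∈ 𝔞; simpa using hy, ?_⟩
    rw [hF, ← hs₁, ← hs₂, AlgEquiv.apply_symm_apply]
  · rintro ⟨x, hx, hF⟩
    exact ⟨s x, hx, by rw [hF, hs₁, hs₂]⟩

theorem Uniformizes.swap {A : PPAV 2} {ψ₁ ψ₂ : K →+* ℂ} {𝔞 : Set K}
    {F : (Fin 2 → ℂ) ≃ₗ[ℂ] (Fin 2 → ℂ)} (h : Uniformizes A ψ₁ ψ₂ 𝔞 F) :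
    ∃ G, Uniformizes A ψ₂ ψ₁ 𝔞 G := by
  refine ⟨F.trans (LinearEquiv.funCongrLeft ℂ ℂ (Equiv.swap 0 1)), fun v => ?_⟩
  rw [h v]
  refine exists_congr fun x => and_congr_right fun _ => ?_
  constructor
  · intro e
    ext i
    fin_cases i <;> simp [e, LinearEquiv.funCongrLeft, LinearMap.funLeft]
  · intro e
    have e0 := congrFun e 0
    have e1 := congrFun e 1
    simp [LinearEquiv.funCongrLeft, LinearMap.funLeft] at e0 e1
    ext i
    fin_cases i <;> simp [e0, e1]

theorem IsUniformizedBy.of_isomorphic {A B : PPAV 2} {ψ₁ ψ₂ : K →+* ℂ} {z : K}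
    (h : IsUniformizedBy B ω ψ₁ ψ₂ z) (hAB : A.Isomorphic B) : IsUniformizedBy A ω ψ₁ ψ₂ z := by
  obtain ⟨f, hf, hfE⟩ := hAB
  obtain ⟨F, hF, hE⟩ := h
  refine ⟨f.trans F, fun v => ?_, fun u v => ?_⟩
  · rw [LinearEquiv.trans_apply, ← hF, ← SetLike.mem_coe (p := B.lattice), ← hf,
      f.injective.mem_set_image]
    rfl
  · rw [← hfE, hE]; rfl

/-- Two uniformizations of one surface differ by a complex linear map between the two lattices,
which induces an additive map on K after clearing denominators. By `semilinear` it is x ↦ κ s(x). If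
s is trivial and the embeddings agree, κ carries one ideal to the other, and comparing forms relates
z to z'. -/
theorem IsUniformizedBy.exists_semilinear (hK : IsPrimitiveQuarticCMField K)
    (hω : Algebra.adjoin ℤ {ω} = ⊤) {A : PPAV 2} {ψ₁ ψ₂ χ₁ χ₂ : K →+* ℂ} {z z' : K}
    (hp : IsPair ω ψ₁ ψ₂) (hp' : IsPair ω χ₁ χ₂) (h : IsUniformizedBy A ω ψ₁ ψ₂ z)
    (h' : IsUniformizedBy A ω χ₁ χ₂ z') {C C' : ClassGroup (𝓞 K)} (hC : IsIdealClassOf z C)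
    (hC' : IsIdealClassOf z' C') :
    ∃ s : K ≃ₐ[ℚ] K, ((∀ x, χ₁ (s x) = ψ₁ x) ∧ (∀ x, χ₂ (s x) = ψ₂ x) ∨
        (∀ x, χ₁ (s x) = ψ₂ x) ∧ (∀ x, χ₂ (s x) = ψ₁ x)) ∧
      (χ₁ = ψ₁ → χ₂ = ψ₂ → (∀ x, s x = x) → ∃ κ, κ ≠ 0 ∧
        (∀ x, κ * x ∈ idealSet z' ↔ x ∈ idealSet z) ∧
        z' - IsCMField.complexConj K z' =
          κ * IsCMField.complexConj K κ * (z - IsCMField.complexConj K z)) := by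
  have h2 := hK.finrank_real
  have hpos := h.pos.1
  have hpos' := h'.pos.1
  obtain ⟨F, hF, hE⟩ := h
  obtain ⟨G, hG, hE'⟩ := h'
  obtain ⟨𝔞, h𝔞⟩ := hC.exists_submodule
  obtain ⟨𝔟, h𝔟⟩ := hC'.exists_submodule
  rw [← h𝔞] at hF
  rw [← h𝔟] at hG
  have hvec : ∀ (σ τ : K →+* ℂ) (n : ℤ) (y : K), ![σ (n * y), τ (n * y)] = n • ![σ y, τ y] := by
    intro σ τ n y; ext i; fin_cases i <;> simp
  have hT : ∀ y, ∃ x, G (F.symm ![ψ₁ y, ψ₂ y]) = ![χ₁ x, χ₂ x] := by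
    intro y
    obtain ⟨n, hn, hny⟩ := hF.exists_int_mul_mem y
    obtain ⟨x, hx, hGx⟩ := (hG _).1 ((hF.mem_iff _).2 hny)
    have hn' : (n : K) ≠ 0 := by exact_mod_cast hn
    refine ⟨x / n, ?_⟩
    have e := hvec χ₁ χ₂ n (x / n)
    rw [mul_div_cancel₀ _ hn', ← hGx, hvec, map_zsmul, map_zsmul] at e
    exact smul_right_injective _ hn e
  choose T hT using hT
  set M : (Fin 2 → ℂ) → (Fin 2 → ℂ) := fun v => G (F.symm v) with hM
  have hMl : ∀ (a b : ℂ) i, M ![a, b] i = M ![1, 0] i * a + M ![0, 1] i * b := by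
    intro a b i
    have : (![a, b] : Fin 2 → ℂ) = a • ![1, 0] + b • ![0, 1] := by
      ext j; fin_cases j <;> simp
    rw [hM, this]
    simp only [map_add, map_smul, Pi.add_apply, Pi.smul_apply, smul_eq_mul]
    ring
  have hT₁ : ∀ y, χ₁ (T y) = M ![1, 0] 0 * ψ₁ y + M ![0, 1] 0 * ψ₂ y := by
    intro y; rw [← hMl]; simp [hM, hT]
  have hT₂ : ∀ y, χ₂ (T y) = M ![1, 0] 1 * ψ₁ y + M ![0, 1] 1 * ψ₂ y := by
    intro y; rw [← hMl]; simp [hM, hT]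
  have hT0 : T 1 ≠ 0 := by
    intro h0
    have e := hT 1
    have e0 : (![0, 0] : Fin 2 → ℂ) = 0 := by ext i; fin_cases i <;> rfl
    simp only [h0, map_zero, e0, map_one] at e
    rw [LinearEquiv.map_eq_zero_iff, LinearEquiv.map_eq_zero_iff] at e
    simpa using congrFun e 0
  obtain ⟨κ, s, hκ, hTs, hs⟩ := hK.semilinear hω hp hp' hT0 hT₁ hT₂
  refine ⟨s, hs, ?_⟩
  rintro rfl rfl hs1
  simp only [hs1] at hTs
  have hi := hp.independent h2 hω (a := χ₁ κ - M ![1, 0] 0) (b := -M ![0, 1] 0) (c := 0) (d := 0)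
    (fun x => by
      have := hT₁ x
      rw [hTs, map_mul] at this
      linear_combination this)
  have hi' := hp.independent h2 hω (a := - M ![1, 0] 1) (b := χ₂ κ - M ![0, 1] 1) (c := 0)
    (d := 0) (fun x => by
      have := hT₂ x
      rw [hTs, map_mul] at this
      linear_combination this)
  refine ⟨κ, hκ, fun x => ?_, ?_⟩
  · rw [← h𝔞, ← h𝔟, SetLike.mem_coe, SetLike.mem_coe, ← hF.mem_iff, ← hG.mem_iff, ← hTs, ← hT,
      LinearEquiv.symm_apply_apply]
  · have e10 : M ![1, 0] 0 = χ₁ κ := by linear_combination -hi.1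
    have e11 : M ![1, 0] 1 = 0 := by linear_combination -hi'.1
    -- Comparing the two forms at (i e₁, e₁) gives Im χ₁(z') = |χ₁(κ)|² Im χ₁(z). One embedding
    -- suffices, since it is injective on K.
    have e := hE (F.symm (Complex.I • ![1, 0])) (F.symm ![1, 0])
    rw [hE', map_smul, map_smul] at e
    simp only [standardForm, LinearEquiv.apply_symm_apply, Pi.smul_apply, smul_eq_mul] at e
    change (Complex.I * M ![1, 0] 0 * (starRingEnd ℂ) (M ![1, 0] 0)).im / _ +
      (Complex.I * M ![1, 0] 1 * (starRingEnd ℂ) (M ![1, 0] 1)).im / _ = _ at e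
    rw [e10, e11, mul_assoc, Complex.mul_conj] at e
    simp at e
    have hd : (χ₁ (delta ω)).re ≠ 0 := fun h0 => by rw [h0, zero_mul] at hpos; exact lt_irrefl _ hpos
    have hz : (χ₁ z).im ≠ 0 := fun h0 => by rw [h0, mul_zero] at hpos; exact lt_irrefl _ hpos
    have hz' : (χ₁ z').im ≠ 0 := fun h0 => by rw [h0, mul_zero] at hpos'; exact lt_irrefl _ hpos'
    have him : (χ₁ z').im = Complex.normSq (χ₁ κ) * (χ₁ z).im := by
      field_simp at e
      linear_combination -e
    apply χ₁.injective
    rw [map_mul, map_mul, sub_conj_im, sub_conj_im, embedding_conj, Complex.mul_conj, him]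
    push_cast
    ring

end

/-! ### Representatives of CM types and the complete sets. -/

section

variable {K : Type*} [Field K] [NumberField K] [IsCMField K] {ω : 𝓞 (maximalRealSubfield K)}

/-- A system of representatives `G` of the pairs of embeddings, up to automorphisms of `K` and
exchange, yields a complete set of period matrices. -/
theorem isCompleteSet_of_pairs (hK : IsPrimitiveQuarticCMField K)
    (hω : Algebra.adjoin ℤ {ω} = ⊤) {ε : (𝓞 (maximalRealSubfield K))ˣ}
    (hε : Odd (Subgroup.closure ({-1, ε} : Set (𝓞 (maximalRealSubfield K))ˣ)).index)
    {R : Set K} (hR : RepresentsIdealClasses R) (G : (K →+* ℂ) → (K →+* ℂ) → Prop)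
    (hG : ∀ ψ₁ ψ₂, G ψ₁ ψ₂ → (ψ₂ (realInt ω)).re < (ψ₁ (realInt ω)).re)
    (hex : ∀ ψ₁ ψ₂, IsPair ω ψ₁ ψ₂ → ∃ (χ₁ χ₂ : K →+* ℂ) (s : K ≃ₐ[ℚ] K), G χ₁ χ₂ ∧
      ((∀ x, ψ₁ (s x) = χ₁ x) ∧ (∀ x, ψ₂ (s x) = χ₂ x) ∨
        (∀ x, ψ₁ (s x) = χ₂ x) ∧ (∀ x, ψ₂ (s x) = χ₁ x)))
    (huniq : ∀ (ψ₁ ψ₂ χ₁ χ₂ : K →+* ℂ) (s : K ≃ₐ[ℚ] K), G ψ₁ ψ₂ → G χ₁ χ₂ →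
      ((∀ x, χ₁ (s x) = ψ₁ x) ∧ (∀ x, χ₂ (s x) = ψ₂ x) ∨
        (∀ x, χ₁ (s x) = ψ₂ x) ∧ (∀ x, χ₂ (s x) = ψ₁ x)) →
      χ₁ = ψ₁ ∧ χ₂ = ψ₂ ∧ ∀ x, s x = x)
    (S : Set (Matrix (Fin 2) (Fin 2) ℂ))
    (hS : ∀ Z, Z ∈ S ↔ ∃ z ∈ signedMultiples ε R, ∃ ψ₁ ψ₂ : K →+* ℂ, G ψ₁ ψ₂ ∧
      0 < (ψ₁ z).im ∧ (ψ₂ z).im < 0 ∧ Z = embeddingSumMatrix ω ψ₁ ψ₂ z) :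
    IsCompleteSetOfCMPeriodMatrices S K := by
  have h2 := hK.finrank_real
  have hSH : S ⊆ siegelUpperHalfSpace 2 := by
    intro Z hZ
    obtain ⟨z, hz, ψ₁, ψ₂, hψ, h₁, h₂, rfl⟩ := (hS Z).1 hZ
    exact embeddingSumMatrix_mem h2 (hG _ _ hψ) h₁ h₂
  refine ⟨hSH, fun Z hZ => ?_, fun A hA => ?_⟩
  · obtain ⟨z, hz, ψ₁, ψ₂, hψ, h₁, h₂, hZz⟩ := (hS Z).1 hZ
    obtain ⟨F, hF, -⟩ := isUniformizedBy_ofPeriodMatrix h2 hω (hG _ _ hψ) h₁ h₂ (hSH hZ) hZz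
    obtain ⟨z', hz', u, -, rfl⟩ := mem_signedMultiples.1 hz
    obtain ⟨C, hC⟩ := hR.1 z' hz'
    obtain ⟨𝔞, h𝔞⟩ := hC.exists_submodule
    rw [idealSet_unit_mul, ← h𝔞] at hF
    exact hF.hasCM hK.finrank_eq fun a x hx => 𝔞.smul_mem a hx
  · obtain ⟨ψ₁, ψ₂, 𝔞, F, hp, hF⟩ := hA.exists_uniformizes hω
    obtain ⟨χ₁, χ₂, s, hχ, hs⟩ := hex ψ₁ ψ₂ hp
    have hlt := hG _ _ hχ
    obtain ⟨𝔟, F', hF'⟩ : ∃ (𝔟 : Submodule (𝓞 K) K) (F' : (Fin 2 → ℂ) ≃ₗ[ℂ] (Fin 2 → ℂ)),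
        Uniformizes A χ₁ χ₂ (𝔟 : Set K) F' := by
      rcases hs with ⟨hs₁, hs₂⟩ | ⟨hs₁, hs₂⟩
      · obtain ⟨𝔟, h𝔟⟩ := hF.comp_aut s hs₁ hs₂
        exact ⟨𝔟, F, h𝔟⟩
      · obtain ⟨𝔟, h𝔟⟩ := hF.comp_aut s hs₁ hs₂
        obtain ⟨F', hF'⟩ := h𝔟.swap
        exact ⟨𝔟, F', hF'⟩
    obtain ⟨z₀, hz₀, C, hC⟩ := hF'.exists_isUniformizedBy hK hω (isPair_of_re_lt hlt)
    obtain ⟨z, hz, hAz⟩ := hz₀.exists_signedMultiple hε hR hC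
    obtain ⟨h₁, h₂⟩ := hAz.im_pos h2 hlt
    have hZ : embeddingSumMatrix ω χ₁ χ₂ z ∈ S := (hS _).2 ⟨z, hz, χ₁, χ₂, hχ, h₁, h₂, rfl⟩
    refine ⟨⟨_, hZ⟩, hAz.isomorphic
      (isUniformizedBy_ofPeriodMatrix h2 hω hlt h₁ h₂ (hSH hZ) rfl), ?_⟩
    -- Uniqueness: A is uniformized by z and by z'. The choice of G fixes the embeddings, R fixes
    -- the ideal representative y, and only the unit factors u and u' remain to be compared.
    rintro ⟨Z', hZ'⟩ hiso
    apply Subtype.ext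
    change Z' = embeddingSumMatrix ω χ₁ χ₂ z
    obtain ⟨z', hz', τ₁, τ₂, hτ, h₁', h₂', hZz'⟩ := (hS Z').1 hZ'
    have hAz' := (isUniformizedBy_ofPeriodMatrix h2 hω (hG _ _ hτ) h₁' h₂' (hSH hZ')
      hZz').of_isomorphic hiso
    obtain ⟨y, hy, u, hu, rfl⟩ := mem_signedMultiples.1 hz
    obtain ⟨y', hy', u', hu', rfl⟩ := mem_signedMultiples.1 hz'
    obtain ⟨C, hC⟩ := hR.1 y hy
    obtain ⟨C', hC'⟩ := hR.1 y' hy'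
    obtain ⟨s, hs, hrel⟩ := hAz.exists_semilinear hK hω (isPair_of_re_lt hlt)
      (isPair_of_re_lt (hG _ _ hτ)) hAz' (hC.of_idealSet_eq (idealSet_unit_mul u y))
      (hC'.of_idealSet_eq (idealSet_unit_mul u' y'))
    obtain ⟨rfl, rfl, hs1⟩ := huniq _ _ _ _ s hχ hτ hs
    obtain ⟨κ, hκ, hab, hsub⟩ := hrel rfl rfl hs1
    rw [idealSet_unit_mul, idealSet_unit_mul] at hab
    obtain rfl := hC.of_mul hC' hκ hab
    obtain rfl : y' = y := (hR.2 C' ⟨y, hC⟩).unique ⟨hy', hC'⟩ ⟨hy, hC⟩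
    obtain ⟨k, rfl⟩ := hC.exists_unit hκ hab
    have hne : y' - IsCMField.complexConj K y' ≠ 0 := by
      intro h0
      apply hAz.ne_conj
      rw [map_mul, conj_realInt, ← mul_sub, h0, mul_zero]
    have hk : realInt (u' : 𝓞 (maximalRealSubfield K)) =
        (k : 𝓞 K) * IsCMField.complexConj K (k : 𝓞 K) *
          realInt (u : 𝓞 (maximalRealSubfield K)) := by
      apply mul_right_cancel₀ hne
      simp only [map_mul, conj_realInt] at hsub
      linear_combination hsub
    -- The multiplier preserves the ideal and is therefore a unit k of K, with k k̄ = u'/u. This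
    -- relative norm is a square, while ±1, ±ε are distinct modulo squares.
    obtain ⟨r, hr⟩ := hK.norm_unit_eq_sq hω k (u' * u⁻¹) (by
      rw [Units.val_mul, map_mul, hk, mul_assoc, realInt_unit_mul_inv, mul_one])
    have huu : u' = u := eq_of_eq_mul_sq hK.finrank_eq hε hu hu' (r := r) (by
      rw [← hr, mul_comm, inv_mul_cancel_right])
    rw [hZz', huu]

/-- Conjugation does not change the value at ω, so if φ₁ and φ₂ agreed there, all embeddings would.
-/
theorem IsCMType.isPair (h4 : Module.finrank ℚ K = 4) (hω : Algebra.adjoin ℤ {ω} = ⊤)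
    {φ₁ φ₂ : K →+* ℂ} (hφ : IsCMType ({φ₁, φ₂} : Set (K →+* ℂ))) : IsPair ω φ₁ φ₂ := by
  intro h
  obtain ⟨σ, hσ⟩ := exists_isPair h4 hω φ₁
  have hmem : σ ∈ ({φ₁, φ₂} ∪ ComplexEmbedding.conjugate '' {φ₁, φ₂} : Set (K →+* ℂ)) := by
    rw [hφ.2]; trivial
  apply hσ
  rcases hmem with (rfl | rfl) | ⟨τ, rfl | rfl, rfl⟩
  · rfl
  · exact h
  · rw [conjugate_realInt]
  · rw [conjugate_realInt]; exact h

theorem IsPair.lt_or_lt {φ₁ φ₂ : K →+* ℂ} (h : IsPair ω φ₁ φ₂) :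
    (φ₂ (realInt ω)).re < (φ₁ (realInt ω)).re ∨ (φ₁ (realInt ω)).re < (φ₂ (realInt ω)).re := by
  rcases lt_trichotomy (φ₂ (realInt ω)).re (φ₁ (realInt ω)).re with h' | h' | h'
  · exact Or.inl h'
  · refine absurd ?_ h
    rw [embedding_real_eq φ₁ (conj_realInt ω), embedding_real_eq φ₂ (conj_realInt ω), h']
  · exact Or.inr h'

/-- Two ordered pairs agree on the real subfield. -/
theorem realInt_eq_of_lt (h2 : Module.finrank ℚ (maximalRealSubfield K) = 2)
    {ψ₁ ψ₂ χ₁ χ₂ : K →+* ℂ} (h : (ψ₂ (realInt ω)).re < (ψ₁ (realInt ω)).re)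
    (h' : (χ₂ (realInt ω)).re < (χ₁ (realInt ω)).re) :
    χ₁ (realInt ω) = ψ₁ (realInt ω) ∧ χ₂ (realInt ω) = ψ₂ (realInt ω) := by
  have hp := isPair_of_re_lt h
  rcases hp.eq_or_eq h2 χ₁ with e | e <;> rcases hp.eq_or_eq h2 χ₂ with e' | e'
  · rw [e, e'] at h'; exact absurd h' (lt_irrefl _)
  · exact ⟨e, e'⟩
  · rw [e, e'] at h'; exact absurd h' h.not_gt
  · rw [e, e'] at h'; exact absurd h' (lt_irrefl _)

/-- Such an s would be an involution, hence would fix ω, against the difference of the two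
embeddings on ω. -/
theorem IsPrimitiveQuarticCMField.not_swap (hK : IsPrimitiveQuarticCMField K)
    (hω : Algebra.adjoin ℤ {ω} = ⊤) {ψ₁ ψ₂ : K →+* ℂ} (hp : IsPair ω ψ₁ ψ₂) (s : K ≃ₐ[ℚ] K)
    (h₁ : ∀ x, ψ₁ (s x) = ψ₂ x) (h₂ : ∀ x, ψ₂ (s x) = ψ₁ x) : False := by
  have hs := hK.fixes_of_involutive hω (s := s) (fun x => ψ₁.injective (by rw [h₁, h₂]))
  apply hp
  rw [← h₁, hs]

/-- In the Galois case, every pair of embeddings is equivalent to a given one. -/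
theorem IsPrimitiveQuarticCMField.exists_aut (hK : IsPrimitiveQuarticCMField K)
    (hω : Algebra.adjoin ℤ {ω} = ⊤) [IsGalois ℚ K] {ψ₁ ψ₂ τ₁ τ₂ : K →+* ℂ}
    (hp : IsPair ω ψ₁ ψ₂) (hτ : IsPair ω τ₁ τ₂) : ∃ s : K ≃ₐ[ℚ] K,
      (∀ x, ψ₁ (s x) = τ₁ x) ∧ (∀ x, ψ₂ (s x) = τ₂ x) ∨
        (∀ x, ψ₁ (s x) = τ₂ x) ∧ (∀ x, ψ₂ (s x) = τ₁ x) := by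
  have h2 := hK.finrank_real
  have hex : ∀ σ τ : K →+* ℂ, ∃ s : K ≃ₐ[ℚ] K, ∀ x, σ (s x) = τ x := by
    intro σ τ
    obtain ⟨s, hs⟩ := ComplexEmbedding.exists_comp_symm_eq_of_comp_eq (k := ℚ) σ τ
      (Subsingleton.elim _ _)
    exact ⟨s.symm, fun x => RingHom.congr_fun hs x⟩
  -- Once s matches the first embeddings, the second ones agree on K₀, since the two values of ω
  -- have sum t. So they agree up to conjugation.
  have key : ∀ {σ₁ σ₂ : K →+* ℂ}, IsPair ω σ₁ σ₂ → ∀ s : K ≃ₐ[ℚ] K,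
      (∀ x, σ₁ (s x) = τ₁ x) → (∀ x, σ₂ (s x) = τ₂ x) ∨
        ∀ x, σ₂ (s x) = (starRingEnd ℂ) (τ₂ x) := by
    intro σ₁ σ₂ hσ s hs
    obtain ⟨t, n, hq, -⟩ := exists_sq_eq h2 ω
    have hw : (σ₂.comp (s : K →+* K)) (realInt ω) = τ₂ (realInt ω) := by
      change σ₂ (s (realInt ω)) = _
      have e := hτ.add_eq hq
      rw [← hs] at e
      have e' := hσ.add_eq hq
      rcases aut_realInt s hq with h | h
      · rw [h] at e ⊢; linear_combination e' - e
      · rw [h] at e ⊢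
        simp only [map_sub, map_intCast] at e ⊢
        linear_combination -e' - e
    refine (embedding_eq_or h2 hω hw).imp (fun h x => RingHom.congr_fun h x) (fun h x => ?_)
    rw [← conj_conjugate_apply, ← h]; rfl
  obtain ⟨s₁, hs₁⟩ := hex ψ₁ τ₁
  obtain ⟨s₂, hs₂⟩ := hex ψ₂ τ₁
  rcases key hp s₁ hs₁ with h | h
  · exact ⟨s₁, Or.inl ⟨hs₁, h⟩⟩
  rcases key hp.symm s₂ hs₂ with h' | h'
  · exact ⟨s₂, Or.inr ⟨h', hs₂⟩⟩
  -- If both attempts to match `τ₁` miss `τ₂` by conjugation, then s₁s₂⁻¹ exchanges `ψ₁` and `ψ₂`.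
  exfalso
  refine hK.not_swap hω hp (s₁ * s₂⁻¹) (fun x => ?_) (fun x => ?_)
  · change ψ₁ (s₁ (s₂.symm x)) = ψ₂ x
    rw [hs₁, ← hs₂, AlgEquiv.apply_symm_apply]
  · change ψ₂ (s₁ (s₂.symm x)) = ψ₁ x
    rw [h, ← h', AlgEquiv.apply_symm_apply]

theorem embedding_eq_of_im_pos (h2 : Module.finrank ℚ (maximalRealSubfield K) = 2)
    (hω : Algebra.adjoin ℤ {ω} = ⊤) {σ τ : K →+* ℂ} (h : σ (realInt ω) = τ (realInt ω)) {z : K}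
    (hz : 0 < (σ z).im * (τ z).im) : σ = τ := by
  rcases embedding_eq_or h2 hω h with h' | h'
  · exact h'
  · rw [h', conj_conjugate_apply, Complex.conj_im] at hz
    nlinarith [sq_nonneg (τ z).im]

/-- All pairs of embeddings are equivalent under automorphisms, so G consists of a single pair,
ordered by the values at ω. -/
theorem isCompleteSet_of_isGalois (hK : IsPrimitiveQuarticCMField K)
    (hω : Algebra.adjoin ℤ {ω} = ⊤) {φ₁ φ₂ : K →+* ℂ} (hφ : IsPair ω φ₁ φ₂)
    {ε : (𝓞 (maximalRealSubfield K))ˣ}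
    (hε : Odd (Subgroup.closure ({-1, ε} : Set (𝓞 (maximalRealSubfield K))ˣ)).index)
    {R : Set K} (hR : RepresentsIdealClasses R) [IsGalois ℚ K] :
    IsCompleteSetOfCMPeriodMatrices
      {Z : Matrix (Fin 2) (Fin 2) ℂ | ∃ z ∈ signedMultiples ε R,
        0 < (φ₁ z).im ∧ (φ₂ z).im < 0 ∧ IsPeriodMatrixOf ω z Z} K := by
  have h2 := hK.finrank_real
  obtain ⟨τ₁, τ₂, hlt, hτ⟩ : ∃ τ₁ τ₂ : K →+* ℂ, (τ₂ (realInt ω)).re < (τ₁ (realInt ω)).re ∧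
      ∀ z, 0 < (φ₁ z).im ∧ (φ₂ z).im < 0 ↔ 0 < (τ₁ z).im ∧ (τ₂ z).im < 0 := by
    rcases hφ.lt_or_lt with h | h
    · exact ⟨φ₁, φ₂, h, fun z => Iff.rfl⟩
    -- If φ₁, φ₂ are in the wrong order at ω, exchanging and conjugating them restores the order and
    -- leaves the two sign conditions unchanged as a whole.
    · refine ⟨ComplexEmbedding.conjugate φ₂, ComplexEmbedding.conjugate φ₁, ?_, fun z => ?_⟩
      · rwa [conjugate_realInt, conjugate_realInt]
      · rw [conj_conjugate_apply, conj_conjugate_apply, Complex.conj_im, Complex.conj_im,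
          neg_pos, neg_lt_zero, and_comm]
  have hp := isPair_of_re_lt hlt
  refine isCompleteSet_of_pairs hK hω hε hR (fun ψ₁ ψ₂ => ψ₁ = τ₁ ∧ ψ₂ = τ₂) ?_ ?_ ?_ _ ?_
  · rintro _ _ ⟨rfl, rfl⟩; exact hlt
  · intro ψ₁ ψ₂ hψ
    obtain ⟨s, hs⟩ := hK.exists_aut hω hψ hp
    exact ⟨τ₁, τ₂, s, ⟨rfl, rfl⟩, hs⟩
  · rintro _ _ _ _ s ⟨rfl, rfl⟩ ⟨rfl, rfl⟩ (⟨h₁, -⟩ | ⟨h₁, h₂⟩)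
    · exact ⟨rfl, rfl, fun x => RingHom.injective _ (h₁ x)⟩
    · exact (hK.not_swap hω hp s h₁ h₂).elim
  · refine fun Z => exists_congr fun z => and_congr_right fun _ => ?_
    rw [← and_assoc, hτ]
    constructor
    · rintro ⟨⟨h₁, h₂⟩, ψ₁, ψ₂, hψ, h₁', h₂', rfl⟩
      obtain ⟨e₁, e₂⟩ := realInt_eq_of_lt h2 hlt hψ
      exact ⟨ψ₁, ψ₂, ⟨embedding_eq_of_im_pos h2 hω e₁ (mul_pos h₁' h₁),
        embedding_eq_of_im_pos h2 hω e₂ (mul_pos_of_neg_of_neg h₂' h₂)⟩, h₁', h₂', rfl⟩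
    · rintro ⟨_, _, ⟨rfl, rfl⟩, h₁, h₂, rfl⟩
      exact ⟨⟨h₁, h₂⟩, _, _, hlt, h₁, h₂, rfl⟩

/-- There are four ordered pairs, and the only nontrivial automorphism, complex conjugation, groups
them in twos. Requiring ψ₁ = φ or ψ₂ = φ̄ picks one pair from each group, and it expresses the
condition Im φ(z) > 0. -/
theorem isCompleteSet_of_not_isGalois (hK : IsPrimitiveQuarticCMField K)
    (hω : Algebra.adjoin ℤ {ω} = ⊤) (φ : K →+* ℂ)
    {ε : (𝓞 (maximalRealSubfield K))ˣ}
    (hε : Odd (Subgroup.closure ({-1, ε} : Set (𝓞 (maximalRealSubfield K))ˣ)).index)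
    {R : Set K} (hR : RepresentsIdealClasses R) (hG : ¬ IsGalois ℚ K) :
    IsCompleteSetOfCMPeriodMatrices
      {Z : Matrix (Fin 2) (Fin 2) ℂ | ∃ z ∈ signedMultiples ε R,
        0 < (φ z).im ∧ IsPeriodMatrixOf ω z Z} K := by
  have h2 := hK.finrank_real
  have hcc : ∀ σ : K →+* ℂ, ComplexEmbedding.conjugate (ComplexEmbedding.conjugate σ) = σ :=
    fun σ => RingHom.ext fun x => by simp
  let c : K ≃ₐ[ℚ] K := (IsCMField.complexConj K).restrictScalars ℚ
  have hc : ∀ (σ : K →+* ℂ) x, σ (c x) = ComplexEmbedding.conjugate σ x := fun σ x => by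
    rw [conj_conjugate_apply]; exact embedding_conj σ x
  refine isCompleteSet_of_pairs hK hω hε hR (fun ψ₁ ψ₂ =>
    (ψ₂ (realInt ω)).re < (ψ₁ (realInt ω)).re ∧
      (ψ₁ = φ ∨ ψ₂ = ComplexEmbedding.conjugate φ)) (fun _ _ h => h.1) ?_ ?_ _ ?_
  · have key : ∀ ψ₁ ψ₂ : K →+* ℂ, (ψ₂ (realInt ω)).re < (ψ₁ (realInt ω)).re →
        ∃ (χ₁ χ₂ : K →+* ℂ) (s : K ≃ₐ[ℚ] K), ((χ₂ (realInt ω)).re < (χ₁ (realInt ω)).re ∧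
          (χ₁ = φ ∨ χ₂ = ComplexEmbedding.conjugate φ)) ∧
          (∀ x, ψ₁ (s x) = χ₁ x) ∧ (∀ x, ψ₂ (s x) = χ₂ x) := by
      intro ψ₁ ψ₂ h
      have h' : (ComplexEmbedding.conjugate ψ₂ (realInt ω)).re <
          (ComplexEmbedding.conjugate ψ₁ (realInt ω)).re := by
        rwa [conjugate_realInt, conjugate_realInt]
      rcases (isPair_of_re_lt h).cases h2 hω φ with rfl | rfl | rfl | rfl
      · exact ⟨φ, ψ₂, AlgEquiv.refl, ⟨h, Or.inl rfl⟩, fun _ => rfl, fun _ => rfl⟩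
      · exact ⟨_, _, c, ⟨h', Or.inr rfl⟩, hc _, hc _⟩
      · exact ⟨_, _, c, ⟨h', Or.inl rfl⟩, hc _, hc _⟩
      · exact ⟨ψ₁, ψ₂, AlgEquiv.refl, ⟨h, Or.inr (hcc _).symm⟩, fun _ => rfl, fun _ => rfl⟩
    intro ψ₁ ψ₂ hp
    rcases hp.lt_or_lt with h | h
    · obtain ⟨χ₁, χ₂, s, hχ, hs⟩ := key _ _ h
      exact ⟨χ₁, χ₂, s, hχ, Or.inl hs⟩
    · obtain ⟨χ₁, χ₂, s, hχ, hs⟩ := key _ _ h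
      exact ⟨χ₁, χ₂, s, hχ, Or.inr hs.symm⟩
  · rintro ψ₁ ψ₂ χ₁ χ₂ s ⟨hψ, hψφ⟩ ⟨hχ, hχφ⟩ hs
    obtain ⟨e₁, e₂⟩ := realInt_eq_of_lt h2 hψ hχ
    have hp := isPair_of_re_lt hψ
    have hsw : s (realInt ω) = realInt ω := by
      rcases aut_eq_or_of_not_isGalois hK.finrank_eq hω hG s with h | h
      · exact h _
      · rw [h, conj_realInt]
    have hs' : (∀ x, χ₁ (s x) = ψ₁ x) ∧ (∀ x, χ₂ (s x) = ψ₂ x) := by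
      rcases hs with hs | hs
      · exact hs
      · have := hs.1 (realInt ω)
        rw [hsw, e₁] at this
        exact absurd this hp
    rcases aut_eq_or_of_not_isGalois hK.finrank_eq hω hG s with h | h
    · simp only [h] at hs'
      exact ⟨RingHom.ext hs'.1, RingHom.ext hs'.2, h⟩
    · exfalso
      have h₁ : ψ₁ = ComplexEmbedding.conjugate χ₁ := RingHom.ext fun x => by
        rw [← hs'.1, h]; exact hc χ₁ x
      have h₂ : ψ₂ = ComplexEmbedding.conjugate χ₂ := RingHom.ext fun x => by
        rw [← hs'.2, h]; exact hc χ₂ x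
      rcases hψφ with hψφ | hψφ <;> rcases hχφ with hχφ | hχφ
      · rw [hψφ, hχφ] at h₁
        exact conjugate_ne φ h₁.symm
      · apply hp
        rw [hψφ, ← e₂, hχφ, conjugate_realInt]
      · apply hp
        rw [hψφ, ← e₁, hχφ, conjugate_realInt]
      · exact conjugate_ne φ (by rw [← hψφ, h₂, hχφ, hcc])
  · refine fun Z => exists_congr fun z => and_congr_right fun _ => ?_
    constructor
    · rintro ⟨h, ψ₁, ψ₂, hψ, h₁, h₂, rfl⟩
      refine ⟨ψ₁, ψ₂, ⟨hψ, ?_⟩, h₁, h₂, rfl⟩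
      -- φ agrees on K₀ with `ψ₁` or with `ψ₂`. Since Im ψ₁(z) > 0 > Im ψ₂(z), the sign of Im φ(z)
      -- forces ψ₁ = φ in the first case and ψ₂ = φ̄ in the second.
      rcases (isPair_of_re_lt hψ).eq_or_eq h2 φ with e | e
      · exact Or.inl (embedding_eq_of_im_pos h2 hω e.symm (mul_pos h₁ h))
      · refine Or.inr (embedding_eq_of_im_pos (z := z) h2 hω (by rw [conjugate_realInt, e]) ?_)
        rw [conj_conjugate_apply, Complex.conj_im]
        nlinarith
    · rintro ⟨ψ₁, ψ₂, ⟨hψ, hφ⟩, h₁, h₂, rfl⟩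
      refine ⟨?_, ψ₁, ψ₂, hψ, h₁, h₂, rfl⟩
      rcases hφ with rfl | rfl
      · exact h₁
      · rw [conj_conjugate_apply, Complex.conj_im] at h₂
        linarith

end

end CMSurface

end

theorem mainTheorem9 (K : Type*) [Field K] [NumberField K]
    (hK : CMSurface.IsPrimitiveQuarticCMField K)
    (ω : 𝓞 (maximalRealSubfield K)) (hω : Algebra.adjoin ℤ {ω} = ⊤)
    (φ₁ φ₂ : K →+* ℂ) (hφ : CMSurface.IsCMType ({φ₁, φ₂} : Set (K →+* ℂ)))
    (ε : (𝓞 (maximalRealSubfield K))ˣ)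
    (hε : Odd (Subgroup.closure ({-1, ε} : Set (𝓞 (maximalRealSubfield K))ˣ)).index)
    (R : Set K) (hR : CMSurface.RepresentsIdealClasses R) :
    (IsGalois ℚ K → IsCyclic (K ≃ₐ[ℚ] K) →
      CMSurface.IsCompleteSetOfCMPeriodMatrices
        {Z : Matrix (Fin 2) (Fin 2) ℂ | ∃ z ∈ CMSurface.signedMultiples ε R,
          0 < (φ₁ z).im ∧ (φ₂ z).im < 0 ∧ CMSurface.IsPeriodMatrixOf ω z Z} K) ∧
    (¬ IsGalois ℚ K →
      CMSurface.IsCompleteSetOfCMPeriodMatrices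
        {Z : Matrix (Fin 2) (Fin 2) ℂ | ∃ z ∈ CMSurface.signedMultiples ε R,
          0 < (φ₁ z).im ∧ CMSurface.IsPeriodMatrixOf ω z Z} K) := by
  have := hK.isCMField
  exact ⟨fun _ _ => CMSurface.isCompleteSet_of_isGalois hK hω (hφ.isPair hK.finrank_eq hω) hε hR,
    CMSurface.isCompleteSet_of_not_isGalois hK hω φ₁ hε hR⟩
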